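/- Let $M$ be a smooth 6-manifold and let $\pi: F\to M$ be its bundle of coframes, whose fibre $F_x$ consists of the linear isomorphisms $u:T_xM\to\mathbb{R}^6$. The group $\mathrm{GL}(6,\mathbb{R})$ acts on $F$ on the right by $u\cdot a=a^{-1}\circ u$. Identify $\mathbb{R}^6$ with $\mathbb{C}^3$ by $(x^1,\dots,x^6)\mapsto(x^1+ix^4,\,x^2+ix^5,\,x^3+ix^6)$, so that $\mathrm{SL}(3,\mathbb{C})\subset\mathrm{GL}(6,\mathbb{R})$, and let $\bar\pi:J=F/\mathrm{SL}(3,\mathbb{C})\to M$ be the quotient bundle, a manifold of dimension $26$. Let $\eta=(\eta^1,\dots,\eta^6)$ be the tautological 1-form on $F$, $\eta(v)=u(\pi'(v))$ for $v\in T_uF$. The complex 3-form $$\gamma=(\eta^1+i\eta^4)\wedge(\eta^2+i\eta^5)\wedge(\eta^3+i\eta^6)$$ is well defined on $J$. Let $\mathcal{J}\subset\Omega^*(J)$ be the ideal generated by (the real and imaginary parts of) $d\gamma$. A $p$-plane $E\subset T_zJ$ is an integral element of $\mathcal{J}$ if all forms in $\mathcal{J}$ vanish on $E$; $V_p(\mathcal{J})\subset\mathrm{Gr}_p(TJ)$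 is the space of the $p$-dimensional integral elements, and $V_p(\mathcal{J},\bar\pi)$ is the subspace of those $E$ on which $\bar\pi'$ is injective. The polar space $H(E)\subset T_zJ$ of an integral element $E\subset T_zJ$ is the union of all the integral elements of $\mathcal{J}$ that contain $E$; it is a linear subspace. An integral element $E\in V_p(\mathcal{J})$ is ordinary if there are finitely many $p$-forms $\varphi_1,\dots,\varphi_q\in\mathcal{J}$ and local coordinates $x$ on $J$ with $dx^1\wedge\dots\wedge dx^p\neq0$ on $E$, such that, in a neighborhood of $E$ in $\mathrm{Gr}_p(TJ)$, the functions $\hat\varphi_j$ defined by $\varphi_j|_{E'}=\hat\varphi_j(E')\,(dx^1\wedge\dots\wedge dx^p)|_{E'}$ have linearly independent differentials and $V_p(\mathcal{J})$ is the set of their common zeros. It is regular if it is ordinary and $\dim H$ is constant on a neighborhood of $E$ in $V_p(\mathcal{J})$. Let $(m_0,m_1,m_2,m_3,m_4,m_5,m_6)=(26,26,26,24,18,12,6)$ and $0\le p\le 6$. Then: 1. $\dim H(E)\ge m_p$ for every $E\in V_p(\mathcal{J},\bar\pi)$. 2. If $p\ne3,4$, then $\dim H(E)=m_p$ for every $E\in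 V_p(\mathcal{J},\bar\pi)$. 3. There is a dense open subset of $V_p(\mathcal{J},\bar\pi)$ such that $\dim H(E)=m_p$ for every $E$ in it. 4. Every $E\in V_p(\mathcal{J},\bar\pi)$ with $\dim H(E)=m_p$ is regular. -/

import Mathlib

open Set Filter Topology
open scoped Manifold ContDiff

noncomputable section

/-! ### Differential forms on a manifold -/

namespace EDS

section Forms

variable {E : Type*} [NormedAddCommGroup E] [NormedSpace ℝ E]
  {X : Type*} [TopologicalSpace X] [ChartedSpace E X]
  {F : Type*} [NormedAddCommGroup F] [NormedSpace ℝ F]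

/-- (Not necessarily smooth) `F`-valued differential `q`-forms on a manifold `X` modelled
on the vector space `E`. -/
abbrev DForm (E : Type*) [NormedAddCommGroup E] [NormedSpace ℝ E]
    (X : Type*) [TopologicalSpace X] [ChartedSpace E X] (q : ℕ)
    (F : Type*) [NormedAddCommGroup F] [NormedSpace ℝ F] :=
  ∀ x : X, TangentSpace 𝓘(ℝ, E) x [⋀^Fin q]→L[ℝ] F

/-- The expression of a form in the preferred chart at `x₀`: its pullback by the inverse of the
chart, a form on (the target of the chart in) the vector space `E`. -/
def inChart {q : ℕ} (θ : DForm E X q F) (x₀ : X) (y : E) : E [⋀^Fin q]→L[ℝ] F :=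
  (θ ((chartAt E x₀).symm y)).compContinuousLinearMap
    (mfderiv 𝓘(ℝ, E) 𝓘(ℝ, E) (chartAt E x₀).symm y)

/-- Smooth forms: those with smooth coefficients in the charts. -/
def IsSmoothForm {q : ℕ} (θ : DForm E X q F) : Prop :=
  ∀ x₀ : X, ContDiffOn ℝ ∞ (inChart θ x₀) (chartAt E x₀).target

/-- The exterior derivative of a form on a manifold; at `x` it is computed in the chart at `x`. -/
def extD {q : ℕ} (θ : DForm E X q F) : DForm E X (q + 1) F := fun x =>
  (extDeriv (inChart θ x) (chartAt E x x)).compContinuousLinearMap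
    (mfderiv 𝓘(ℝ, E) 𝓘(ℝ, E) (chartAt E x) x)

/-- The product `v ↦ α (v₁, …, v_a) β (v_{a+1}, …, v_{a+b})` of two alternating forms, a
multilinear form. -/
def mulForms {V : Type*} [AddCommGroup V] [Module ℝ V] [TopologicalSpace V] {a b : ℕ}
    (α : V [⋀^Fin a]→L[ℝ] ℝ) (β : V [⋀^Fin b]→L[ℝ] ℝ) :
    ContinuousMultilinearMap ℝ (fun _ : Fin (a + b) => V) ℝ where
  toMultilinearMap :=
    (LinearMap.mul' ℝ ℝ).compMultilinearMap
      ((MultilinearMap.domCoprod α.toMultilinearMap β.toMultilinearMap).domDomCongr finSumFinEquiv)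
  cont := by
    have h : Continuous fun v : Fin (a + b) → V =>
        α (fun i => v (Fin.castAdd b i)) * β (fun j => v (Fin.natAdd a j)) :=
      (α.coe_continuous.comp (by fun_prop)).mul (β.coe_continuous.comp (by fun_prop))
    convert! h using 2

theorem mulForms_apply {V : Type*} [AddCommGroup V] [Module ℝ V] [TopologicalSpace V] {a b : ℕ}
    (α : V [⋀^Fin a]→L[ℝ] ℝ) (β : V [⋀^Fin b]→L[ℝ] ℝ) (v : Fin (a + b) → V) :
    mulForms α β v = α (fun i => v (Fin.castAdd b i)) * β (fun j => v (Fin.natAdd a j)) :=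
  rfl

/-- The wedge product
`(α ∧ β)(v) = 1 / (a! b!) ∑_σ sign σ α(v_{σ 1}, …, v_{σ a}) β(v_{σ (a+1)}, …, v_{σ (a+b)})`. -/
def wedge {V : Type*} [AddCommGroup V] [Module ℝ V] [TopologicalSpace V] {a b : ℕ}
    (α : V [⋀^Fin a]→L[ℝ] ℝ) (β : V [⋀^Fin b]→L[ℝ] ℝ) : V [⋀^Fin (a + b)]→L[ℝ] ℝ :=
  ((a.factorial * b.factorial : ℕ) : ℝ)⁻¹ •
    ContinuousMultilinearMap.alternatization (mulForms α β)

/-- The ideal of the ring `Ω^*(X)` of smooth real differential forms generated by a family `G` of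
homogeneous forms, given through its homogeneous elements: the smallest family of forms
that contains `G` and is closed under addition and under multiplication by smooth forms. -/
inductive InIdeal (G : ∀ q : ℕ, Set (DForm E X q ℝ)) : ∀ q : ℕ, DForm E X q ℝ → Prop
  | gen {q : ℕ} (ψ : DForm E X q ℝ) : ψ ∈ G q → InIdeal G q ψ
  | zero (q : ℕ) : InIdeal G q 0
  | add {q : ℕ} (ψ ψ' : DForm E X q ℝ) : InIdeal G q ψ → InIdeal G q ψ' → InIdeal G q (ψ + ψ')
  | wedge_right {q r : ℕ} (ψ : DForm E X q ℝ) (α : DForm E X r ℝ) :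
      InIdeal G q ψ → IsSmoothForm α → InIdeal G (q + r) (fun x => wedge (ψ x) (α x))
  | wedge_left {q r : ℕ} (α : DForm E X r ℝ) (ψ : DForm E X q ℝ) :
      IsSmoothForm α → InIdeal G q ψ → InIdeal G (r + q) (fun x => wedge (α x) (ψ x))

/-- The homogeneous elements of the ideal generated by `G`, degree by degree. -/
def ideal (G : ∀ q : ℕ, Set (DForm E X q ℝ)) (q : ℕ) : Set (DForm E X q ℝ) :=
  {ψ | InIdeal G q ψ}

/-- A subspace `P` of a tangent space is an integral element of `I` if all the forms in `I`
vanish on it. -/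
def IsIntegralElement (I : ∀ q : ℕ, Set (DForm E X q ℝ)) {x : X}
    (P : Submodule ℝ (TangentSpace 𝓘(ℝ, E) x)) : Prop :=
  ∀ (q : ℕ) (ψ : DForm E X q ℝ), ψ ∈ I q →
    ∀ v : Fin q → TangentSpace 𝓘(ℝ, E) x, (∀ i, v i ∈ P) → ψ x v = 0

/-- The union of all the integral elements of `I` that contain `P`. -/
def polarSet (I : ∀ q : ℕ, Set (DForm E X q ℝ)) {x : X}
    (P : Submodule ℝ (TangentSpace 𝓘(ℝ, E) x)) : Set (TangentSpace 𝓘(ℝ, E) x) :=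
  {v | ∃ Q : Submodule ℝ (TangentSpace 𝓘(ℝ, E) x), IsIntegralElement I Q ∧ P ≤ Q ∧ v ∈ Q}

/-- The polar space `H(P)` as a linear subspace: the span of the union of all the integral elements
that contain `P`. By `coe_polarSpace` it is equal to that union if `P` is an integral element. -/
def polarSpace (I : ∀ q : ℕ, Set (DForm E X q ℝ)) {x : X}
    (P : Submodule ℝ (TangentSpace 𝓘(ℝ, E) x)) : Submodule ℝ (TangentSpace 𝓘(ℝ, E) x) :=
  Submodule.span ℝ (polarSet I P)

end Forms

section Polar

/-- An alternating form vanishes on `P + ℝ v` if and only if it vanishes whenever all its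
arguments are in `P`, or all but one, the remaining one being `v`. -/
theorem alternating_vanish_iff {V : Type*} [AddCommGroup V] [Module ℝ V] {q : ℕ}
    (f : V [⋀^Fin q]→ₗ[ℝ] ℝ) (P : Submodule ℝ V) (v : V) :
    (∀ u : Fin q → V, (∀ i, u i ∈ P ⊔ Submodule.span ℝ {v}) → f u = 0) ↔
      (∀ u : Fin q → V, (∀ i, u i ∈ P) → f u = 0) ∧
      ∀ (u : Fin q → V) (j : Fin q), (∀ i, u i ∈ P) → f (Function.update u j v) = 0 := by
  constructor
  · intro h
    refine ⟨fun u hu => h u fun i => Submodule.mem_sup_left (hu i), fun u j hu => h _ fun i => ?_⟩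
    by_cases hij : i = j
    · subst hij
      simpa using Submodule.mem_sup_right (Submodule.mem_span_singleton_self v)
    · simpa [hij] using Submodule.mem_sup_left (hu i)
  · rintro ⟨h0, h1⟩ u hu
    have hdec : ∀ i, ∃ p ∈ P, ∃ t : ℝ, u i = p + t • v := by
      intro i
      obtain ⟨p, hp, w, hw, hpw⟩ := Submodule.mem_sup.1 (hu i)
      obtain ⟨t, rfl⟩ := Submodule.mem_span_singleton.1 hw
      exact ⟨p, hp, t, hpw.symm⟩
    choose p hp t hu' using hdec
    have hsum : u = p + fun i => t i • v := funext hu'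
    rw [hsum]
    have := f.toMultilinearMap.map_add_univ p (fun i => t i • v)
    simp only [AlternatingMap.coe_multilinearMap] at this
    rw [this]
    refine Finset.sum_eq_zero fun s _ => ?_
    by_cases hs : ∃ i j, i ≠ j ∧ i ∉ s ∧ j ∉ s
    · obtain ⟨i, j, hij, hi, hj⟩ := hs
      refine f.map_linearDependent _ fun hli => ?_
      have hpair := hli.comp ![i, j] (by
        intro a b hab
        fin_cases a <;> fin_cases b <;> simp_all [eq_comm])
      have h2 : s.piecewise p (fun i => t i • v) ∘ ![i, j] = ![t i • v, t j • v] := by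
        funext a
        fin_cases a <;> simp [hi, hj]
      rw [h2, LinearIndependent.pair_iff] at hpair
      have h3 := hpair (t j) (-t i) (by rw [smul_smul, smul_smul, neg_mul, neg_smul, mul_comm]; simp)
      have h4 := hpair 1 0 (by simp [neg_eq_zero.1 h3.2])
      exact one_ne_zero h4.1
    · push Not at hs
      by_cases hs' : ∃ j, j ∉ s
      · obtain ⟨j, hj⟩ := hs'
        have h2 : s.piecewise p (fun i => t i • v) = Function.update p j (t j • v) := by
          funext i
          by_cases hij : i = j
          · subst hij; simp [hj]
          · have : i ∈ s := by
              by_contra hi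
              exact hi (hs j i (Ne.symm hij) hj)
            simp [this, hij]
        rw [h2, f.map_update_smul, h1 p j hp, smul_zero]
      · push Not at hs'
        have h2 : s.piecewise p (fun i => t i • v) = p := by
          funext i
          simp [hs' i]
        rw [h2]
        exact h0 p hp

variable {E : Type*} [NormedAddCommGroup E] [NormedSpace ℝ E]
  {X : Type*} [TopologicalSpace X] [ChartedSpace E X]

theorem mem_polarSet_iff (I : ∀ q : ℕ, Set (DForm E X q ℝ)) {x : X}
    (P : Submodule ℝ (TangentSpace 𝓘(ℝ, E) x)) (hP : IsIntegralElement I P)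
    (v : TangentSpace 𝓘(ℝ, E) x) :
    v ∈ polarSet I P ↔ ∀ (q : ℕ) (ψ : DForm E X q ℝ), ψ ∈ I q →
      ∀ (u : Fin q → TangentSpace 𝓘(ℝ, E) x) (j : Fin q), (∀ i, u i ∈ P) →
        ψ x (Function.update u j v) = 0 := by
  constructor
  · rintro ⟨Q, hQ, hPQ, hv⟩ q ψ hψ u j hu
    refine hQ q ψ hψ _ fun i => ?_
    by_cases hij : i = j
    · subst hij; simpa using hv
    · simpa [hij] using hPQ (hu i)
  · intro h
    refine ⟨P ⊔ Submodule.span ℝ {v}, fun q ψ hψ => ?_, le_sup_left,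
      Submodule.mem_sup_right (Submodule.mem_span_singleton_self v)⟩
    exact (alternating_vanish_iff (ψ x).toAlternatingMap P v).2 ⟨hP q ψ hψ, h q ψ hψ⟩

/-- The union of the integral elements that contain a given integral element is a linear
subspace. -/
theorem coe_polarSpace (I : ∀ q : ℕ, Set (DForm E X q ℝ)) {x : X}
    (P : Submodule ℝ (TangentSpace 𝓘(ℝ, E) x)) (hP : IsIntegralElement I P) :
    (polarSpace I P : Set (TangentSpace 𝓘(ℝ, E) x)) = polarSet I P := by
  refine Subset.antisymm (fun v hv => ?_) Submodule.subset_span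
  refine Submodule.span_induction (p := fun v _ => v ∈ polarSet I P) (fun _ h => h) ?_ ?_ ?_ hv
  · exact ⟨P, hP, le_rfl, P.zero_mem⟩
  · intro v w _ _ hv hw
    rw [mem_polarSet_iff I P hP] at hv hw ⊢
    intro q ψ hψ u j hu
    rw [(ψ x).map_update_add, hv q ψ hψ u j hu, hw q ψ hψ u j hu, add_zero]
  · intro c v _ hv
    rw [mem_polarSet_iff I P hP] at hv ⊢
    intro q ψ hψ u j hu
    rw [(ψ x).map_update_smul, hv q ψ hψ u j hu, smul_zero]

end Polar

/-! ### Grassmann bundles, ordinary and regular integral elements -/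

section Grassmann

/-- `Gr_p(TX)`, the bundle of `p`-planes in the tangent spaces of `X`. -/
structure Gr (E : Type*) [NormedAddCommGroup E] [NormedSpace ℝ E]
    (X : Type*) [TopologicalSpace X] [ChartedSpace E X] (p : ℕ) where
  /-- the base point of the plane -/
  pt : X
  /-- the plane -/
  plane : Submodule ℝ (TangentSpace 𝓘(ℝ, E) pt)
  finrank_plane : Module.finrank ℝ plane = p

variable {E : Type*} [NormedAddCommGroup E] [NormedSpace ℝ E]
  {X : Type*} [TopologicalSpace X] [ChartedSpace E X] {p : ℕ}

/-- A linear coordinate system `(x¹, …, xᵖ; xᵖ⁺¹, …, xⁿ)` on `E`, divided in two blocks. Together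
with a chart of `X` it gives local coordinates on `X`. -/
abbrev Coord (E : Type*) [NormedAddCommGroup E] [NormedSpace ℝ E] (p : ℕ) :=
  E ≃L[ℝ] (Fin p → ℝ) × (Fin (Module.finrank ℝ E - p) → ℝ)

/-- The vectors `∂/∂xⁱ + ∑_a sᵢᵃ ∂/∂xᵃ` of `E`, where `i ≤ p < a`: the basis dual to
`dx¹, …, dxᵖ` of a `p`-plane on which `dx¹ ∧ … ∧ dxᵖ ≠ 0`. -/
def slopeVector (ℓ : Coord E p) (s : Fin p → Fin (Module.finrank ℝ E - p) → ℝ) (i : Fin p) : E :=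
  ℓ.symm (Pi.single i 1, s i)

theorem linearIndependent_slopeVector (ℓ : Coord E p)
    (s : Fin p → Fin (Module.finrank ℝ E - p) → ℝ) :
    LinearIndependent ℝ (slopeVector ℓ s) := by
  have h : LinearIndependent ℝ (((LinearMap.fst ℝ (Fin p → ℝ)
      (Fin (Module.finrank ℝ E - p) → ℝ)).comp (ℓ : E →ₗ[ℝ] _)) ∘ slopeVector ℓ s) := by
    have : (((LinearMap.fst ℝ (Fin p → ℝ) (Fin (Module.finrank ℝ E - p) → ℝ)).comp
        (ℓ : E →ₗ[ℝ] _)) ∘ slopeVector ℓ s) = fun i => Pi.basisFun ℝ (Fin p) i := by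
      funext i
      simp [slopeVector]
    rw [this]
    exact (Pi.basisFun ℝ (Fin p)).linearIndependent
  exact h.of_comp

/-- The coordinate domain `{(x, s)}` for `p`-planes: `x` is in the range of the chart at `x₀` and
`s` is an arbitrary matrix of slopes. -/
abbrev GrCoord (E : Type*) [NormedAddCommGroup E] [NormedSpace ℝ E]
    {X : Type*} [TopologicalSpace X] [ChartedSpace E X] (p : ℕ) (x₀ : X) :=
  (chartAt E x₀).target × (Fin p → Fin (Module.finrank ℝ E - p) → ℝ)

variable [IsManifold 𝓘(ℝ, E) ∞ X]

theorem finrank_graphPlane (x₀ : X) (ℓ : Coord E p) (w : GrCoord E p x₀) :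
    Module.finrank ℝ (Submodule.span ℝ (range fun i =>
      mfderiv 𝓘(ℝ, E) 𝓘(ℝ, E) (chartAt E x₀).symm (w.1 : E) (slopeVector (E := E) ℓ w.2 i))) = p := by
  have : IsManifold 𝓘(ℝ, E) 1 X := IsManifold.of_le (n := ∞) (by exact_mod_cast le_top)
  have hinj := (mdifferentiable_chart (I := 𝓘(ℝ, E)) x₀).symm.mfderiv_injective
    (x := (w.1 : E)) w.1.2
  have h := (linearIndependent_slopeVector ℓ w.2).map'
    (mfderiv 𝓘(ℝ, E) 𝓘(ℝ, E) (chartAt E x₀).symm (w.1 : E)).toLinearMap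
    (LinearMap.ker_eq_bot.2 hinj)
  have h2 := finrank_span_eq_card h
  rw [Fintype.card_fin] at h2
  exact h2

/-- The `p`-plane with coordinates `(x, s)`: the standard local parametrization of `Gr_p(TX)`,
onto the set of the `p`-planes on which `dx¹ ∧ … ∧ dxᵖ ≠ 0`. -/
def graphPlane (x₀ : X) (ℓ : Coord E p) (w : GrCoord E p x₀) : Gr E X p where
  pt := (chartAt E x₀).symm (w.1 : E)
  plane := Submodule.span ℝ (range fun i =>
    mfderiv 𝓘(ℝ, E) 𝓘(ℝ, E) (chartAt E x₀).symm (w.1 : E) (slopeVector (E := E) ℓ w.2 i))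
  finrank_plane := finrank_graphPlane x₀ ℓ w

/-- The manifold topology of `Gr_p(TX)`: a set is open if it is open in all the standard
coordinates. -/
instance : TopologicalSpace (Gr E X p) :=
  ⨆ (x₀ : X) (ℓ : Coord E p), TopologicalSpace.coinduced (graphPlane x₀ ℓ) inferInstance

/-- The space `V_p(I)` of the `p`-dimensional integral elements. -/
def V (I : ∀ q : ℕ, Set (DForm E X q ℝ)) (p : ℕ) : Set (Gr E X p) :=
  {P | IsIntegralElement I P.plane}

/-- The function `φ̂` on (a coordinate domain in) `Gr_p(TX)` that belongs to a `p`-form `φ`, in the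
coordinates `(x, s)`: on the plane with these coordinates, `φ = φ̂ dx¹ ∧ … ∧ dxᵖ`. -/
def hat (x₀ : X) (ℓ : Coord E p) (φ : DForm E X p ℝ)
    (w : E × (Fin p → Fin (Module.finrank ℝ E - p) → ℝ)) : ℝ :=
  inChart φ x₀ w.1 (slopeVector ℓ w.2)

/-- Ordinary integral elements: near such an element `V_p(I)` is the zero set of finitely many
functions `φ̂` with `φ ∈ I^p`, whose differentials are linearly independent. -/
def IsOrdinary (I : ∀ q : ℕ, Set (DForm E X q ℝ)) (P : Gr E X p) : Prop :=
  P ∈ V I p ∧ ∃ (x₀ : X) (ℓ : Coord E p) (W : Set (GrCoord E p x₀)) (q : ℕ)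
    (φ : Fin q → DForm E X p ℝ),
    IsOpen W ∧ P ∈ graphPlane x₀ ℓ '' W ∧ (∀ j, φ j ∈ I p) ∧
    (∀ w ∈ W, LinearIndependent ℝ fun j => fderiv ℝ (hat x₀ ℓ (φ j)) ((w.1 : E), w.2)) ∧
    ∀ w ∈ W, graphPlane x₀ ℓ w ∈ V I p ↔ ∀ j, hat x₀ ℓ (φ j) ((w.1 : E), w.2) = 0

/-- The extension rank `r(P) = dim H(P) - p - 1`. -/
def extensionRank (I : ∀ q : ℕ, Set (DForm E X q ℝ)) (P : Gr E X p) : ℤ :=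
  (Module.finrank ℝ (polarSpace I P.plane) : ℤ) - p - 1

/-- Regular integral elements: ordinary integral elements near which the extension rank, a function
on `V_p(I)`, is constant. -/
def IsRegular (I : ∀ q : ℕ, Set (DForm E X q ℝ)) (P : Gr E X p) : Prop :=
  IsOrdinary I P ∧ ∃ U : Set (Gr E X p), IsOpen U ∧ P ∈ U ∧
    ∀ P' ∈ U ∩ V I p, extensionRank I P' = extensionRank I P

/-- The space `V_p(I, π)` of the `π`-transverse `p`-dimensional integral elements for a map
`π : X → Y`: those on which the differential of `π` is injective. -/
def VTransverse {E' : Type*} [NormedAddCommGroup E'] [NormedSpace ℝ E']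
    {Y : Type*} [TopologicalSpace Y] [ChartedSpace E' Y] (π : X → Y)
    (I : ∀ q : ℕ, Set (DForm E X q ℝ)) (p : ℕ) : Set (Gr E X p) :=
  {P | P ∈ V I p ∧ InjOn (mfderiv 𝓘(ℝ, E) 𝓘(ℝ, E') π P.pt) P.plane}

end Grassmann

end EDS

/-! ### The bundle `J = F / SL(3, ℂ)` over a 6-manifold -/

namespace SLBundle

/-- The model space of 6-manifolds. -/
abbrev E6 := EuclideanSpace ℝ (Fin 6)

/-- `ℂ³`, identified with `ℝ⁶` by `(x¹, …, x⁶) ↦ (x¹ + i x⁴, x² + i x⁵, x³ + i x⁶)`. -/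
abbrev C3 := Fin 3 → ℂ

section Linear

/-- The complex linear part `A` of a real linear map `T(v) = A v + B v̄` of `ℂ³`. -/
def linPart (T : C3 →L[ℝ] C3) : Matrix (Fin 3) (Fin 3) ℂ :=
  Matrix.of fun j k => (T (Pi.single k 1) j - Complex.I * T (Pi.single k Complex.I) j) / 2

/-- The complex antilinear part `B` of a real linear map `T(v) = A v + B v̄` of `ℂ³`. -/
def antiPart (T : C3 →L[ℝ] C3) : Matrix (Fin 3) (Fin 3) ℂ :=
  Matrix.of fun j k => (T (Pi.single k 1) j + Complex.I * T (Pi.single k Complex.I) j) / 2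

/-- A complex matrix as a real linear map of `ℂ³`. -/
def ofMatrix (a : Matrix (Fin 3) (Fin 3) ℂ) : C3 →L[ℝ] C3 :=
  LinearMap.toContinuousLinearMap (a.mulVecLin.restrictScalars ℝ)

@[simp] theorem ofMatrix_apply (a : Matrix (Fin 3) (Fin 3) ℂ) (v : C3) :
    ofMatrix a v = a.mulVec v := rfl

/-- Complex conjugation of `ℂ³`. -/
def conjCLM : C3 →L[ℝ] C3 :=
  ContinuousLinearMap.pi fun j => Complex.conjCLE.toContinuousLinearMap.comp
    (ContinuousLinearMap.proj j)

@[simp] theorem conjCLM_apply (v : C3) (j : Fin 3) :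
    conjCLM v j = (starRingEnd ℂ) (v j) := rfl

theorem eq_linPart_add_antiPart (T : C3 →L[ℝ] C3) :
    T = ofMatrix (linPart T) + (ofMatrix (antiPart T)).comp conjCLM := by
  have key : ∀ k (z : ℂ), T (Pi.single k z) = z.re • T (Pi.single k 1) +
      z.im • T (Pi.single k Complex.I) := by
    intro k z
    rw [← map_smul, ← map_smul, ← map_add, ← Pi.single_smul, ← Pi.single_smul, ← Pi.single_add]
    congr 2
    apply Complex.ext <;> simp
  ext v j
  have hv : v = ∑ k, Pi.single k (v k) := (Finset.univ_sum_single v).symm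
  have h1 : T v j = ∑ k, ((v k).re • T (Pi.single k 1) j +
      (v k).im • T (Pi.single k Complex.I) j) := by
    conv_lhs => rw [hv]
    rw [map_sum, Finset.sum_apply]
    refine Finset.sum_congr rfl fun k _ => ?_
    rw [key k (v k)]
    rfl
  rw [h1]
  simp only [_root_.add_apply, ContinuousLinearMap.comp_apply, ofMatrix_apply,
    Matrix.mulVec, dotProduct, Pi.add_apply, conjCLM_apply, ← Finset.sum_add_distrib]
  refine Finset.sum_congr rfl fun k _ => ?_
  simp only [linPart, antiPart, Matrix.of_apply]
  have hz : v k = (v k).re + (v k).im * Complex.I := (Complex.re_add_im _).symm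
  have hc : (starRingEnd ℂ) (v k) = (v k).re - (v k).im * Complex.I := by
    apply Complex.ext <;> simp
  rw [hc]
  conv_rhs => rw [hz]
  simp only [Complex.real_smul, Complex.add_re, Complex.ofReal_re, Complex.mul_re, Complex.I_re,
    Complex.ofReal_im, Complex.I_im, Complex.add_im, Complex.mul_im]
  push_cast
  ring_nf
  rw [Complex.I_sq]
  ring

theorem linPart_add (a b : Matrix (Fin 3) (Fin 3) ℂ) :
    linPart (ofMatrix a + (ofMatrix b).comp conjCLM) = a := by
  have hc : ∀ k (z : ℂ), conjCLM (Pi.single k z) = Pi.single k ((starRingEnd ℂ) z) := by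
    intro k z; ext j
    by_cases h : j = k
    · subst h; simp
    · simp [h]
  ext j k
  simp only [linPart, Matrix.of_apply, _root_.add_apply,
    ContinuousLinearMap.comp_apply, hc, ofMatrix_apply, Matrix.mulVec_single, Pi.add_apply]
  simp
  ring_nf
  rw [Complex.I_sq]
  ring

theorem antiPart_add (a b : Matrix (Fin 3) (Fin 3) ℂ) :
    antiPart (ofMatrix a + (ofMatrix b).comp conjCLM) = b := by
  have hc : ∀ k (z : ℂ), conjCLM (Pi.single k z) = Pi.single k ((starRingEnd ℂ) z) := by
    intro k z; ext j
    by_cases h : j = k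
    · subst h; simp
    · simp [h]
  ext j k
  simp only [antiPart, Matrix.of_apply, _root_.add_apply,
    ContinuousLinearMap.comp_apply, hc, ofMatrix_apply, Matrix.mulVec_single, Pi.add_apply]
  simp
  ring_nf
  rw [Complex.I_sq]
  ring

theorem ofMatrix_mul (a b : Matrix (Fin 3) (Fin 3) ℂ) :
    ofMatrix (a * b) = (ofMatrix a).comp (ofMatrix b) := by
  ext1 v
  simp [Matrix.mulVec_mulVec]

theorem linPart_comp (a : Matrix (Fin 3) (Fin 3) ℂ) (T : C3 →L[ℝ] C3) :
    linPart ((ofMatrix a).comp T) = a * linPart T := by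
  conv_lhs => rw [eq_linPart_add_antiPart T]
  rw [ContinuousLinearMap.comp_add, ← ContinuousLinearMap.comp_assoc, ← ofMatrix_mul,
    ← ofMatrix_mul, linPart_add]

theorem antiPart_comp (a : Matrix (Fin 3) (Fin 3) ℂ) (T : C3 →L[ℝ] C3) :
    antiPart ((ofMatrix a).comp T) = a * antiPart T := by
  conv_lhs => rw [eq_linPart_add_antiPart T]
  rw [ContinuousLinearMap.comp_add, ← ContinuousLinearMap.comp_assoc, ← ofMatrix_mul,
    ← ofMatrix_mul, antiPart_add]

/-- The coordinate space of the fibres of `J`. -/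
abbrev Fib := ℂ × (Fin 3 → Fin 3 → ℂ)

/-- `T = A + B ∘ conj ↦ (det A, A⁻¹ B)`. Where `A` is invertible, this is a complete invariant of
`T` under composition from the left with elements of `SL(3, ℂ)`. -/
def fibCoord (T : C3 →L[ℝ] C3) : Fib :=
  ((linPart T).det, fun j k => ((linPart T)⁻¹ * antiPart T) j k)

/-- `(c, B) ↦ diag(c, 1, 1) ∘ (1 + B ∘ conj)`, a section of `fibCoord`. -/
def fibSlice (q : Fib) : C3 →L[ℝ] C3 :=
  (ofMatrix (Matrix.diagonal ![q.1, 1, 1])).comp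
    (ContinuousLinearMap.id ℝ C3 + (ofMatrix (Matrix.of q.2)).comp conjCLM)

theorem ofMatrix_one : ofMatrix 1 = ContinuousLinearMap.id ℝ C3 := by
  ext1 v; simp

theorem det_diag (c : ℂ) : (Matrix.diagonal ![c, 1, 1] : Matrix (Fin 3) (Fin 3) ℂ).det = c := by
  simp [Matrix.det_diagonal, Fin.prod_univ_three]

theorem fibCoord_fibSlice (q : Fib) (hq : q.1 ≠ 0) : fibCoord (fibSlice q) = q := by
  have hd : IsUnit (Matrix.diagonal ![q.1, 1, 1] : Matrix (Fin 3) (Fin 3) ℂ).det := by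
    rw [det_diag]; exact isUnit_iff_ne_zero.2 hq
  rw [fibCoord, fibSlice, ← ofMatrix_one, linPart_comp, antiPart_comp, linPart_add, antiPart_add,
    mul_one, det_diag, ← mul_assoc, Matrix.nonsing_inv_mul _ hd, one_mul]
  rfl

theorem fibCoord_comp (a : Matrix.SpecialLinearGroup (Fin 3) ℂ) (T : C3 →L[ℝ] C3) :
    fibCoord ((ofMatrix a.1).comp T) = fibCoord T := by
  rw [fibCoord, fibCoord, linPart_comp, antiPart_comp, Matrix.det_mul, a.2, one_mul,
    Matrix.mul_inv_rev, mul_assoc, ← mul_assoc _ a.1, Matrix.nonsing_inv_mul _ (by simp [a.2]),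
    one_mul]

theorem fibSlice_fibCoord (T : C3 →L[ℝ] C3) (hT : (fibCoord T).1 ≠ 0) :
    ∃ a : Matrix.SpecialLinearGroup (Fin 3) ℂ, fibSlice (fibCoord T) = (ofMatrix a.1).comp T := by
  have hu : IsUnit (linPart T).det := isUnit_iff_ne_zero.2 hT
  refine ⟨⟨Matrix.diagonal ![(linPart T).det, 1, 1] * (linPart T)⁻¹, ?_⟩, ?_⟩
  · rw [Matrix.det_mul, det_diag, Matrix.det_nonsing_inv, Ring.mul_inverse_cancel _ hu]
  · have e : (ofMatrix (linPart T)⁻¹).comp T =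
        ContinuousLinearMap.id ℝ C3 + (ofMatrix ((linPart T)⁻¹ * antiPart T)).comp conjCLM := by
      conv_lhs => rw [eq_linPart_add_antiPart T]
      rw [linPart_add, ContinuousLinearMap.comp_add, ← ContinuousLinearMap.comp_assoc,
        ← ofMatrix_mul, ← ofMatrix_mul, Matrix.nonsing_inv_mul _ hu, ofMatrix_one]
    change _ = (ofMatrix (_ * _)).comp T
    rw [ofMatrix_mul, ContinuousLinearMap.comp_assoc, e]
    rfl

theorem contDiff_linPart_apply (j k : Fin 3) : ContDiff ℝ ∞ fun T => linPart T j k := by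
  simp only [linPart, Matrix.of_apply]
  fun_prop

theorem contDiff_antiPart_apply (j k : Fin 3) : ContDiff ℝ ∞ fun T => antiPart T j k := by
  simp only [antiPart, Matrix.of_apply]
  fun_prop

theorem contDiff_det_linPart : ContDiff ℝ ∞ fun T => (linPart T).det := by
  have h := contDiff_linPart_apply
  simp only [Matrix.det_fin_three]
  fun_prop

theorem contDiffOn_fibCoord : ContDiffOn ℝ ∞ fibCoord {T | (linPart T).det ≠ 0} := by
  refine contDiff_det_linPart.contDiffOn.prodMk ?_
  rw [contDiffOn_pi]; intro j
  rw [contDiffOn_pi]; intro k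
  have h : ∀ j k, ContDiff ℝ ∞ fun T => (linPart T).adjugate j k := by
    intro j k
    have h := contDiff_linPart_apply
    fin_cases j <;> fin_cases k <;> simp [Matrix.adjugate_fin_three] <;> fun_prop
  have h2 := contDiff_antiPart_apply
  have e : ∀ T ∈ {T | (linPart T).det ≠ 0}, ((linPart T)⁻¹ * antiPart T) j k =
      ∑ i, (linPart T).det⁻¹ * (linPart T).adjugate j i * antiPart T i k := by
    intro T _
    simp [Matrix.mul_apply, Matrix.inv_def]
  refine ContDiffOn.congr ?_ e
  refine ContDiffOn.sum fun i _ => ?_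
  refine ((contDiff_det_linPart.contDiffOn.inv fun T hT => hT).mul (h j i).contDiffOn).mul
    (h2 i k).contDiffOn

theorem contDiff_ofMatrix_of {X : Type*} [NormedAddCommGroup X] [NormedSpace ℝ X]
    {f : X → Matrix (Fin 3) (Fin 3) ℂ} (hf : ∀ j k, ContDiff ℝ ∞ fun x => f x j k) :
    ContDiff ℝ ∞ fun x => ofMatrix (f x) := by
  rw [contDiff_clm_apply_iff]
  intro v
  rw [contDiff_pi]
  intro j
  simp only [ofMatrix_apply, Matrix.mulVec, dotProduct]
  have := hf j
  fun_prop

theorem contDiff_fibSlice : ContDiff ℝ ∞ fibSlice := by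
  unfold fibSlice
  refine ContDiff.clm_comp (contDiff_ofMatrix_of fun j k => ?_)
    (contDiff_const.add (ContDiff.clm_comp (contDiff_ofMatrix_of fun j k => ?_) contDiff_const))
  · fin_cases j <;> fin_cases k <;> simp <;> fun_prop
  · simp only [Matrix.of_apply]
    fun_prop

end Linear

section Bundle

variable {M : Type*} [TopologicalSpace M] [ChartedSpace E6 M]

/-- The fibre `F_x` of the coframe bundle: the linear isomorphisms `u : T_x M → ℝ⁶ = ℂ³`. -/
abbrev Coframe (x : M) := TangentSpace 𝓘(ℝ, E6) x ≃L[ℝ] C3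

/-- The orbits of the right action `u · a = a⁻¹ ∘ u` of `SL(3, ℂ)` on the coframes at `x`. -/
def coframeSetoid (x : M) : Setoid (Coframe x) where
  r u u' := ∃ a : Matrix.SpecialLinearGroup (Fin 3) ℂ, ∀ v, u' v = (a⁻¹).1.mulVec (u v)
  iseqv :=
    { refl := fun u => ⟨1, fun v => by simp⟩
      symm := by
        rintro u u' ⟨a, h⟩
        refine ⟨a⁻¹, fun v => ?_⟩
        rw [h, Matrix.mulVec_mulVec, ← Matrix.SpecialLinearGroup.coe_mul]
        simp
      trans := by
        rintro u u' u'' ⟨a, h⟩ ⟨b, h'⟩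
        refine ⟨a * b, fun v => ?_⟩
        rw [h', h, Matrix.mulVec_mulVec, ← Matrix.SpecialLinearGroup.coe_mul, mul_inv_rev] }

variable (M) in
/-- `J = F / SL(3, ℂ)`: the points of `J` are the `SL(3, ℂ)`-orbits of coframes of `M`. -/
structure J where
  /-- the projection `π̄ : J → M` -/
  base : M
  /-- the orbit of coframes at the base point -/
  orbit : Quotient (coframeSetoid base)

/-- The orbit `u · SL(3, ℂ)` of a coframe `u`, i.e. the quotient map `F → J`. -/
def J.ofCoframe {x : M} (u : Coframe x) : J M := ⟨x, Quotient.mk (coframeSetoid x) u⟩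

theorem J.ofCoframe_eq {x : M} {u u' : Coframe x} (a : Matrix.SpecialLinearGroup (Fin 3) ℂ)
    (h : ∀ v, u' v = a.1.mulVec (u v)) : J.ofCoframe u' = J.ofCoframe u := by
  have : Quotient.mk (coframeSetoid x) u = Quotient.mk (coframeSetoid x) u' :=
    Quotient.sound (s := coframeSetoid x) ⟨a⁻¹, by simpa using h⟩
  rw [J.ofCoframe, J.ofCoframe, this]

/-- A coframe at `x` as an isomorphism of the model space `ℝ⁶` (which is what `T_x M` is, by
means of the preferred chart at `x`). -/
def toModel {x : M} (u : Coframe x) : E6 ≃L[ℝ] C3 := u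

open Classical in
/-- An invertible linear map `L` as an isomorphism (`Z` if `L` is not invertible). -/
def equivOf (Z : E6 ≃L[ℝ] C3) (L : E6 →L[ℝ] C3) : E6 ≃L[ℝ] C3 :=
  if h : L.IsInvertible then Classical.choose h else Z

theorem coe_equivOf (Z : E6 ≃L[ℝ] C3) {L : E6 →L[ℝ] C3} (h : L.IsInvertible) :
    (equivOf Z L : E6 →L[ℝ] C3) = L := by
  rw [equivOf, dif_pos h]
  exact Classical.choose_spec h

/-- The coframe at `x` given by an invertible linear map `L` of the model space. -/
def coframeOf (Z : E6 ≃L[ℝ] C3) (x : M) (L : E6 →L[ℝ] C3) : Coframe x := equivOf Z L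

theorem coframeOf_apply {Z : E6 ≃L[ℝ] C3} {x : M} {L : E6 →L[ℝ] C3} (h : L.IsInvertible)
    (v : E6) : toModel (coframeOf Z x L) v = L v :=
  congrArg (fun L : E6 →L[ℝ] C3 => L v) (coe_equivOf Z h)

theorem J.exists_rep (z : J M) : ∃ u : Coframe z.base, J.ofCoframe u = z := by
  obtain ⟨x, o⟩ := z
  obtain ⟨u, rfl⟩ := Quotient.exists_rep (s := coframeSetoid x) o
  exact ⟨u, rfl⟩

/-- The model space of `J`: six base coordinates and twenty (ten complex) fibre coordinates. -/
abbrev N := E6 × Fib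

/-- An open set that contains the domain of the transition map. -/
def transDom (x₀ x₁ : M) : Set N :=
  {y | y.1 ∈ ((chartAt E6 x₀).symm.trans (chartAt E6 x₁)).source ∧ y.2.1 ≠ 0 ∧
    (fibSlice y.2).IsInvertible}

theorem isOpen_transDom (x₀ x₁ : M) : IsOpen (transDom x₀ x₁) := by
  have h1 : IsOpen {y : N | y.1 ∈ ((chartAt E6 x₀).symm.trans (chartAt E6 x₁)).source} :=
    ((chartAt E6 x₀).symm.trans (chartAt E6 x₁)).open_source.preimage continuous_fst
  have h2 : IsOpen {y : N | y.2.1 ≠ 0} :=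
    isOpen_ne.preimage (continuous_fst.comp continuous_snd)
  have h3 : IsOpen {y : N | (fibSlice y.2).IsInvertible} :=
    (ContinuousLinearEquiv.isOpen (𝕜 := ℝ) (E := C3) (F := C3)).preimage
      (contDiff_fibSlice.continuous.comp continuous_snd)
  exact h1.inter (h2.inter h3)

variable [IsManifold 𝓘(ℝ, E6) ∞ M]

/-- A coframe `u` at `x`, written in the chart of `M` at `x₀` and compared with a fixed
isomorphism `Z : ℝ⁶ → ℂ³`: the map `u ∘ (dx)⁻¹ ∘ Z⁻¹` with `dx` the differential of the chart. -/
def compare (x₀ : M) (Z : E6 ≃L[ℝ] C3) {x : M} (u : Coframe x) : C3 →L[ℝ] C3 :=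
  (toModel u : E6 →L[ℝ] C3).comp
    ((tangentCoordChange 𝓘(ℝ, E6) x₀ x x).comp (Z.symm : C3 →L[ℝ] E6))

theorem compare_eq_of_rel (x₀ : M) (Z : E6 ≃L[ℝ] C3) {x : M} (u u' : Coframe x)
    (h : (coframeSetoid x).r u u') :
    fibCoord (compare x₀ Z u) = fibCoord (compare x₀ Z u') := by
  obtain ⟨a, h⟩ := h
  rw [← fibCoord_comp a⁻¹ (compare x₀ Z u)]
  congr 1
  ext1 v
  exact (h _).symm

/-- The coordinates of the point of `J` that is the orbit of `u`, in the chart with index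
`(x₀, Z)`: the coordinates of the base point in the chart of `M` at `x₀`, and `(det A, A⁻¹ B)`
where `u ∘ (dx)⁻¹ = A ∘ Z + B ∘ conj ∘ Z`. -/
def coordFun (x₀ : M) (Z : E6 ≃L[ℝ] C3) (z : J M) : N :=
  (chartAt E6 x₀ z.base,
    Quotient.lift (s := coframeSetoid z.base) (fun u => fibCoord (compare x₀ Z u))
      (compare_eq_of_rel x₀ Z) z.orbit)

theorem coordFun_ofCoframe (x₀ : M) (Z : E6 ≃L[ℝ] C3) {x : M} (u : Coframe x) :
    coordFun x₀ Z (J.ofCoframe u) = (chartAt E6 x₀ x, fibCoord (compare x₀ Z u)) := rfl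

/-- The linear map `L` with `L ∘ (dx)⁻¹ = fibSlice q ∘ Z` at the point `x`. -/
def sliceMap (x₀ : M) (Z : E6 ≃L[ℝ] C3) (x : M) (q : Fib) : E6 →L[ℝ] C3 :=
  (fibSlice q).comp ((Z : E6 →L[ℝ] C3).comp (tangentCoordChange 𝓘(ℝ, E6) x x₀ x))

/-- The inverse of the chart with index `(x₀, Z)`. -/
def coordInv (x₀ : M) (Z : E6 ≃L[ℝ] C3) (y : N) : J M :=
  J.ofCoframe (coframeOf Z ((chartAt E6 x₀).symm y.1) (sliceMap x₀ Z ((chartAt E6 x₀).symm y.1) y.2))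

theorem tcc_comp {x₀ x₁ x : M} (h₀ : x ∈ (chartAt E6 x₀).source)
    (h₁ : x ∈ (chartAt E6 x₁).source) :
    (tangentCoordChange 𝓘(ℝ, E6) x x₁ x).comp (tangentCoordChange 𝓘(ℝ, E6) x₀ x x) =
      tangentCoordChange 𝓘(ℝ, E6) x₀ x₁ x := by
  ext1 v
  exact tangentCoordChange_comp ⟨⟨by simpa using h₀, by simp⟩, by simpa using h₁⟩

theorem tcc_self {x₀ x : M} (h₀ : x ∈ (chartAt E6 x₀).source) :
    tangentCoordChange 𝓘(ℝ, E6) x₀ x₀ x = ContinuousLinearMap.id ℝ E6 := by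
  ext1 v
  exact tangentCoordChange_self (by simpa using h₀)

theorem tcc_comp_self {x₀ x : M} (h₀ : x ∈ (chartAt E6 x₀).source) :
    (tangentCoordChange 𝓘(ℝ, E6) x₀ x x).comp (tangentCoordChange 𝓘(ℝ, E6) x x₀ x) =
      ContinuousLinearMap.id ℝ E6 := by
  rw [← tcc_self (mem_chart_source E6 x)]
  ext1 v
  exact tangentCoordChange_comp ⟨⟨by simp, by simpa using h₀⟩, by simp⟩

theorem tcc_invertible {x₀ x : M} (h₀ : x ∈ (chartAt E6 x₀).source) :
    (tangentCoordChange 𝓘(ℝ, E6) x x₀ x).IsInvertible :=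
  ContinuousLinearMap.IsInvertible.of_inverse
    ((tcc_comp h₀ h₀).trans (tcc_self h₀)) (tcc_comp_self h₀)

theorem tcc_invertible' {x₀ x : M} (h₀ : x ∈ (chartAt E6 x₀).source) :
    (tangentCoordChange 𝓘(ℝ, E6) x₀ x x).IsInvertible :=
  ContinuousLinearMap.IsInvertible.of_inverse
    (tcc_comp_self h₀) ((tcc_comp h₀ h₀).trans (tcc_self h₀))

theorem sliceMap_invertible {x₀ x : M} (h₀ : x ∈ (chartAt E6 x₀).source) (Z : E6 ≃L[ℝ] C3)
    {q : Fib} (hq : (fibSlice q).IsInvertible) : (sliceMap x₀ Z x q).IsInvertible :=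
  hq.comp ((ContinuousLinearMap.isInvertible_equiv (f := Z)).comp (tcc_invertible h₀))

theorem compare_coframeOf {x₀ x₁ x : M} (h₀ : x ∈ (chartAt E6 x₀).source)
    (h₁ : x ∈ (chartAt E6 x₁).source) (Z Z₁ : E6 ≃L[ℝ] C3)
    {q : Fib} (hq : (fibSlice q).IsInvertible) :
    compare x₁ Z₁ (coframeOf Z x (sliceMap x₀ Z x q)) =
      (fibSlice q).comp ((Z : E6 →L[ℝ] C3).comp
        ((tangentCoordChange 𝓘(ℝ, E6) x₁ x₀ x).comp (Z₁.symm : C3 →L[ℝ] E6))) := by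
  ext1 v
  have h := coframeOf_apply (Z := Z) (x := x) (sliceMap_invertible h₀ Z hq)
    (tangentCoordChange 𝓘(ℝ, E6) x₁ x x (Z₁.symm v))
  refine h.trans ?_
  simp only [← tcc_comp h₁ h₀]
  rfl

/-- The chart of `J` with index `(x₀, Z)`. Its inverse is the composition of the smooth local
section `(x, q) ↦ fibSlice q ∘ Z ∘ dx` of coframes, which meets each `SL(3, ℂ)`-orbit with
`det A ≠ 0` once and transversely, with the quotient map `F → J`; so these charts give the smooth
structure of the quotient manifold `F / SL(3, ℂ)`. -/
def coordChart (x₀ : M) (Z : E6 ≃L[ℝ] C3) : PartialEquiv (J M) N where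
  toFun := coordFun x₀ Z
  invFun := coordInv x₀ Z
  source := {z | z.base ∈ (chartAt E6 x₀).source ∧ (coordFun x₀ Z z).2.1 ≠ 0}
  target := {y | y.1 ∈ (chartAt E6 x₀).target ∧ y.2.1 ≠ 0 ∧ (fibSlice y.2).IsInvertible}
  map_source' := by
    intro z hz
    obtain ⟨u, hu⟩ := z.exists_rep
    rw [← hu] at hz ⊢
    generalize z.base = x at u hz hu ⊢
    have hz1 : x ∈ (chartAt E6 x₀).source := hz.1
    have hz2 : (fibCoord (compare x₀ Z u)).1 ≠ 0 := hz.2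
    refine ⟨(chartAt E6 x₀).map_source hz1, hz2, ?_⟩
    obtain ⟨a, ha⟩ := fibSlice_fibCoord (compare x₀ Z u) hz2
    change (fibSlice (fibCoord (compare x₀ Z u))).IsInvertible
    rw [ha]
    have ha' : (ofMatrix a.1).IsInvertible := by
      refine ContinuousLinearMap.IsInvertible.of_inverse (g := ofMatrix (a⁻¹).1) ?_ ?_ <;>
      rw [← ofMatrix_mul, ← Matrix.SpecialLinearGroup.coe_mul] <;> simp [ofMatrix_one]
    refine ha'.comp ?_
    exact (ContinuousLinearMap.isInvertible_equiv (f := toModel u)).comp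
      ((tcc_invertible' hz1).comp (ContinuousLinearMap.isInvertible_equiv (f := Z.symm)))
  map_target' := by
    rintro y ⟨hy1, hy2, hy3⟩
    have h := (chartAt E6 x₀).map_target hy1
    refine ⟨h, ?_⟩
    rw [coordInv, coordFun_ofCoframe, compare_coframeOf h h Z Z hy3, tcc_self h]
    have e : (fibSlice y.2).comp ((Z : E6 →L[ℝ] C3).comp ((ContinuousLinearMap.id ℝ E6).comp
        (Z.symm : C3 →L[ℝ] E6))) = fibSlice y.2 := by
      ext1 v; simp
    rw [e, fibCoord_fibSlice _ hy2]
    exact hy2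
  left_inv' := by
    intro z hz
    obtain ⟨u, hu⟩ := z.exists_rep
    rw [← hu] at hz ⊢
    generalize z.base = x at u hz hu ⊢
    have hz1 : x ∈ (chartAt E6 x₀).source := hz.1
    have hz2 : (fibCoord (compare x₀ Z u)).1 ≠ 0 := hz.2
    obtain ⟨a, ha⟩ := fibSlice_fibCoord (compare x₀ Z u) hz2
    have ha' : (ofMatrix a.1).IsInvertible := by
      refine ContinuousLinearMap.IsInvertible.of_inverse (g := ofMatrix (a⁻¹).1) ?_ ?_ <;>
      rw [← ofMatrix_mul, ← Matrix.SpecialLinearGroup.coe_mul] <;> simp [ofMatrix_one]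
    have hinv : (fibSlice (fibCoord (compare x₀ Z u))).IsInvertible := by
      rw [ha]
      exact ha'.comp ((ContinuousLinearMap.isInvertible_equiv (f := toModel u)).comp
        ((tcc_invertible' hz1).comp (ContinuousLinearMap.isInvertible_equiv (f := Z.symm))))
    rw [coordFun_ofCoframe, coordInv]
    simp only
    rw [(chartAt E6 x₀).left_inv hz1]
    refine J.ofCoframe_eq a fun v => ?_
    refine (coframeOf_apply (sliceMap_invertible hz1 Z hinv) v).trans ?_
    rw [sliceMap, ha]
    have h : tangentCoordChange 𝓘(ℝ, E6) x₀ x x (tangentCoordChange 𝓘(ℝ, E6) x x₀ x v) = v :=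
      congrArg (fun L : E6 →L[ℝ] E6 => L v) (tcc_comp_self hz1)
    refine Eq.trans (b := (ofMatrix a.1) (toModel u (tangentCoordChange 𝓘(ℝ, E6) x₀ x x
      (Z.symm (Z (tangentCoordChange 𝓘(ℝ, E6) x x₀ x v)))))) rfl ?_
    rw [Z.symm_apply_apply]
    exact congrArg (fun w => a.1.mulVec (toModel u w)) h
  right_inv' := by
    rintro y ⟨hy1, hy2, hy3⟩
    have h := (chartAt E6 x₀).map_target hy1
    rw [coordInv, coordFun_ofCoframe, compare_coframeOf h h Z Z hy3, tcc_self h]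
    have e : (fibSlice y.2).comp ((Z : E6 →L[ℝ] C3).comp ((ContinuousLinearMap.id ℝ E6).comp
        (Z.symm : C3 →L[ℝ] E6))) = fibSlice y.2 := by
      ext1 v; simp
    rw [e, fibCoord_fibSlice _ hy2, (chartAt E6 x₀).right_inv hy1]

/-- The transition map from the chart with index `(x₀, Z)` to the one with index `(x₁, Z₁)`: the
map `u ∘ (dx)⁻¹ ∘ Z₁⁻¹` in terms of the first coordinates. -/
def transMap (x₀ x₁ : M) (Z Z₁ : E6 ≃L[ℝ] C3) (y : N) : C3 →L[ℝ] C3 :=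
  (fibSlice y.2).comp ((Z : E6 →L[ℝ] C3).comp
    ((tangentCoordChange 𝓘(ℝ, E6) x₁ x₀ ((chartAt E6 x₀).symm y.1)).comp
      (Z₁.symm : C3 →L[ℝ] E6)))

theorem contDiffOn_transMap (x₀ x₁ : M) (Z Z₁ : E6 ≃L[ℝ] C3) :
    ContDiffOn ℝ ∞ (transMap x₀ x₁ Z Z₁) (transDom x₀ x₁) := by
  have hM : IsManifold 𝓘(ℝ, E6) (∞ + 1) M := by
    rw [show (∞ : WithTop ℕ∞) + 1 = ∞ from rfl]; infer_instance
  have hb : ContDiffOn ℝ ∞ (fun y : E6 => chartAt E6 x₁ ((chartAt E6 x₀).symm y))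
      ((chartAt E6 x₀).symm.trans (chartAt E6 x₁)).source := by
    have := contDiffOn_ext_coord_change (I := 𝓘(ℝ, E6)) (n := ∞) x₁ x₀
    simpa [Function.comp_def] using this
  have ht : ContDiffOn ℝ ∞ (fun y : E6 => tangentCoordChange 𝓘(ℝ, E6) x₁ x₀
      ((chartAt E6 x₀).symm y)) ((chartAt E6 x₀).symm.trans (chartAt E6 x₁)).source := by
    have h := contDiffOn_fderiv_coord_change (I := 𝓘(ℝ, E6)) (n := ∞)
      (achart E6 x₁) (achart E6 x₀)
    refine h.comp hb fun y hy => ?_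
    have hy1 : y ∈ (chartAt E6 x₀).target := hy.1
    have hy2 : (chartAt E6 x₀).symm y ∈ (chartAt E6 x₁).source := hy.2
    simp [hy2, (chartAt E6 x₀).map_target hy1]
  refine ContDiffOn.clm_comp (contDiff_fibSlice.comp contDiff_snd).contDiffOn
    (contDiffOn_const.clm_comp (ContDiffOn.clm_comp (ht.comp contDiff_fst.contDiffOn
      fun y hy => hy.1) contDiffOn_const))

theorem trans_source_eq (x₀ x₁ : M) (Z Z₁ : E6 ≃L[ℝ] C3) :
    ((coordChart x₀ Z).symm.trans (coordChart x₁ Z₁)).source =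
      transDom x₀ x₁ ∩ transMap x₀ x₁ Z Z₁ ⁻¹' {T | (linPart T).det ≠ 0} := by
  ext y
  have key : ∀ (_ : y ∈ transDom x₀ x₁), coordFun x₁ Z₁ (coordInv x₀ Z y) =
      (chartAt E6 x₁ ((chartAt E6 x₀).symm y.1), fibCoord (transMap x₀ x₁ Z Z₁ y)) := by
    rintro ⟨hy1, hy2, hy3⟩
    have h0 : (chartAt E6 x₀).symm y.1 ∈ (chartAt E6 x₀).source :=
      (chartAt E6 x₀).map_target hy1.1
    rw [coordInv, coordFun_ofCoframe, compare_coframeOf h0 hy1.2 Z Z₁ hy3]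
    rfl
  constructor
  · rintro ⟨⟨hy1, hy2, hy3⟩, hy4, hy5⟩
    have hd : y ∈ transDom x₀ x₁ := ⟨⟨hy1, hy4⟩, hy2, hy3⟩
    refine ⟨hd, ?_⟩
    have h5 : (coordFun x₁ Z₁ (coordInv x₀ Z y)).2.1 ≠ 0 := hy5
    rw [key hd] at h5
    exact h5
  · rintro ⟨hd, hy5⟩
    refine ⟨⟨hd.1.1, hd.2.1, hd.2.2⟩, hd.1.2, ?_⟩
    change (coordFun x₁ Z₁ (coordInv x₀ Z y)).2.1 ≠ 0
    rw [key hd]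
    exact hy5

theorem isOpen_trans_source (x₀ x₁ : M) (Z Z₁ : E6 ≃L[ℝ] C3) :
    IsOpen ((coordChart x₀ Z).symm.trans (coordChart x₁ Z₁)).source := by
  rw [trans_source_eq]
  refine (contDiffOn_transMap x₀ x₁ Z Z₁).continuousOn.isOpen_inter_preimage
    (isOpen_transDom x₀ x₁) ?_
  exact isOpen_ne.preimage contDiff_det_linPart.continuous

theorem contDiffOn_trans (x₀ x₁ : M) (Z Z₁ : E6 ≃L[ℝ] C3) :
    ContDiffOn ℝ ∞ ((coordChart x₀ Z).symm.trans (coordChart x₁ Z₁))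
      ((coordChart x₀ Z).symm.trans (coordChart x₁ Z₁)).source := by
  have hb : ContDiffOn ℝ ∞ (fun y : E6 => chartAt E6 x₁ ((chartAt E6 x₀).symm y))
      ((chartAt E6 x₀).symm.trans (chartAt E6 x₁)).source := by
    have := contDiffOn_ext_coord_change (I := 𝓘(ℝ, E6)) (n := ∞) x₁ x₀
    simpa [Function.comp_def] using this
  rw [trans_source_eq]
  have h : ContDiffOn ℝ ∞ (fun y : N => ((chartAt E6 x₁ ((chartAt E6 x₀).symm y.1),
      fibCoord (transMap x₀ x₁ Z Z₁ y)) : N))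
      (transDom x₀ x₁ ∩ transMap x₀ x₁ Z Z₁ ⁻¹' {T | (linPart T).det ≠ 0}) :=
    (hb.comp contDiff_fst.contDiffOn fun y hy => hy.1.1).prodMk
      (contDiffOn_fibCoord.comp ((contDiffOn_transMap x₀ x₁ Z Z₁).mono inter_subset_left)
        fun y hy => hy.2)
  refine h.congr fun y hy => ?_
  obtain ⟨⟨hy1, hy2, hy3⟩, -⟩ := hy
  have h0 : (chartAt E6 x₀).symm y.1 ∈ (chartAt E6 x₀).source :=
    (chartAt E6 x₀).map_target hy1.1
  change coordFun x₁ Z₁ (coordInv x₀ Z y) = _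
  rw [coordInv, coordFun_ofCoframe, compare_coframeOf h0 hy1.2 Z Z₁ hy3]
  rfl

variable (M) in
/-- The atlas of `J`. -/
def core : ChartedSpaceCore N (J M) where
  atlas := range fun i : M × (E6 ≃L[ℝ] C3) => coordChart i.1 i.2
  chartAt z := coordChart z.base (toModel z.exists_rep.choose)
  mem_chart_source z := by
    refine ⟨mem_chart_source E6 z.base, ?_⟩
    have h := z.exists_rep.choose_spec
    generalize z.exists_rep.choose = u at h ⊢
    have h2 : coordFun z.base (toModel u) z = coordFun z.base (toModel u) (J.ofCoframe u) := by rw [h]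
    change (coordFun z.base (toModel u) z).2.1 ≠ 0
    rw [h2, coordFun_ofCoframe]
    have e : compare z.base (toModel u) u = ofMatrix 1 + (ofMatrix 0).comp conjCLM := by
      rw [compare, tcc_self (mem_chart_source E6 z.base)]
      ext1 v
      simp [ofMatrix]
    change (linPart (compare z.base (toModel u) u)).det ≠ 0
    rw [e, linPart_add]
    simp
  chart_mem_atlas z := ⟨(z.base, toModel z.exists_rep.choose), rfl⟩
  open_source := by
    rintro _ _ ⟨i, rfl⟩ ⟨j, rfl⟩
    exact isOpen_trans_source i.1 j.1 i.2 j.2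
  continuousOn_toFun := by
    rintro _ _ ⟨i, rfl⟩ ⟨j, rfl⟩
    exact (contDiffOn_trans i.1 j.1 i.2 j.2).continuousOn

instance : TopologicalSpace (J M) := (core M).toTopologicalSpace

instance : ChartedSpace N (J M) := (core M).toChartedSpace

instance : IsManifold 𝓘(ℝ, N) ∞ (J M) := by
  refine isManifold_of_contDiffOn _ _ _ fun e e' he he' => ?_
  have hat : ∀ e : OpenPartialHomeomorph (J M) N, e ∈ atlas N (J M) →
      ∃ (x₀ : M) (Z : E6 ≃L[ℝ] C3), e.toPartialEquiv = coordChart x₀ Z := by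
    intro e he
    obtain ⟨f, hf, he⟩ := mem_iUnion₂.1 he
    obtain ⟨i, rfl⟩ := hf
    obtain rfl := mem_singleton_iff.1 he
    exact ⟨i.1, i.2, rfl⟩
  obtain ⟨x₀, Z, h⟩ := hat e he
  obtain ⟨x₁, Z₁, h'⟩ := hat e' he'
  have h2 := contDiffOn_trans x₀ x₁ Z Z₁
  rw [← h, ← h'] at h2
  simpa using h2

/-- `Υ₀ = (dx¹ + i dx⁴) ∧ (dx² + i dx⁵) ∧ (dx³ + i dx⁶) = dz¹ ∧ dz² ∧ dz³` on `ℝ⁶ = ℂ³`. -/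
def upsilon0 : C3 [⋀^Fin 3]→L[ℝ] ℂ where
  toMultilinearMap :=
    (Matrix.detRowAlternating (R := ℂ) (n := Fin 3)).toMultilinearMap.restrictScalars ℝ
  map_eq_zero_of_eq' := fun v i j h hij =>
    (Matrix.detRowAlternating (R := ℂ) (n := Fin 3)).map_eq_zero_of_eq v h hij
  cont := by
    have h : Continuous fun v : Fin 3 → C3 => Matrix.det (Matrix.of v) :=
      Continuous.matrix_det (by fun_prop)
    exact h

/-- `upsilon0` is the determinant of three vectors of `ℂ³`. -/
theorem upsilon0_apply (v : Fin 3 → C3) : upsilon0 v = Matrix.det (Matrix.of v) := rfl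

theorem upsilon0_mulVec (a : Matrix.SpecialLinearGroup (Fin 3) ℂ) (v : Fin 3 → C3) :
    upsilon0 (fun i => a.1.mulVec (v i)) = upsilon0 v := by
  have h : (Matrix.of fun i => a.1.mulVec (v i)) = Matrix.of v * a.1.transpose := by
    ext i j
    simp [Matrix.mul_apply, Matrix.mulVec, dotProduct, mul_comm]
  rw [upsilon0_apply, upsilon0_apply, h, Matrix.det_mul, Matrix.det_transpose, a.2, mul_one]

/-- The complex volume form `u^* Υ₀` on `T_x M` that belongs to the orbit of `u`. -/
def upsilon (z : J M) : TangentSpace 𝓘(ℝ, E6) z.base [⋀^Fin 3]→L[ℝ] ℂ :=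
  Quotient.lift (s := coframeSetoid z.base)
    (fun u => upsilon0.compContinuousLinearMap (u : TangentSpace 𝓘(ℝ, E6) z.base →L[ℝ] C3))
    (by
      rintro u u' ⟨a, h⟩
      ext v
      have e : (fun i => u' (v i)) = fun i => (a⁻¹).1.mulVec (u (v i)) := funext fun i => h (v i)
      change upsilon0 (fun i => u (v i)) = upsilon0 (fun i => u' (v i))
      rw [e, upsilon0_mulVec]) z.orbit

/-- The form `γ = (η¹ + i η⁴) ∧ (η² + i η⁵) ∧ (η³ + i η⁶)` on `J`, where `η = u ∘ π'`. -/
def gamma : EDS.DForm N (J M) 3 ℂ := fun z =>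
  (upsilon z).compContinuousLinearMap (mfderiv 𝓘(ℝ, N) 𝓘(ℝ, E6) (J.base (M := M)) z)

variable (M) in
/-- The generators of `𝒥`: the real and imaginary parts of `dγ`, in degree 4. -/
inductive IsGenerator : ∀ q : ℕ, EDS.DForm N (J M) q ℝ → Prop
  | re : IsGenerator 4 fun z => Complex.reCLM.compContinuousAlternatingMap (EDS.extD gamma z)
  | im : IsGenerator 4 fun z => Complex.imCLM.compContinuousAlternatingMap (EDS.extD gamma z)

variable (M) in
/-- The ideal `𝒥` on `J` generated by `dγ`. -/
def idealJ : ∀ q : ℕ, Set (EDS.DForm N (J M) q ℝ) :=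
  EDS.ideal fun q => {ψ | IsGenerator M q ψ}

variable (M) in
/-- `V_p(𝒥, π̄)`: the `π̄`-transverse `p`-dimensional integral elements of `𝒥`. -/
def VJ (p : ℕ) : Set (EDS.Gr N (J M) p) := 
  EDS.VTransverse (E' := E6) (Y := M) J.base (idealJ M) p

/-- The numbers `(m₀, …, m₆) = (26, 26, 26, 24, 18, 12, 6)`. -/
def m : Fin 7 → ℕ := ![26, 26, 26, 24, 18, 12, 6]

end Bundle

end SLBundle

end

/-! In a chart of `J` the form γ is the pullback of the standard volume form Υ₀ of ℂ³ by a coframe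
that depends on the fibre coordinates only. Hence dγ(v₀, …, v₃) is an alternating sum of terms
K(f)(ζb, ζb', ζb''): f is the fibre component of one of the vectors, b, b', b'' are the base
components of the other three, and K f is the variation of the volume form in the vertical direction
f. The stabilizer of Υ₀ is SL(3, ℂ), by which the coframes are divided, so K is an isomorphism of
the fibre onto the variations of Υ₀ under all real endomorphisms, that is, onto Λ^{3,0} ⊕ Λ^{2,1},
of complex dimension 10. This is `IsModel`, established in `exists_isModel_omega`; from there on the
proof is linear algebra.

Let W ⊂ ℂ³ be the base image of a transverse integral element P. On vertical vectors the polar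
equations are the restriction of Λ^{3,0} ⊕ Λ^{2,1} to Λ³W. Its complex rank is 0 for p ≤ 2 and 1, 4,
7, 10 for p = 3, 4, 5, 6, except that it drops for p = 4 if W is a complex subspace. Twice these
numbers are the codimensions 26 - m_p. For p = 5 there are ten equations, with three relations
between them that come from the missing type (1,2); by integrality of P these relations persist on
all vectors, not only on vertical ones (`IsModel.rel_of_vanishOn`). For p = 6 injectivity of K gives
H(P) = P. For p = 4 every non-complex W is good (`IsModel.finrank_polarN_four`), and a complex one
becomes non-complex when one basis vector is tilted along the single equation that defines
integrality (`exists_deformation`).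

Constancy of dim H near P follows since transversality and surjectivity of the polar equations are
open conditions. For ordinariness, the forms Re dγ and Im dγ are multiplied by differentials of
functions on M. With the base components of a plane fixed, such forms are linear in the fibre
components, so the functions φ̂ and their fibre derivatives are given by the same functionals.
Independent functionals chosen at P still cut out all the equations nearby, provided that the rank
of the whole system is not larger there (`exists_linearIndependent_functionals`). For p = 4, 5 the
system has the largest conceivable rank at P (`IsModel.rank_four`, `IsModel.rank_five`); for p = 6
its rank does not depend on the plane (`IsModel.rank_of_span`); for p ≤ 3 there are no equations. -/

noncomputable section

namespace EDS

/-! ### Wedge products with a 1-form, and integral elements of a generated ideal. -/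

section WedgeAlgebra

variable {V : Type*} [AddCommGroup V] [Module ℝ V] [TopologicalSpace V]

theorem wedge_apply {a b : ℕ} (α : V [⋀^Fin a]→L[ℝ] ℝ) (β : V [⋀^Fin b]→L[ℝ] ℝ)
    (v : Fin (a + b) → V) :
    wedge α β v = ((a.factorial * b.factorial : ℕ) : ℝ)⁻¹ *
      ∑ σ : Equiv.Perm (Fin (a + b)), ((Equiv.Perm.sign σ : ℤ) : ℝ) *
        (α (fun i => v (σ (Fin.castAdd b i))) * β (fun j => v (σ (Fin.natAdd a j)))) := by
  change ((a.factorial * b.factorial : ℕ) : ℝ)⁻¹ •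
    (ContinuousMultilinearMap.alternatization (mulForms α β)) v = _
  rw [ContinuousMultilinearMap.alternatization_apply_apply, smul_eq_mul]
  congr 1
  refine Finset.sum_congr rfl fun σ _ => ?_
  rw [Units.smul_def, zsmul_eq_mul]
  rfl

theorem wedge_eq_zero_of_forall_mem {a b : ℕ} {α : V [⋀^Fin a]→L[ℝ] ℝ} {β : V [⋀^Fin b]→L[ℝ] ℝ}
    {P : Set V} (h : (∀ u : Fin a → V, (∀ i, u i ∈ P) → α u = 0) ∨
      (∀ u : Fin b → V, (∀ i, u i ∈ P) → β u = 0))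
    (v : Fin (a + b) → V) (hv : ∀ i, v i ∈ P) : wedge α β v = 0 := by
  rw [wedge_apply, Finset.sum_eq_zero, mul_zero]
  intro σ _
  rcases h with h | h
  · rw [h _ fun i => hv _]; ring
  · rw [h _ fun i => hv _]; ring

/-- A permutation of `Fin (a + 1)` that fixes the last element does not change an alternating form
of degree `a`, up to its sign. -/
theorem map_perm_of_apply_last {a : ℕ} (α : V [⋀^Fin a]→L[ℝ] ℝ) (w : Fin (a + 1) → V)
    (σ : Equiv.Perm (Fin (a + 1))) (hσ : σ (Fin.last a) = Fin.last a) :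
    ((Equiv.Perm.sign σ : ℤ) : ℝ) * α (fun i => w (σ i.castSucc)) = α (fun i => w i.castSucc) := by
  have hne : ∀ x, σ x ≠ Fin.last a ↔ x ≠ Fin.last a := fun x =>
    not_congr ⟨fun h => σ.injective (h.trans hσ.symm), fun h => h ▸ hσ⟩
  have hs : Equiv.Perm.sign (σ.subtypePerm (p := fun x => x ≠ Fin.last a) hne) = Equiv.Perm.sign σ :=
    Equiv.Perm.sign_subtypePerm (p := fun x => x ≠ Fin.last a) σ hne fun x hx h =>
      hx (by rw [h, hσ])
  let e := finSuccAboveEquiv (Fin.last a)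
  let τ : Equiv.Perm (Fin a) := (e.trans (σ.subtypePerm (p := fun x => x ≠ Fin.last a) hne)).trans e.symm
  have hτ : ∀ i, (τ i).castSucc = σ i.castSucc := by
    intro i
    have h1 : e (τ i) = σ.subtypePerm (p := fun x => x ≠ Fin.last a) hne (e i) := by simp [τ]
    have h2 := congrArg Subtype.val h1
    simpa [e, finSuccAboveEquiv_apply] using h2
  have hsτ : Equiv.Perm.sign τ = Equiv.Perm.sign σ := by
    rw [← hs]
    exact Equiv.Perm.sign_trans_trans_symm (σ.subtypePerm (p := fun x => x ≠ Fin.last a) hne) e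
  have h := α.toAlternatingMap.map_perm (fun i => w i.castSucc) τ
  have h3 : α (fun i => w (σ i.castSucc)) = (Equiv.Perm.sign σ : ℤ) • α (fun i => w i.castSucc) := by
    rw [← hsτ]
    refine Eq.trans ?_ h
    change _ = α _
    congr 1
    funext i
    simp [hτ]
  rw [h3, zsmul_eq_mul, ← mul_assoc, ← Int.cast_mul]
  rcases Int.units_eq_one_or (Equiv.Perm.sign σ) with h | h <;> simp [h]

/-- As `l` kills all the vectors but the last, only the permutations that fix the last index
contribute to the wedge product, and they all contribute the same term. -/
theorem eq_zero_of_wedge_eq_zero {a : ℕ} (α : V [⋀^Fin a]→L[ℝ] ℝ) (l : V [⋀^Fin 1]→L[ℝ] ℝ)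
    (w : Fin (a + 1) → V) (h0 : ∀ i : Fin a, l (fun _ => w i.castSucc) = 0)
    (h1 : l (fun _ => w (Fin.last a)) ≠ 0) (h : wedge α l w = 0) :
    α (fun i => w i.castSucc) = 0 := by
  rw [wedge_apply] at h
  have hc : (((a.factorial * (1 : ℕ).factorial : ℕ) : ℝ))⁻¹ ≠ 0 := by positivity
  replace h := (mul_eq_zero.1 h).resolve_left hc
  have hterm : ∀ σ : Equiv.Perm (Fin (a + 1)), ((Equiv.Perm.sign σ : ℤ) : ℝ) *
      (α (fun i => w (σ (Fin.castAdd 1 i))) * l (fun j => w (σ (Fin.natAdd a j)))) =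
      if σ (Fin.last a) = Fin.last a then
        α (fun i => w i.castSucc) * l (fun _ => w (Fin.last a)) else 0 := by
    intro σ
    have e1 : (fun j : Fin 1 => w (σ (Fin.natAdd a j))) = fun _ => w (σ (Fin.last a)) := by
      funext j
      rw [Subsingleton.elim j 0]
      rfl
    rw [e1]
    split_ifs with hσ
    · rw [← mul_assoc, hσ, ← map_perm_of_apply_last α w σ hσ]
      rfl
    · obtain ⟨i, hi⟩ := Fin.exists_castSucc_eq.2 hσ
      rw [← hi, h0]; ring
  rw [Finset.sum_congr rfl fun σ _ => hterm σ, ← Finset.sum_filter, Finset.sum_const,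
    nsmul_eq_mul] at h
  have hcard : ((Finset.univ.filter fun σ : Equiv.Perm (Fin (a + 1)) =>
      σ (Fin.last a) = Fin.last a).card : ℝ) ≠ 0 := by
    rw [Nat.cast_ne_zero]
    exact Finset.card_ne_zero_of_mem (a := 1) (by simp)
  exact (mul_eq_zero.1 ((mul_eq_zero.1 h).resolve_left hcard)).resolve_right h1

end WedgeAlgebra

section IdealElements

variable {E : Type*} [NormedAddCommGroup E] [NormedSpace ℝ E]
  {X : Type*} [TopologicalSpace X] [ChartedSpace E X]

/-- Vanishing on `P` passes to sums and to products with arbitrary forms, so induction over the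
ideal leaves only the generators to check. -/
theorem isIntegralElement_ideal_iff (G : ∀ q : ℕ, Set (DForm E X q ℝ)) {x : X}
    (P : Submodule ℝ (TangentSpace 𝓘(ℝ, E) x)) :
    IsIntegralElement (ideal G) P ↔ ∀ (q : ℕ) (ψ : DForm E X q ℝ), ψ ∈ G q →
      ∀ v : Fin q → TangentSpace 𝓘(ℝ, E) x, (∀ i, v i ∈ P) → ψ x v = 0 := by
  refine ⟨fun h q ψ hψ => h q ψ (.gen ψ hψ), fun h q ψ hψ => ?_⟩
  induction hψ with
  | gen ψ hψ => exact h _ ψ hψ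
  | zero q => intro v _; rfl
  | add ψ ψ' _ _ h1 h2 => 
    intro v hv
    change ψ x v + ψ' x v = 0
    rw [h1 v hv, h2 v hv, add_zero]
  | wedge_right ψ α _ _ h1 => exact fun v hv => wedge_eq_zero_of_forall_mem (α := ψ x) (P := (P : Set _)) (.inl h1) v hv
  | wedge_left α ψ _ _ h1 => exact fun v hv => wedge_eq_zero_of_forall_mem (β := ψ x) (P := (P : Set _)) (.inr h1) v hv

theorem inChart_wedge {a b : ℕ} (α : DForm E X a ℝ) (β : DForm E X b ℝ) (x₀ : X) (y : E) :
    inChart (fun x => wedge (α x) (β x)) x₀ y = wedge (inChart α x₀ y) (inChart β x₀ y) := by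
  ext v
  rw [wedge_apply]
  exact wedge_apply _ _ _

end IdealElements

end EDS

namespace SLBundle

/-! ### Variations of the complex volume form under real endomorphisms. -/

section Derivation

theorem upsilon0_vec (a b c : C3) : upsilon0 ![a, b, c] =
    a 0 * b 1 * c 2 - a 0 * b 2 * c 1 - a 1 * b 0 * c 2 + a 1 * b 2 * c 0
      + a 2 * b 0 * c 1 - a 2 * b 1 * c 0 := by
  rw [upsilon0_apply, Matrix.det_fin_three]
  simp

/-- The action of a real endomorphism `τ` of `ℂ³` on the complex volume form, as a derivation. -/
def derUps : (C3 →L[ℝ] C3) →ₗ[ℝ] ((Fin 3 → C3) → ℂ) where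
  toFun τ u := ∑ i, upsilon0 (Function.update u i (τ (u i)))
  map_add' τ τ' := by
    funext u
    simp [Finset.sum_add_distrib, ContinuousAlternatingMap.map_update_add]
  map_smul' c τ := by
    funext u
    simp [Finset.mul_sum, ContinuousAlternatingMap.map_update_smul]

theorem derUps_apply (τ : C3 →L[ℝ] C3) (u : Fin 3 → C3) :
    derUps τ u = ∑ i, upsilon0 (Function.update u i (τ (u i))) := rfl

theorem derUps_vec (τ : C3 →L[ℝ] C3) (a b c : C3) :
    derUps τ ![a, b, c] =
      upsilon0 ![τ a, b, c] + upsilon0 ![a, τ b, c] + upsilon0 ![a, b, τ c] := by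
  have e0 : Function.update ![a, b, c] 0 (τ a) = ![τ a, b, c] := by
    funext i; fin_cases i <;> simp
  have e1 : Function.update ![a, b, c] 1 (τ b) = ![a, τ b, c] := by
    funext i; fin_cases i <;> simp
  have e2 : Function.update ![a, b, c] 2 (τ c) = ![a, b, τ c] := by
    funext i; fin_cases i <;> simp
  rw [derUps_apply, Fin.sum_univ_three, ← e0, ← e1, ← e2]
  rfl

theorem vec_eta (u : Fin 3 → C3) : u = ![u 0, u 1, u 2] := by
  ext i; fin_cases i <;> rfl

theorem derUps_ofMatrix (A : Matrix (Fin 3) (Fin 3) ℂ) (u : Fin 3 → C3) :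
    derUps (ofMatrix A) u = A.trace * upsilon0 u := by
  rw [vec_eta u, derUps_vec]
  simp only [upsilon0_vec, ofMatrix_apply, Matrix.mulVec, dotProduct, Fin.sum_univ_three,
    Matrix.trace, Matrix.diag]
  ring

theorem ext_of_parts {T T' : C3 →L[ℝ] C3} (h : linPart T = linPart T')
    (h' : antiPart T = antiPart T') : T = T' := by
  rw [eq_linPart_add_antiPart T, eq_linPart_add_antiPart T', h, h']

theorem linPart_add_map (T T' : C3 →L[ℝ] C3) : linPart (T + T') = linPart T + linPart T' := by
  ext j k
  simp [linPart]
  ring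

theorem antiPart_add_map (T T' : C3 →L[ℝ] C3) : antiPart (T + T') = antiPart T + antiPart T' := by
  ext j k
  simp [antiPart]
  ring

theorem conj_single (k : Fin 3) (z : ℂ) :
    conjCLM (Pi.single k z) = Pi.single k ((starRingEnd ℂ) z) := by
  ext j
  by_cases h : j = k
  · subst h; simp
  · simp [h]

/-- The stabilizer algebra of Υ₀ in the real endomorphisms is sl(3, ℂ): the linear part A
contributes tr A · Υ₀, of type (3,0), and the antilinear part contributes to type (2,1), faithfully.
-/
theorem parts_of_derUps_eq_zero {τ : C3 →L[ℝ] C3} (h : derUps τ = 0) :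
    (linPart τ).trace = 0 ∧ antiPart τ = 0 := by
  obtain ⟨A, hA⟩ : ∃ A, linPart τ = A := ⟨_, rfl⟩
  obtain ⟨B, hB⟩ : ∃ B, antiPart τ = B := ⟨_, rfl⟩
  have e : ∀ k z j, τ (Pi.single k z) j = A j k * z + B j k * (starRingEnd ℂ) z := by
    intro k z j
    conv_lhs => rw [eq_linPart_add_antiPart τ, hA, hB]
    simp only [_root_.add_apply, ContinuousLinearMap.comp_apply, conj_single, ofMatrix_apply,
      Matrix.mulVec_single, Pi.add_apply]
    simp
  have hI : Complex.I ≠ 0 := Complex.I_ne_zero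
  have key : ∀ k l m : Fin 3, ∀ z w t : ℂ,
      derUps τ ![Pi.single k z, Pi.single l w, Pi.single m t] = 0 := fun k l m z w t => by
    rw [h]; rfl
  rw [hA, hB]
  simp only [derUps_vec, upsilon0_vec, e] at key
  -- On the standard basis the value is tr A + tr B. Multiplying the k-th vector by i multiplies the
  -- value by i, except that the term of B at (k, k) changes sign; the comparison isolates that
  -- entry.
  have d0 := key 0 1 2 1 1 1
  have d1 := key 0 1 2 Complex.I 1 1
  have d2 := key 0 1 2 1 Complex.I 1
  have d3 := key 0 1 2 1 1 Complex.I
  -- On a triple e_k, i e_k, e_l the contributions of A cancel, and one off-diagonal entry of B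
  -- remains, with factor ±2i.
  have o1 := key 0 0 2 1 Complex.I 1
  have o2 := key 0 0 1 1 Complex.I 1
  have o3 := key 1 1 2 1 Complex.I 1
  have o4 := key 1 1 0 1 Complex.I 1
  have o5 := key 2 2 0 1 Complex.I 1
  have o6 := key 2 2 1 1 Complex.I 1
  simp at d0 d1 d2 d3 o1 o2 o3 o4 o5 o6
  have p1 : B 1 0 = 0 := by
    refine (mul_eq_zero.1 (?_ : Complex.I * B 1 0 = 0)).resolve_left hI
    linear_combination -o1 / 2
  have p2 : B 2 0 = 0 := by
    refine (mul_eq_zero.1 (?_ : Complex.I * B 2 0 = 0)).resolve_left hI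
    linear_combination o2 / 2
  have p3 : B 0 1 = 0 := by
    refine (mul_eq_zero.1 (?_ : Complex.I * B 0 1 = 0)).resolve_left hI
    linear_combination o3 / 2
  have p4 : B 2 1 = 0 := by
    refine (mul_eq_zero.1 (?_ : Complex.I * B 2 1 = 0)).resolve_left hI
    linear_combination -o4 / 2
  have p5 : B 1 2 = 0 := by
    refine (mul_eq_zero.1 (?_ : Complex.I * B 1 2 = 0)).resolve_left hI
    linear_combination o5 / 2
  have p6 : B 0 2 = 0 := by
    refine (mul_eq_zero.1 (?_ : Complex.I * B 0 2 = 0)).resolve_left hI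
    linear_combination -o6 / 2
  have q0 : B 0 0 = 0 := by
    refine (mul_eq_zero.1 (?_ : Complex.I * B 0 0 = 0)).resolve_left hI
    linear_combination (Complex.I * d0 - d1) / 2
  have q1 : B 1 1 = 0 := by
    refine (mul_eq_zero.1 (?_ : Complex.I * B 1 1 = 0)).resolve_left hI
    linear_combination (Complex.I * d0 - d2) / 2
  have q2 : B 2 2 = 0 := by
    refine (mul_eq_zero.1 (?_ : Complex.I * B 2 2 = 0)).resolve_left hI
    linear_combination (Complex.I * d0 - d3) / 2
  constructor
  · rw [Matrix.trace_fin_three]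
    linear_combination d0 - q0 - q1 - q2
  · ext j k
    fin_cases j <;> fin_cases k <;> assumption

end Derivation

/-! ### The slice of coframes is transverse to the SL(3, ℂ)-orbits. -/

section Slice

/-- `fibSlice` is polynomial of degree two, so its restriction to a line is exactly quadratic, and
the derivative is the coefficient of t. -/
theorem fderiv_fibSlice_apply (q f : Fib) :
    fderiv ℝ fibSlice q f = (ofMatrix (Matrix.diagonal ![f.1, 0, 0])).comp
        (ContinuousLinearMap.id ℝ C3 + (ofMatrix (Matrix.of q.2)).comp conjCLM) +
      (ofMatrix (Matrix.diagonal ![q.1, 1, 1])).comp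
        ((ofMatrix (Matrix.of f.2)).comp conjCLM) := by
  have hd : HasFDerivAt fibSlice (fderiv ℝ fibSlice q) q :=
    (contDiff_fibSlice.differentiable (by simp) q).hasFDerivAt
  have hl : HasDerivAt (fun t : ℝ => q + t • f) f 0 := by
    simpa using ((hasDerivAt_id (0 : ℝ)).smul_const f).const_add q
  have h0 : q = q + (0 : ℝ) • f := by simp
  have hd' : HasFDerivAt fibSlice (fderiv ℝ fibSlice q) (q + (0 : ℝ) • f) := by rwa [← h0]
  have h1 := HasFDerivAt.comp_hasDerivAt (0 : ℝ) hd' hl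
  refine h1.unique ?_
  set B1 := (ofMatrix (Matrix.diagonal ![f.1, 0, 0])).comp
        (ContinuousLinearMap.id ℝ C3 + (ofMatrix (Matrix.of q.2)).comp conjCLM) +
      (ofMatrix (Matrix.diagonal ![q.1, 1, 1])).comp
        ((ofMatrix (Matrix.of f.2)).comp conjCLM) with hB1
  set B2 := (ofMatrix (Matrix.diagonal ![f.1, 0, 0])).comp
    ((ofMatrix (Matrix.of f.2)).comp conjCLM) with hB2
  have e : (fibSlice ∘ fun t : ℝ => q + t • f) = fun t : ℝ => fibSlice q + t • B1 + (t * t) • B2 := by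
    funext t
    ext v j
    fin_cases j <;>
    simp [fibSlice, hB1, hB2, Matrix.mulVec, dotProduct, Fin.sum_univ_three, Matrix.diagonal_apply] <;>
    ring
  rw [e]
  have hx := (((hasDerivAt_id (0 : ℝ)).smul_const B1).const_add (fibSlice q)).add
    (((hasDerivAt_id (0 : ℝ)).mul (hasDerivAt_id (0 : ℝ))).smul_const B2)
  refine HasDerivAt.congr_deriv hx ?_
  rw [one_smul, id, mul_zero, zero_mul, add_zero]
  exact (congrArg (B1 + ·) (zero_smul ℝ B2)).trans (add_zero B1)

theorem linPart_fibSlice (q : Fib) : linPart (fibSlice q) = Matrix.diagonal ![q.1, 1, 1] := by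
  rw [fibSlice, ← ofMatrix_one, linPart_comp, linPart_add, mul_one]

theorem antiPart_fibSlice (q : Fib) :
    antiPart (fibSlice q) = Matrix.diagonal ![q.1, 1, 1] * Matrix.of q.2 := by
  rw [fibSlice, ← ofMatrix_one, antiPart_comp, antiPart_add]

theorem linPart_fderiv (q f : Fib) :
    linPart (fderiv ℝ fibSlice q f) = Matrix.diagonal ![f.1, 0, 0] := by
  have e : (ofMatrix (Matrix.of f.2)).comp conjCLM =
      ofMatrix 0 + (ofMatrix (Matrix.of f.2)).comp conjCLM := by
    ext1 v; simp
  rw [fderiv_fibSlice_apply, linPart_add_map, ← ofMatrix_one, linPart_comp, linPart_comp,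
    linPart_add, e, linPart_add]
  simp

theorem antiPart_fderiv (q f : Fib) :
    antiPart (fderiv ℝ fibSlice q f) = Matrix.diagonal ![f.1, 0, 0] * Matrix.of q.2 +
      Matrix.diagonal ![q.1, 1, 1] * Matrix.of f.2 := by
  have e : (ofMatrix (Matrix.of f.2)).comp conjCLM =
      ofMatrix 0 + (ofMatrix (Matrix.of f.2)).comp conjCLM := by
    ext1 v; simp
  rw [fderiv_fibSlice_apply, antiPart_add_map, ← ofMatrix_one, antiPart_comp, antiPart_comp,
    antiPart_add, e, antiPart_add]

/-- The action of a vertical tangent vector on the complex volume form, in a frame in which this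
form is `upsilon0`. -/
def vertMap (q : Fib) (σ : C3 ≃L[ℝ] C3) : Fib →ₗ[ℝ] ((Fin 3 → C3) → ℂ) :=
  derUps ∘ₗ ((ContinuousLinearMap.compL ℝ C3 C3 C3).flip (σ.symm : C3 →L[ℝ] C3)).toLinearMap ∘ₗ
    (fderiv ℝ fibSlice q).toLinearMap

theorem vertMap_eq (q : Fib) (σ : C3 ≃L[ℝ] C3) (f : Fib) :
    vertMap q σ f = derUps ((fderiv ℝ fibSlice q f).comp (σ.symm : C3 →L[ℝ] C3)) := rfl

theorem diag_mul_diag (a b : ℂ) : (Matrix.diagonal ![a, 0, 0] : Matrix (Fin 3) (Fin 3) ℂ) *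
    Matrix.diagonal ![b, 1, 1] = Matrix.diagonal ![a * b, 0, 0] := by
  rw [Matrix.diagonal_mul_diagonal]
  congr 1
  ext i; fin_cases i <;> simp

theorem diag_mul_diag' (a b : ℂ) : (Matrix.diagonal ![a, 1, 1] : Matrix (Fin 3) (Fin 3) ℂ) *
    Matrix.diagonal ![b, 1, 1] = Matrix.diagonal ![a * b, 1, 1] := by
  rw [Matrix.diagonal_mul_diagonal]
  congr 1
  ext i; fin_cases i <;> simp

theorem diag_one : (Matrix.diagonal ![1, 1, 1] : Matrix (Fin 3) (Fin 3) ℂ) = 1 := by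
  rw [← Matrix.diagonal_one]
  congr 1
  ext i; fin_cases i <;> simp

/-- Tangent vectors of the slice, together with sl(3, ℂ), span all the real endomorphisms. Since
sl(3, ℂ) acts trivially on Υ₀, the slice directions alone give every variation. -/
theorem exists_vertMap_eq {q : Fib} (hq : q.1 ≠ 0) {σ : C3 ≃L[ℝ] C3}
    (hσ : (σ : C3 →L[ℝ] C3) = fibSlice q) (τ : C3 →L[ℝ] C3) : ∃ f, vertMap q σ f = derUps τ := by
  set D : Matrix (Fin 3) (Fin 3) ℂ := Matrix.diagonal ![q.1, 1, 1] with hD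
  set D' : Matrix (Fin 3) (Fin 3) ℂ := Matrix.diagonal ![q.1⁻¹, 1, 1] with hD'
  have hDD : D' * D = 1 := by rw [hD, hD', diag_mul_diag', inv_mul_cancel₀ hq, diag_one]
  have hDD' : D * D' = 1 := by rw [hD, hD', diag_mul_diag', mul_inv_cancel₀ hq, diag_one]
  set L := linPart (τ.comp (σ : C3 →L[ℝ] C3)) with hL
  -- One solves dS(f) = (τ + A) ∘ σ, with dS the derivative of `fibSlice` and A trace-free complex
  -- linear. The linear parts determine `A` in terms of `f1`, the condition tr A = 0 determines
  -- `f1`, and the antilinear parts determine `f2`.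
  set f1 : ℂ := (L * D').trace * q.1 with hf1
  set A : Matrix (Fin 3) (Fin 3) ℂ := (Matrix.diagonal ![f1, 0, 0] - L) * D' with hA
  set f2 : Matrix (Fin 3) (Fin 3) ℂ := D' * (antiPart (τ.comp (σ : C3 →L[ℝ] C3)) +
    A * D * Matrix.of q.2 - Matrix.diagonal ![f1, 0, 0] * Matrix.of q.2) with hf2
  have htr : A.trace = 0 := by
    rw [hA, sub_mul, Matrix.trace_sub, hD', diag_mul_diag, Matrix.trace_diagonal,
      Fin.sum_univ_three]
    simp only [hf1, mul_assoc, mul_inv_cancel₀ hq, mul_one]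
    simp [hD']
  refine ⟨(f1, fun j k => f2 j k), ?_⟩
  have hder : fderiv ℝ fibSlice q (f1, fun j k => f2 j k) =
      (τ + ofMatrix A).comp (σ : C3 →L[ℝ] C3) := by
    rw [ContinuousLinearMap.add_comp]
    apply ext_of_parts
    · rw [linPart_fderiv, linPart_add_map, linPart_comp, hσ, linPart_fibSlice, ← hσ, ← hL, hA,
        mul_assoc, ← hD, hDD, mul_one]
      simp
    · rw [antiPart_fderiv, antiPart_add_map, antiPart_comp, hσ, antiPart_fibSlice, ← hσ]
      have e : Matrix.of (fun j k => f2 j k) = f2 := rfl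
      rw [e, ← hD, hf2, ← mul_assoc D, hDD', one_mul, mul_assoc]
      simp
  rw [vertMap_eq, hder]
  have e : ((τ + ofMatrix A).comp (σ : C3 →L[ℝ] C3)).comp (σ.symm : C3 →L[ℝ] C3) =
      τ + ofMatrix A := by
    ext1 v; simp
  rw [e, map_add]
  funext u
  simp [derUps_ofMatrix, htr]

/-- If the variation vanishes, then dS(f) = A ∘ σ with A in sl(3, ℂ). The linear parts give diag(f₁,
0, 0) = A · diag(c, 1, 1), so that only the first column of A is nonzero and tr A = 0 forces f₁ = 0;
the antilinear parts force f₂ = 0. -/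
theorem vertMap_injective {q : Fib} (hq : q.1 ≠ 0) {σ : C3 ≃L[ℝ] C3}
    (hσ : (σ : C3 →L[ℝ] C3) = fibSlice q) {f : Fib} (hf : vertMap q σ f = 0) : f = 0 := by
  rw [vertMap_eq] at hf
  obtain ⟨h1, h2⟩ := parts_of_derUps_eq_zero hf
  set τ := (fderiv ℝ fibSlice q f).comp (σ.symm : C3 →L[ℝ] C3) with hτ
  set A := linPart τ with hA
  have hτA : τ = ofMatrix A := by
    apply ext_of_parts
    · have e : ofMatrix A = ofMatrix A + (ofMatrix 0).comp conjCLM := by ext1 v; simp [ofMatrix]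
      rw [e, linPart_add]
    · have e : ofMatrix A = ofMatrix A + (ofMatrix 0).comp conjCLM := by ext1 v; simp [ofMatrix]
      rw [e, antiPart_add, h2]
  have hd : fderiv ℝ fibSlice q f = (ofMatrix A).comp (fibSlice q) := by
    rw [← hτA, hτ, ← hσ]
    ext1 v; simp
  have hl := congrArg linPart hd
  have ha := congrArg antiPart hd
  rw [linPart_fderiv, linPart_comp, linPart_fibSlice] at hl
  rw [antiPart_fderiv, antiPart_comp, antiPart_fibSlice, ← mul_assoc, ← hl, add_eq_left] at ha
  have hDD : (Matrix.diagonal ![q.1⁻¹, 1, 1] : Matrix (Fin 3) (Fin 3) ℂ) *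
      Matrix.diagonal ![q.1, 1, 1] = 1 := by rw [diag_mul_diag', inv_mul_cancel₀ hq, diag_one]
  have h3 : Matrix.of f.2 = 0 := by
    have := congrArg (fun X => (Matrix.diagonal ![q.1⁻¹, 1, 1] : Matrix (Fin 3) (Fin 3) ℂ) * X) ha
    simpa [← mul_assoc, hDD] using this
  have h4 : f.1 = 0 := by
    have e0 := congrFun (congrFun hl 0) 0
    have e1 := congrFun (congrFun hl 1) 1
    have e2 := congrFun (congrFun hl 2) 2
    simp [Matrix.mul_diagonal] at e0 e1 e2
    rw [Matrix.trace_fin_three] at h1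
    rw [e0]
    linear_combination q.1 * h1 + q.1 * e1 + q.1 * e2
  exact Prod.ext h4 h3

end Slice

end SLBundle

namespace EDS

/-! ### The exterior derivative in an arbitrary chart. -/

section ChartCalculus

variable {E : Type*} [NormedAddCommGroup E] [NormedSpace ℝ E]
  {X : Type*} [TopologicalSpace X] [ChartedSpace E X]
  {F : Type*} [NormedAddCommGroup F] [NormedSpace ℝ F]

/-- The differential of the inverse of a chart, as a map of the model space. -/
def chartD (x₀ : X) (y : E) : E →L[ℝ] TangentSpace 𝓘(ℝ, E) ((chartAt E x₀).symm y) :=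
  mfderiv 𝓘(ℝ, E) 𝓘(ℝ, E) (chartAt E x₀).symm y

theorem inChart_apply {q : ℕ} (θ : DForm E X q F) (x₀ : X) (y : E) (v : Fin q → E) :
    inChart θ x₀ y v = θ ((chartAt E x₀).symm y) (fun i => chartD x₀ y (v i)) := rfl

variable [IsManifold 𝓘(ℝ, E) ∞ X]

theorem isManifold_one : IsManifold 𝓘(ℝ, E) 1 X :=
  IsManifold.of_le (n := ∞) (by exact_mod_cast le_top)

theorem chartD_comp (x₀ : X) {y : E} (hy : y ∈ (chartAt E x₀).target) :
    (chartD x₀ y).comp (mfderiv 𝓘(ℝ, E) 𝓘(ℝ, E) (chartAt E x₀) ((chartAt E x₀).symm y)) =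
      ContinuousLinearMap.id ℝ _ := by
  have := isManifold_one (E := E) (X := X)
  have h := (mdifferentiable_chart (I := 𝓘(ℝ, E)) x₀).symm_comp_deriv
    (x := (chartAt E x₀).symm y) ((chartAt E x₀).map_target hy)
  rw [(chartAt E x₀).right_inv hy] at h
  exact h

theorem comp_chartD (x₀ : X) {y : E} (hy : y ∈ (chartAt E x₀).target) :
    (mfderiv 𝓘(ℝ, E) 𝓘(ℝ, E) (chartAt E x₀) ((chartAt E x₀).symm y)).comp (chartD x₀ y) =
      ContinuousLinearMap.id ℝ _ := by
  have := isManifold_one (E := E) (X := X)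
  exact (mdifferentiable_chart (I := 𝓘(ℝ, E)) x₀).comp_symm_deriv hy

theorem chartD_bijective (x₀ : X) {y : E} (hy : y ∈ (chartAt E x₀).target) :
    Function.Bijective (chartD x₀ y) := by
  constructor
  · exact Function.LeftInverse.injective fun v => congrArg (fun L => L v) (comp_chartD x₀ hy)
  · exact Function.RightInverse.surjective fun v => congrArg (fun L => L v) (chartD_comp x₀ hy)

/-- The exterior derivative may be computed in any chart. -/
theorem inChart_extD {q : ℕ} (θ : DForm E X q F)
    (hθ : ∀ (x₀ : X), ∀ y ∈ (chartAt E x₀).target, DifferentiableAt ℝ (inChart θ x₀) y)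
    (x₀ : X) {y : E} (hy : y ∈ (chartAt E x₀).target) :
    inChart (extD θ) x₀ y = extDeriv (inChart θ x₀) y := by
  have := isManifold_one (E := E) (X := X)
  set x := (chartAt E x₀).symm y with hx
  set f : E → E := fun y' => chartAt E x ((chartAt E x₀).symm y') with hf
  set S := ((chartAt E x₀).symm.trans (chartAt E x)).source with hS
  have hSo : IsOpen S := ((chartAt E x₀).symm.trans (chartAt E x)).open_source
  have hyS : y ∈ S := ⟨hy, mem_chart_source E x⟩
  have hfS : ∀ y' ∈ S, fderiv ℝ f y' = (mfderiv 𝓘(ℝ, E) 𝓘(ℝ, E) (chartAt E x)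
      ((chartAt E x₀).symm y')).comp (chartD x₀ y') := by
    intro y' hy'
    rw [← mfderiv_eq_fderiv]
    exact mfderiv_comp y' (mdifferentiableAt_atlas (I := 𝓘(ℝ, E)) (chart_mem_atlas E x) hy'.2)
      (mdifferentiableAt_atlas_symm (I := 𝓘(ℝ, E)) (chart_mem_atlas E x₀) hy'.1)
  have hpull : ∀ y' ∈ S, inChart θ x₀ y' =
      (inChart θ x (f y')).compContinuousLinearMap (fderiv ℝ f y') := by
    intro y' hy'
    have h1 : (chartAt E x).symm (f y') = (chartAt E x₀).symm y' :=
      (chartAt E x).left_inv hy'.2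
    ext v
    rw [hfS y' hy']
    have h2 : (chartD x (f y')).comp (mfderiv 𝓘(ℝ, E) 𝓘(ℝ, E) (chartAt E x)
        ((chartAt E x).symm (f y'))) = ContinuousLinearMap.id ℝ _ :=
      chartD_comp x ((chartAt E x).map_source hy'.2)
    change θ ((chartAt E x₀).symm y') (fun i => chartD x₀ y' (v i)) =
      θ ((chartAt E x).symm (f y')) (fun i => chartD x (f y')
        (mfderiv 𝓘(ℝ, E) 𝓘(ℝ, E) (chartAt E x) ((chartAt E x₀).symm y') (chartD x₀ y' (v i))))
    rw [h1] at h2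
    have h3 : ∀ w : E, chartD x (f y') (mfderiv 𝓘(ℝ, E) 𝓘(ℝ, E) (chartAt E x)
        ((chartAt E x₀).symm y') w) = w := fun w => congrArg (fun L : E →L[ℝ] E => L w) h2
    have h4 : ∀ p p' : X, p = p' → ∀ w : Fin q → E, θ p w = θ p' w := by
      rintro p _ rfl w; rfl
    refine (h4 _ _ h1.symm _).trans ?_
    exact congrArg (fun w : Fin q → E => θ ((chartAt E x).symm (f y')) w)
      (funext fun i => (h3 _).symm)
  have hfc : ContDiffAt ℝ ∞ f y := by
    have h := contDiffOn_ext_coord_change (I := 𝓘(ℝ, E)) (n := ∞) x x₀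
    have h2 : ContDiffOn ℝ ∞ f S := by simpa [Function.comp_def, hf, hS] using h
    exact h2.contDiffAt (hSo.mem_nhds hyS)
  have hev : inChart θ x₀ =ᶠ[𝓝 y] fun y' =>
      (inChart θ x (f y')).compContinuousLinearMap (fderiv ℝ f y') :=
    Filter.eventuallyEq_of_mem (hSo.mem_nhds hyS) hpull
  -- Near `y` the two local expressions of θ are related by pullback along the transition map `f`,
  -- with which the exterior derivative commutes. The other side is the derivative in the chart at
  -- `x` itself, which is how `extD` is defined at `x`.
  rw [hev.extDeriv_eq, extDeriv_pullback (r := ∞)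
    (hθ x (f y) ((chartAt E x).map_source (mem_chart_source E x))) hfc
    (by rw [minSmoothness_of_isRCLikeNormedField]; exact WithTop.coe_le_coe.2 (le_top : (2 : ℕ∞) ≤ ⊤)), hfS y hyS]
  rfl

end ChartCalculus

end EDS

section PullbackDerivative

variable {E V W F : Type*} [NormedAddCommGroup E] [NormedSpace ℝ E]
  [NormedAddCommGroup V] [NormedSpace ℝ V] [NormedAddCommGroup W] [NormedSpace ℝ W]
  [NormedAddCommGroup F] [NormedSpace ℝ F]

theorem fderiv_const_compContinuousLinearMap {n : ℕ} (φ : W [⋀^Fin n]→L[ℝ] F) {g : E → V →L[ℝ] W}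
    {g' : E →L[ℝ] V →L[ℝ] W} {y : E} (hg : HasFDerivAt g g' y) (w : E) (v : Fin n → V) :
    fderiv ℝ (fun y => φ.compContinuousLinearMap (g y)) y w v =
      ∑ k, φ (Function.update (fun j => g y (v j)) k (g' w (v k))) := by
  have h1 := (hasFDerivAt_const φ y).continuousAlternatingMapCompContinuousLinearMap hg
  rw [h1.fderiv, ContinuousLinearMap.comp_zero, zero_add, ContinuousLinearMap.comp_apply,
    ContinuousAlternatingMap.fderivCompContinuousLinearMap_apply]
  refine Finset.sum_congr rfl fun k _ => congrArg φ ?_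
  funext j
  by_cases hjk : j = k
  · subst hjk; simp
  · simp [hjk]

end PullbackDerivative

namespace SLBundle

/-! ### Local expressions of γ and dγ. -/

section Charts

variable {M : Type*} [TopologicalSpace M] [ChartedSpace E6 M]

/-- The reference isomorphism in the index of the preferred chart of `J` at `z`. -/
def refIso (z : J M) : E6 ≃L[ℝ] C3 := toModel z.exists_rep.choose

/-- The local expression of the tautological form in the chart at `z`. -/
def frame (z : J M) (y : N) : N →L[ℝ] C3 :=
  (fibSlice y.2).comp ((refIso z : E6 →L[ℝ] C3).comp (ContinuousLinearMap.fst ℝ E6 Fib))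

theorem frame_apply (z : J M) (y v : N) : frame z y v = fibSlice y.2 (refIso z v.1) := rfl

theorem hasFDerivAt_frame (z : J M) (y : N) : HasFDerivAt (frame z)
    ((((ContinuousLinearMap.compL ℝ N C3 C3).flip
      ((refIso z : E6 →L[ℝ] C3).comp (ContinuousLinearMap.fst ℝ E6 Fib)))).comp
      ((fderiv ℝ fibSlice y.2).comp (ContinuousLinearMap.snd ℝ E6 Fib))) y := by
  have h1 : HasFDerivAt fibSlice (fderiv ℝ fibSlice y.2) y.2 :=
    (contDiff_fibSlice.differentiable (by simp) y.2).hasFDerivAt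
  have h2 : HasFDerivAt (fun y : N => fibSlice y.2)
    ((fderiv ℝ fibSlice y.2).comp (ContinuousLinearMap.snd ℝ E6 Fib)) y :=
    h1.comp y hasFDerivAt_snd
  exact (((ContinuousLinearMap.compL ℝ N C3 C3).flip
      ((refIso z : E6 →L[ℝ] C3).comp (ContinuousLinearMap.fst ℝ E6 Fib)))).hasFDerivAt.comp y h2

variable [IsManifold 𝓘(ℝ, E6) ∞ M]

theorem chartAt_apply_fst (z z' : J M) : (chartAt N z z').1 = chartAt E6 z.base z'.base := rfl

theorem mdifferentiableAt_base (z : J M) :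
    MDifferentiableAt 𝓘(ℝ, N) 𝓘(ℝ, E6) (J.base (M := M)) z := by
  have := EDS.isManifold_one (E := E6) (X := M)
  have := EDS.isManifold_one (E := N) (X := J M)
  have h1 : MDifferentiableAt 𝓘(ℝ, N) 𝓘(ℝ, N) (chartAt N z) z :=
    mdifferentiableAt_atlas (I := 𝓘(ℝ, N)) (chart_mem_atlas N z) (mem_chart_source N z)
  have h2 : MDifferentiableAt 𝓘(ℝ, N) 𝓘(ℝ, E6) (Prod.fst : N → E6) (chartAt N z z) :=
    differentiableAt_fst.mdifferentiableAt
  have h3 : MDifferentiableAt 𝓘(ℝ, E6) 𝓘(ℝ, E6) (chartAt E6 z.base).symm (chartAt N z z).1 :=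
    mdifferentiableAt_atlas_symm (I := 𝓘(ℝ, E6)) (chart_mem_atlas E6 z.base)
      (mem_chart_target E6 z.base)
  have h4 := MDifferentiableAt.comp z (MDifferentiableAt.comp (chartAt N z z) h3 h2) h1
  refine h4.congr_of_eventuallyEq ?_
  filter_upwards [(chartAt N z).open_source.mem_nhds (mem_chart_source N z)] with z' hz'
  have h5 : z'.base ∈ (chartAt E6 z.base).source := hz'.1
  exact ((chartAt E6 z.base).left_inv h5).symm

theorem mfderiv_base_chartD (z : J M) {y : N} (hy : y ∈ (chartAt N z).target) (v : N) :
    mfderiv 𝓘(ℝ, N) 𝓘(ℝ, E6) (J.base (M := M)) ((chartAt N z).symm y) (EDS.chartD z y v) =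
      EDS.chartD z.base y.1 v.1 := by
  have := EDS.isManifold_one (E := E6) (X := M)
  have := EDS.isManifold_one (E := N) (X := J M)
  have h1 : MDifferentiableAt 𝓘(ℝ, N) 𝓘(ℝ, N) (chartAt N z).symm y :=
    mdifferentiableAt_atlas_symm (I := 𝓘(ℝ, N)) (chart_mem_atlas N z) hy
  have h2 : MDifferentiableAt 𝓘(ℝ, N) 𝓘(ℝ, E6) (Prod.fst : N → E6) y :=
    differentiableAt_fst.mdifferentiableAt
  have h3 : MDifferentiableAt 𝓘(ℝ, E6) 𝓘(ℝ, E6) (chartAt E6 z.base).symm y.1 :=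
    mdifferentiableAt_atlas_symm (I := 𝓘(ℝ, E6)) (chart_mem_atlas E6 z.base) hy.1
  have e1 := mfderiv_comp y (mdifferentiableAt_base ((chartAt N z).symm y)) h1
  have e2 := mfderiv_comp y h3 h2
  have e3 : (J.base (M := M)) ∘ (chartAt N z).symm = (chartAt E6 z.base).symm ∘ Prod.fst := rfl
  rw [e3, e2, mfderiv_eq_fderiv, fderiv_fst] at e1
  exact (congrArg (fun L : N →L[ℝ] E6 => L v) e1).symm

/-- The inverse of the chart of `J` is built from a section of coframes. In the coordinates of `M`
this section is `fibSlice q ∘ refIso z`, the differential of the chart of `M` cancelling the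
coordinate change in `sliceMap`. -/
theorem inChart_gamma (z : J M) {y : N} (hy : y ∈ (chartAt N z).target) :
    EDS.inChart gamma z y = upsilon0.compContinuousLinearMap (frame z y) := by
  have := EDS.isManifold_one (E := E6) (X := M)
  ext v
  have h1 : ∀ i, mfderiv 𝓘(ℝ, N) 𝓘(ℝ, E6) (J.base (M := M)) ((chartAt N z).symm y)
      (EDS.chartD z y (v i)) = EDS.chartD z.base y.1 (v i).1 :=
    fun i => mfderiv_base_chartD z hy (v i)
  have hx : (chartAt E6 z.base).symm y.1 ∈ (chartAt E6 z.base).source :=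
    (chartAt E6 z.base).map_target hy.1
  have h2 : ∀ w : E6, toModel (coframeOf (refIso z) ((chartAt E6 z.base).symm y.1)
      (sliceMap z.base (refIso z) ((chartAt E6 z.base).symm y.1) y.2))
        (EDS.chartD z.base y.1 w) = fibSlice y.2 (refIso z w) := by
    intro w
    refine (coframeOf_apply (sliceMap_invertible hx (refIso z) hy.2.2) _).trans ?_
    have h3 : tangentCoordChange 𝓘(ℝ, E6) ((chartAt E6 z.base).symm y.1) z.base
        ((chartAt E6 z.base).symm y.1) (EDS.chartD z.base y.1 w) = w := by
      rw [← mfderiv_chartAt_eq_tangentCoordChange hx]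
      exact congrArg (fun L : E6 →L[ℝ] E6 => L w) (EDS.comp_chartD z.base hy.1)
    change fibSlice y.2 (refIso z (tangentCoordChange 𝓘(ℝ, E6) ((chartAt E6 z.base).symm y.1)
      z.base ((chartAt E6 z.base).symm y.1) (EDS.chartD z.base y.1 w))) = _
    rw [h3]
  change upsilon0 (fun i => toModel (coframeOf (refIso z) ((chartAt E6 z.base).symm y.1)
      (sliceMap z.base (refIso z) ((chartAt E6 z.base).symm y.1) y.2))
      (mfderiv 𝓘(ℝ, N) 𝓘(ℝ, E6) (J.base (M := M)) ((chartAt N z).symm y)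
      (EDS.chartD z y (v i)))) = upsilon0 (fun i => frame z y (v i))
  congr 1
  funext i
  rw [frame_apply, ← h2]
  exact congrArg _ (h1 i)

theorem differentiableAt_inChart_gamma (z : J M) {y : N} (hy : y ∈ (chartAt N z).target) :
    DifferentiableAt ℝ (EDS.inChart gamma z) y := by
  have h : DifferentiableAt ℝ (fun y => upsilon0.compContinuousLinearMap (frame z y)) y :=
    (differentiableAt_const upsilon0).continuousAlternatingMapCompContinuousLinearMap
      (hasFDerivAt_frame z y).differentiableAt
  refine h.congr_of_eventuallyEq ?_
  filter_upwards [(chartAt N z).open_target.mem_nhds hy] with y' hy'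
  exact inChart_gamma z hy'

/-- The local expression of `dγ` in the chart at `z`. -/
def omega (z : J M) (y : N) : N [⋀^Fin 4]→L[ℝ] ℂ := EDS.inChart (EDS.extD gamma) z y

/-- The local coframe depends on the fibre coordinates alone, so the differentiated argument enters
only through its fibre component, and the remaining ones only through their base components. -/
theorem omega_apply (z : J M) {y : N} (hy : y ∈ (chartAt N z).target) (v : Fin 4 → N) :
    omega z y v = ∑ i : Fin 4, (-1 : ℂ) ^ (i : ℕ) * ∑ k : Fin 3,
      upsilon0 (Function.update (fun j => fibSlice y.2 (refIso z (v (i.succAbove j)).1)) k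
        (fderiv ℝ fibSlice y.2 (v i).2 (refIso z (v (i.succAbove k)).1))) := by
  rw [omega, EDS.inChart_extD gamma (fun z y hy => differentiableAt_inChart_gamma z hy) z hy,
    extDeriv_apply (differentiableAt_inChart_gamma z hy)]
  refine Finset.sum_congr rfl fun i _ => ?_
  have hev : EDS.inChart gamma z =ᶠ[𝓝 y]
      fun y => upsilon0.compContinuousLinearMap (frame z y) := by
    filter_upwards [(chartAt N z).open_target.mem_nhds hy] with y' hy'
    exact inChart_gamma z hy'
  rw [fderiv_continuousAlternatingMap_apply_const_apply (differentiableAt_inChart_gamma z hy),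
    hev.fderiv_eq, fderiv_const_compContinuousLinearMap upsilon0 (hasFDerivAt_frame z y),
    zsmul_eq_mul]
  push_cast
  rfl

end Charts

end SLBundle

section AlternatingSpan

/-- An alternating map vanishes on the span of a finite family if it vanishes on the increasing
subfamilies. -/
theorem AlternatingMap.eq_zero_of_strictMono {V W : Type*} [AddCommGroup V] [Module ℝ V]
    [AddCommGroup W] [Module ℝ W] {n p : ℕ} (g : V [⋀^Fin n]→ₗ[ℝ] W) (e : Fin p → V)
    (h : ∀ s : Fin n → Fin p, StrictMono s → g (e ∘ s) = 0) (u : Fin n → V)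
    (hu : ∀ i, u i ∈ Submodule.span ℝ (range e)) : g u = 0 := by
  have hall : ∀ r : Fin n → Fin p, g (e ∘ r) = 0 := by
    intro r
    by_cases hr : Function.Injective r
    · have hs : StrictMono (r ∘ Tuple.sort r) :=
        (Tuple.monotone_sort r).strictMono_of_injective (hr.comp (Tuple.sort r).injective)
      have h1 := g.map_perm (e ∘ r) (Tuple.sort r)
      have h2 : (e ∘ r) ∘ (Tuple.sort r) = e ∘ (r ∘ Tuple.sort r) := rfl
      rw [h2, h _ hs] at h1
      exact ((smul_eq_zero_iff_eq _).1 h1.symm)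
    · exact g.map_eq_zero_of_not_injective _ fun h' => hr (Function.Injective.of_comp h')
  have hc : ∀ i, ∃ c : Fin p → ℝ, ∑ j, c j • e j = u i := fun i =>
    (Submodule.mem_span_range_iff_exists_fun ℝ).1 (hu i)
  choose c hc using hc
  have hu' : u = fun i => ∑ j, c i j • e j := funext fun i => (hc i).symm
  have h1 := g.toMultilinearMap.map_sum (fun i j => c i j • e j)
  rw [hu']
  refine h1.trans (Finset.sum_eq_zero fun r _ => ?_)
  have h2 := g.toMultilinearMap.map_smul_univ (fun i => c i (r i)) (fun i => e (r i))
  refine h2.trans ?_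
  have h3 : g.toMultilinearMap (fun i => e (r i)) = 0 := hall r
  rw [h3, smul_zero]

end AlternatingSpan

namespace SLBundle

/-! ### The algebraic model of dγ at a point. -/

section Model

/-- The algebraic structure of `dγ` at a point of `J`: `φ` is the value of `dγ` on the tangent
space `N`, `ζ` the coframe, and `K` the action of the vertical vectors on `γ`. -/
structure IsModel (φ : N [⋀^Fin 4]→L[ℝ] ℂ) (ζ : E6 ≃L[ℝ] C3)
    (K : Fib →ₗ[ℝ] ((Fin 3 → C3) → ℂ)) : Prop where
  formula : ∀ v : Fin 4 → N, φ v =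
    ∑ i : Fin 4, (-1 : ℂ) ^ (i : ℕ) * K (v i).2 (fun j => ζ (v (i.succAbove j)).1)
  surj : ∀ τ, ∃ f, K f = derUps τ
  mem : ∀ f, ∃ τ, K f = derUps τ
  inj : ∀ f, K f = 0 → f = 0

/-- Composing the reference isomorphism with σ = `fibSlice y.2` makes the volume form at the point
equal to Υ₀ itself, so that `K` becomes `vertMap`. -/
theorem exists_isModel_omega {M : Type*} [TopologicalSpace M] [ChartedSpace E6 M]
    [IsManifold 𝓘(ℝ, E6) ∞ M] (z : J M) {y : N} (hy : y ∈ (chartAt N z).target) :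
    ∃ ζ K, IsModel (omega z y) ζ K := by
  obtain ⟨σ, hσ⟩ := hy.2.2
  refine ⟨(refIso z).trans σ, vertMap y.2 σ, ?_, exists_vertMap_eq hy.2.1 hσ, fun f => ⟨_, rfl⟩,
    fun f => vertMap_injective hy.2.1 hσ⟩
  intro v
  rw [omega_apply z hy]
  refine Finset.sum_congr rfl fun i _ => ?_
  rw [vertMap_eq, derUps_apply]
  congr 1
  refine Finset.sum_congr rfl fun k _ => ?_
  rw [← hσ]
  simp

variable {φ : N [⋀^Fin 4]→L[ℝ] ℂ} {ζ : E6 ≃L[ℝ] C3} {K : Fib →ₗ[ℝ] ((Fin 3 → C3) → ℂ)}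

theorem IsModel.apply_vec (h : IsModel φ ζ K) (a b c d : N) : φ ![a, b, c, d] =
    K a.2 ![ζ b.1, ζ c.1, ζ d.1] - K b.2 ![ζ a.1, ζ c.1, ζ d.1] +
      K c.2 ![ζ a.1, ζ b.1, ζ d.1] - K d.2 ![ζ a.1, ζ b.1, ζ c.1] := by
  rw [h.formula, Fin.sum_univ_four]
  have e0 : (fun j : Fin 3 => ζ ((![a, b, c, d] : Fin 4 → N) ((0 : Fin 4).succAbove j)).1) =
      ![ζ b.1, ζ c.1, ζ d.1] := by funext j; fin_cases j <;> rfl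
  have e1 : (fun j : Fin 3 => ζ ((![a, b, c, d] : Fin 4 → N) ((1 : Fin 4).succAbove j)).1) =
      ![ζ a.1, ζ c.1, ζ d.1] := by funext j; fin_cases j <;> rfl
  have e2 : (fun j : Fin 3 => ζ ((![a, b, c, d] : Fin 4 → N) ((2 : Fin 4).succAbove j)).1) =
      ![ζ a.1, ζ b.1, ζ d.1] := by funext j; fin_cases j <;> rfl
  have e3 : (fun j : Fin 3 => ζ ((![a, b, c, d] : Fin 4 → N) ((3 : Fin 4).succAbove j)).1) =
      ![ζ a.1, ζ b.1, ζ c.1] := by funext j; fin_cases j <;> rfl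
  rw [e0, e1, e2, e3]
  simp
  ring

theorem IsModel.map_vec_zero (h : IsModel φ ζ K) (f : Fib) (b c : C3) :
    K f ![0, b, c] = 0 ∧ K f ![b, 0, c] = 0 ∧ K f ![b, c, 0] = 0 := by
  obtain ⟨τ, hτ⟩ := h.mem f
  rw [hτ]
  refine ⟨?_, ?_, ?_⟩ <;> simp [derUps_vec, upsilon0_vec]

theorem IsModel.apply_vertical (h : IsModel φ ζ K) (f : Fib) (b c d : N) :
    φ ![(0, f), b, c, d] = K f ![ζ b.1, ζ c.1, ζ d.1] := by
  rw [h.apply_vec]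
  simp [(h.map_vec_zero _ _ _).1]

/-- The forms `K f` have no components with two arguments of type `(0, 1)`. -/
theorem IsModel.type_rel (h : IsModel φ ζ K) (f : Fib) (x u v : C3) :
    K f ![x, u, v] + Complex.I * K f ![x, Complex.I • u, v] + Complex.I * K f ![x, u, Complex.I • v]
      - K f ![x, Complex.I • u, Complex.I • v] = 0 := by
  obtain ⟨τ, hτ⟩ := h.mem f
  rw [hτ]
  simp only [derUps_vec, upsilon0_vec, Pi.smul_apply, smul_eq_mul]
  ring_nf
  simp only [Complex.I_sq]
  ring

theorem IsModel.map_swap (h : IsModel φ ζ K) (f : Fib) (x u v : C3) :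
    K f ![u, x, v] = - K f ![x, u, v] := by
  obtain ⟨τ, hτ⟩ := h.mem f
  rw [hτ]
  simp only [derUps_vec, upsilon0_vec]
  ring

theorem IsModel.map_swap' (h : IsModel φ ζ K) (f : Fib) (x u v : C3) :
    K f ![x, v, u] = - K f ![x, u, v] := by
  obtain ⟨τ, hτ⟩ := h.mem f
  rw [hτ]
  simp only [derUps_vec, upsilon0_vec]
  ring

/-- The bivector u ∧ iu is of type (1,1). As `K f` has no component with two arguments of type
(0,1), it is complex linear in the third argument. -/
theorem IsModel.type_rel' (h : IsModel φ ζ K) (f : Fib) (u v : C3) :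
    K f ![u, Complex.I • u, v] + Complex.I * K f ![u, Complex.I • u, Complex.I • v] = 0 := by
  obtain ⟨τ, hτ⟩ := h.mem f
  rw [hτ]
  simp only [derUps_vec, upsilon0_vec, Pi.smul_apply, smul_eq_mul]
  ring_nf
  simp only [Complex.I_sq, Complex.I_pow_three]
  ring

/-- The space of the vectors `v` such that `φ (v, b, c, d) = 0` for all `b`, `c`, `d` in `P`. -/
def polarN {V : Type*} [AddCommGroup V] [Module ℝ V] [TopologicalSpace V]
    (φ : V [⋀^Fin 4]→L[ℝ] ℂ) (P : Submodule ℝ V) : Submodule ℝ V where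
  carrier := {v | ∀ b ∈ P, ∀ c ∈ P, ∀ d ∈ P, φ ![v, b, c, d] = 0}
  zero_mem' := fun b _ c _ d _ => φ.map_coord_zero 0 rfl
  add_mem' := by
    intro v w hv hw b hb c hc d hd
    have := φ.toAlternatingMap.toMultilinearMap.cons_add ![b, c, d] v w
    exact this.trans (by
      rw [show φ.toAlternatingMap.toMultilinearMap (Fin.cons v ![b, c, d]) = 0 from hv b hb c hc d hd,
        show φ.toAlternatingMap.toMultilinearMap (Fin.cons w ![b, c, d]) = 0 from hw b hb c hc d hd,
        add_zero])
  smul_mem' := by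
    intro t v hv b hb c hc d hd
    have := φ.toAlternatingMap.toMultilinearMap.cons_smul ![b, c, d] t v
    exact this.trans (by
      rw [show φ.toAlternatingMap.toMultilinearMap (Fin.cons v ![b, c, d]) = 0 from hv b hb c hc d hd,
        smul_zero])

/-- The vanishing of `φ` on a plane. -/
def VanishOn (φ : N [⋀^Fin 4]→L[ℝ] ℂ) (P : Submodule ℝ N) : Prop :=
  ∀ v : Fin 4 → N, (∀ i, v i ∈ P) → φ v = 0

/-- The linear functional `v ↦ φ (v, b, c, d)`. -/
def contr (φ : N [⋀^Fin 4]→L[ℝ] ℂ) (b c d : N) : N →ₗ[ℝ] ℂ where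
  toFun v := φ ![v, b, c, d]
  map_add' v w := φ.toAlternatingMap.toMultilinearMap.cons_add ![b, c, d] v w
  map_smul' t v := φ.toAlternatingMap.toMultilinearMap.cons_smul ![b, c, d] t v

@[simp] theorem contr_apply (φ : N [⋀^Fin 4]→L[ℝ] ℂ) (b c d v : N) :
    contr φ b c d v = φ ![v, b, c, d] := rfl

theorem mem_polarN_span_iff {p : ℕ} (e : Fin p → N) (v : N) :
    v ∈ polarN φ (Submodule.span ℝ (range e)) ↔
      ∀ i j k : Fin p, i < j → j < k → φ ![v, e i, e j, e k] = 0 := by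
  constructor
  · intro h i j k _ _
    exact h _ (Submodule.subset_span ⟨i, rfl⟩) _ (Submodule.subset_span ⟨j, rfl⟩) _
      (Submodule.subset_span ⟨k, rfl⟩)
  · intro h b hb c hc d hd
    have h1 := AlternatingMap.eq_zero_of_strictMono (φ.toAlternatingMap.curryLeft v) e
      (by
        intro s hs
        have h2 := h (s 0) (s 1) (s 2) (hs (by decide)) (hs (by decide))
        have h3 : e ∘ s = ![e (s 0), e (s 1), e (s 2)] := by
          funext i; fin_cases i <;> rfl
        rw [h3]
        exact h2) ![b, c, d] (by intro i; fin_cases i <;> assumption)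
    exact h1

theorem vanishOn_span_iff {p : ℕ} (e : Fin p → N) :
    VanishOn φ (Submodule.span ℝ (range e)) ↔
      ∀ s : Fin 4 → Fin p, StrictMono s → φ (e ∘ s) = 0 :=
  ⟨fun h s _ => h _ fun i => Submodule.subset_span ⟨s i, rfl⟩,
    fun h => AlternatingMap.eq_zero_of_strictMono φ.toAlternatingMap e h⟩

theorem finrank_N : Module.finrank ℝ N = 26 := by
  simp [Module.finrank_prod, Module.finrank_pi_fintype, Complex.finrank_real_complex]

theorem finrank_fin_complex (k : ℕ) : Module.finrank ℝ (Fin k → ℂ) = 2 * k := by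
  simp [Module.finrank_pi_fintype, Complex.finrank_real_complex, mul_comm]

theorem le_finrank_ker {k : ℕ} (L : N →ₗ[ℝ] (Fin k → ℂ)) :
    26 ≤ Module.finrank ℝ (LinearMap.ker L) + 2 * k := by
  have h1 := L.finrank_range_add_finrank_ker
  have h2 := Submodule.finrank_le (LinearMap.range L)
  rw [finrank_fin_complex] at h2
  rw [finrank_N] at h1
  omega

theorem finrank_ker_of_surjective {k : ℕ} (L : N →ₗ[ℝ] (Fin k → ℂ)) (hL : Function.Surjective L) :
    Module.finrank ℝ (LinearMap.ker L) + 2 * k = 26 := by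
  have h1 := L.finrank_range_add_finrank_ker
  rw [LinearMap.range_eq_top.2 hL, finrank_top, finrank_fin_complex, finrank_N] at h1
  omega

end Model

end SLBundle

namespace SLBundle

/-! ### Independence of the components of `K f` on adapted vectors. -/

section Surjectivity

theorem exists_clm_apply_eq {k : ℕ} {w : Fin k → C3} (hw : LinearIndependent ℝ w)
    (t : Fin k → C3) : ∃ τ : C3 →L[ℝ] C3, ∀ i, τ (w i) = t i := by
  obtain ⟨g, hg⟩ := LinearMap.exists_extend ((Module.Basis.span hw).constr ℝ t)
  refine ⟨LinearMap.toContinuousLinearMap g, fun i => ?_⟩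
  have h1 : w i = (Submodule.span ℝ (range w)).subtype (Module.Basis.span hw i) := by
    simp [Module.Basis.span_apply]
  have h2 := congrArg (fun L => L (Module.Basis.span hw i)) hg
  simp only [LinearMap.comp_apply, Module.Basis.constr_basis] at h2
  rw [← h2, LinearMap.coe_toContinuousLinearMap', ← h1]

/-- Two complex vectors whose exterior product with every vector vanishes are dependent. -/
theorem exists_smul_of_forall_upsilon0_eq_zero {a b : C3} (ha : a ≠ 0)
    (h : ∀ n, upsilon0 ![a, b, n] = 0) : ∃ c : ℂ, b = c • a := by
  have h0 := h (Pi.single 0 1)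
  have h1 := h (Pi.single 1 1)
  have h2 := h (Pi.single 2 1)
  simp [upsilon0_vec] at h0 h1 h2
  obtain ⟨j, hj⟩ := Function.ne_iff.1 ha
  refine ⟨b j / a j, ?_⟩
  have hj' : a j ≠ 0 := hj
  funext k
  rw [Pi.smul_apply, smul_eq_mul, div_mul_eq_mul_div, eq_div_iff hj']
  fin_cases j <;> fin_cases k <;> simp <;>
    first | ring1 | linear_combination h0 | linear_combination -h0 | linear_combination h1 |
      linear_combination -h1 | linear_combination h2 | linear_combination -h2

/-- Otherwise w₁ and w₂ would be complex multiples of w₀, and three real independent vectors would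
lie in a complex line, which has real dimension two. -/
theorem exists_upsilon0_ne_zero {w : Fin 3 → C3} (hw : LinearIndependent ℝ w) :
    ∃ (i : Fin 3) (n : C3), upsilon0 (Function.update w i n) ≠ 0 := by
  by_contra hcon
  push Not at hcon
  have h2 : ∀ n, upsilon0 ![w 0, w 1, n] = 0 := fun n => by
    have e : ![w 0, w 1, n] = Function.update w 2 n := by
      funext i; fin_cases i <;> simp
    rw [e]; exact hcon 2 n
  have h1 : ∀ n, upsilon0 ![w 0, w 2, n] = 0 := fun n => by
    have e : ![w 0, n, w 2] = Function.update w 1 n := by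
      funext i; fin_cases i <;> simp
    have h := hcon 1 n
    rw [← e] at h
    rw [upsilon0_vec] at h ⊢
    linear_combination -h
  have h0 : w 0 ≠ 0 := hw.ne_zero 0
  obtain ⟨a, ha⟩ := exists_smul_of_forall_upsilon0_eq_zero h0 h2
  obtain ⟨b, hb⟩ := exists_smul_of_forall_upsilon0_eq_zero h0 h1
  let g : ℂ →ₗ[ℝ] C3 := (LinearMap.toSpanSingleton ℂ C3 (w 0)).restrictScalars ℝ
  have hg : w = g ∘ ![1, a, b] := by
    funext i
    fin_cases i
    · simp [g]
    · simpa [g] using ha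
    · simpa [g] using hb
  rw [hg] at hw
  have h3 := hw.of_comp.fintype_card_le_finrank
  rw [Complex.finrank_real_complex, Fintype.card_fin] at h3
  omega

/-- Adapted coordinates: an endomorphism with given values on a complex basis and its multiples
by `i`. -/
theorem exists_clm_apply_eq_of_upsilon0_ne_zero {w₁ w₂ w₃ : C3} (hw : upsilon0 ![w₁, w₂, w₃] ≠ 0)
    (t₁ s₁ t₂ s₂ t₃ s₃ : C3) : ∃ τ : C3 →L[ℝ] C3,
      τ w₁ = t₁ ∧ τ (Complex.I • w₁) = s₁ ∧ τ w₂ = t₂ ∧ τ (Complex.I • w₂) = s₂ ∧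
      τ w₃ = t₃ ∧ τ (Complex.I • w₃) = s₃ := by
  set D := upsilon0 ![w₁, w₂, w₃] with hD
  let z₁ : C3 →ₗ[ℝ] ℂ := IsLinearMap.mk' (fun u => upsilon0 ![u, w₂, w₃] / D)
    ⟨fun u v => by simp only [upsilon0_vec, Pi.add_apply]; ring,
      fun c u => by simp only [upsilon0_vec, Pi.smul_apply, Complex.real_smul]; ring⟩
  let z₂ : C3 →ₗ[ℝ] ℂ := IsLinearMap.mk' (fun u => upsilon0 ![w₁, u, w₃] / D)
    ⟨fun u v => by simp only [upsilon0_vec, Pi.add_apply]; ring,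
      fun c u => by simp only [upsilon0_vec, Pi.smul_apply, Complex.real_smul]; ring⟩
  let z₃ : C3 →ₗ[ℝ] ℂ := IsLinearMap.mk' (fun u => upsilon0 ![w₁, w₂, u] / D)
    ⟨fun u v => by simp only [upsilon0_vec, Pi.add_apply]; ring,
      fun c u => by simp only [upsilon0_vec, Pi.smul_apply, Complex.real_smul]; ring⟩
  let T : C3 → C3 → (ℂ →ₗ[ℝ] C3) := fun t s =>
    Complex.reLm.smulRight t + Complex.imLm.smulRight s
  have e11 : z₁ w₁ = 1 := div_self hw
  have e22 : z₂ w₂ = 1 := div_self hw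
  have e33 : z₃ w₃ = 1 := div_self hw
  have e12 : z₁ w₂ = 0 := by
    change upsilon0 _ / D = 0
    rw [div_eq_zero_iff]; left; rw [upsilon0_vec]; ring
  have e13 : z₁ w₃ = 0 := by
    change upsilon0 _ / D = 0
    rw [div_eq_zero_iff]; left; rw [upsilon0_vec]; ring
  have e21 : z₂ w₁ = 0 := by
    change upsilon0 _ / D = 0
    rw [div_eq_zero_iff]; left; rw [upsilon0_vec]; ring
  have e23 : z₂ w₃ = 0 := by
    change upsilon0 _ / D = 0
    rw [div_eq_zero_iff]; left; rw [upsilon0_vec]; ring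
  have e31 : z₃ w₁ = 0 := by
    change upsilon0 _ / D = 0
    rw [div_eq_zero_iff]; left; rw [upsilon0_vec]; ring
  have e32 : z₃ w₂ = 0 := by
    change upsilon0 _ / D = 0
    rw [div_eq_zero_iff]; left; rw [upsilon0_vec]; ring
  have i1 : ∀ u, z₁ (Complex.I • u) = Complex.I * z₁ u := fun u => by
    change upsilon0 _ / D = _ * (upsilon0 _ / D)
    simp only [upsilon0_vec, Pi.smul_apply, smul_eq_mul]; ring
  have i2 : ∀ u, z₂ (Complex.I • u) = Complex.I * z₂ u := fun u => by
    change upsilon0 _ / D = _ * (upsilon0 _ / D)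
    simp only [upsilon0_vec, Pi.smul_apply, smul_eq_mul]; ring
  have i3 : ∀ u, z₃ (Complex.I • u) = Complex.I * z₃ u := fun u => by
    change upsilon0 _ / D = _ * (upsilon0 _ / D)
    simp only [upsilon0_vec, Pi.smul_apply, smul_eq_mul]; ring
  refine ⟨LinearMap.toContinuousLinearMap
    (T t₁ s₁ ∘ₗ z₁ + T t₂ s₂ ∘ₗ z₂ + T t₃ s₃ ∘ₗ z₃), ?_, ?_, ?_, ?_, ?_, ?_⟩ <;>
  simp [T, i1, i2, i3, e11, e12, e13, e21, e22, e23, e31, e32, e33]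

variable {φ : N [⋀^Fin 4]→L[ℝ] ℂ} {ζ : E6 ≃L[ℝ] C3} {K : Fib →ₗ[ℝ] ((Fin 3 → C3) → ℂ)}

/-- The forms `K f` take all the values on a triple of independent vectors. -/
theorem IsModel.exists_apply_eq (h : IsModel φ ζ K) {w : Fin 3 → C3} (hw : LinearIndependent ℝ w)
    (c : ℂ) : ∃ f, K f w = c := by
  obtain ⟨i, n, hn⟩ := exists_upsilon0_ne_zero hw
  -- The endomorphism kills the vectors other than `w i`, so a single term of the derivation
  -- survives; the factor normalizes it to `c`.
  obtain ⟨τ, hτ⟩ := exists_clm_apply_eq hw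
    (Function.update 0 i ((c / upsilon0 (Function.update w i n)) • n))
  obtain ⟨f, hf⟩ := h.surj τ
  refine ⟨f, ?_⟩
  rw [hf, derUps_apply, Finset.sum_eq_single i]
  · rw [hτ, Function.update_self]
    obtain ⟨c', hc'⟩ : ∃ c', c / upsilon0 (Function.update w i n) = c' := ⟨_, rfl⟩
    have hs : upsilon0 (Function.update w i (c' • n)) = c' * upsilon0 (Function.update w i n) :=
      (Matrix.detRowAlternating (R := ℂ) (n := Fin 3)).map_update_smul w i c' n
    rw [hc', hs, ← hc', div_mul_cancel₀ c hn]
  · intro j _ hj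
    rw [hτ, Function.update_of_ne hj]
    exact upsilon0.map_coord_zero j (by simp)
  · simp

/-- Surjectivity onto the components with respect to an adapted basis of a hyperplane. -/
theorem IsModel.exists_apply_eq_five (h : IsModel φ ζ K) {w₁ w₂ w₃ : C3}
    (hw : upsilon0 ![w₁, w₂, w₃] ≠ 0) (c₁ c₂ c₃ c₄ c₅ c₆ c₇ : ℂ) : ∃ f,
      K f ![w₁, w₂, Complex.I • w₂] = c₁ ∧ K f ![w₁, w₂, w₃] = c₂ ∧
      K f ![w₁, Complex.I • w₂, w₃] = c₃ ∧ K f ![w₁, w₂, Complex.I • w₃] = c₄ ∧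
      K f ![w₁, w₃, Complex.I • w₃] = c₅ ∧ K f ![w₂, Complex.I • w₂, w₃] = c₆ ∧
      K f ![w₂, w₃, Complex.I • w₃] = c₇ := by
  obtain ⟨D, hD⟩ : ∃ D, upsilon0 ![w₁, w₂, w₃] = D := ⟨_, rfl⟩
  rw [hD] at hw
  -- Each coefficient of a value of τ is read off by one determinant. The value c₂/D of τ on w₁ also
  -- adds i c₂ to the components (w₁, iw₂, w₃) and (w₁, w₂, iw₃), whence the corrections -i c₂. The
  -- vector iw₁ occurs in no component, so its image is arbitrary.
  obtain ⟨τ, h1, -, h2, h3, h4, h5⟩ := exists_clm_apply_eq_of_upsilon0_ne_zero (hD ▸ hw)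
    ((c₂ / D) • w₁) 0 0
    ((-c₆ / D) • w₁ + ((c₃ - Complex.I * c₂) / D) • w₂ + (c₁ / D) • w₃)
    0 ((c₇ / D) • w₁ + (-c₅ / D) • w₂ + ((c₄ - Complex.I * c₂) / D) • w₃)
  obtain ⟨f, hf⟩ := h.surj τ
  rw [upsilon0_vec] at hD
  refine ⟨f, ?_⟩
  simp only [hf, derUps_vec, h1, h2, h3, h4, h5]
  simp only [upsilon0_vec, Pi.smul_apply, Pi.add_apply, smul_eq_mul, Pi.zero_apply]
  have hDi : D * D⁻¹ = 1 := mul_inv_cancel₀ hw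
  simp only [div_eq_mul_inv]
  refine ⟨?_, ?_, ?_, ?_, ?_, ?_, ?_⟩
  · linear_combination c₁ * D⁻¹ * hD + c₁ * hDi
  · linear_combination c₂ * D⁻¹ * hD + c₂ * hDi
  · linear_combination c₃ * D⁻¹ * hD + c₃ * hDi
  · linear_combination c₄ * D⁻¹ * hD + c₄ * hDi
  · linear_combination c₅ * D⁻¹ * hD + c₅ * hDi
  · linear_combination c₆ * D⁻¹ * hD + c₆ * hDi
  · linear_combination c₇ * D⁻¹ * hD + c₇ * hDi

/-- Surjectivity onto the components with respect to an adapted basis of a four-dimensional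
subspace that is not complex. -/
theorem IsModel.exists_apply_eq_four (h : IsModel φ ζ K) {w₁ w₂ w₃ : C3}
    (hw : upsilon0 ![w₁, w₂, w₃] ≠ 0) (c₁ c₂ c₃ c₄ : ℂ) : ∃ f,
      K f ![w₁, Complex.I • w₁, w₂] = c₁ ∧ K f ![w₁, Complex.I • w₁, w₃] = c₂ ∧
      K f ![w₁, w₂, w₃] = c₃ ∧ K f ![Complex.I • w₁, w₂, w₃] = c₄ := by
  obtain ⟨D, hD⟩ : ∃ D, upsilon0 ![w₁, w₂, w₃] = D := ⟨_, rfl⟩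
  rw [hD] at hw
  obtain ⟨τ, h1, h2, h3, -, h4, -⟩ := exists_clm_apply_eq_of_upsilon0_ne_zero (hD ▸ hw)
    ((c₃ / D) • w₁) ((c₄ / D) • w₁ + (c₂ / D) • w₂ + (-c₁ / D) • w₃) 0 0 0 0
  obtain ⟨f, hf⟩ := h.surj τ
  rw [upsilon0_vec] at hD
  refine ⟨f, ?_⟩
  simp only [hf, derUps_vec, h1, h2, h3, h4]
  simp only [upsilon0_vec, Pi.smul_apply, Pi.add_apply, smul_eq_mul, Pi.zero_apply]
  have hDi : D * D⁻¹ = 1 := mul_inv_cancel₀ hw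
  simp only [div_eq_mul_inv]
  refine ⟨?_, ?_, ?_, ?_⟩
  · linear_combination c₁ * D⁻¹ * hD + c₁ * hDi
  · linear_combination c₂ * D⁻¹ * hD + c₂ * hDi
  · linear_combination c₃ * D⁻¹ * hD + c₃ * hDi
  · linear_combination c₄ * D⁻¹ * hD + c₄ * hDi

end Surjectivity

end SLBundle

namespace SLBundle

/-! ### Polar equations in dimensions three and four, and the type relations in dimension five. -/

section PolarDimensions

variable {φ : N [⋀^Fin 4]→L[ℝ] ℂ} {ζ : E6 ≃L[ℝ] C3} {K : Fib →ₗ[ℝ] ((Fin 3 → C3) → ℂ)}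

theorem polarN_eq_top {p : ℕ} (hp : p ≤ 2) (e : Fin p → N) :
    polarN φ (Submodule.span ℝ (range e)) = ⊤ := by
  rw [eq_top_iff]
  rintro v -
  rw [mem_polarN_span_iff]
  intro i j k hij hjk
  omega

theorem polarN_three (e : Fin 3 → N) :
    polarN φ (Submodule.span ℝ (range e)) =
      LinearMap.ker (LinearMap.pi ![contr φ (e 0) (e 1) (e 2)]) := by
  ext v
  rw [mem_polarN_span_iff, LinearMap.mem_ker]
  constructor
  · intro h
    funext i
    fin_cases i
    exact h 0 1 2 (by decide) (by decide)
  · intro h i j k hij hjk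
    have h0 := congrFun h 0
    have hi : i = 0 := by omega
    have hj : j = 1 := by omega
    have hk : k = 2 := by omega
    subst hi hj hk
    exact h0

theorem IsModel.finrank_polarN_three (h : IsModel φ ζ K) (e : Fin 3 → N)
    (he : LinearIndependent ℝ fun i => (e i).1) :
    Module.finrank ℝ (polarN φ (Submodule.span ℝ (range e))) = 24 := by
  rw [polarN_three]
  have := finrank_ker_of_surjective (LinearMap.pi ![contr φ (e 0) (e 1) (e 2)]) (by
    intro c
    obtain ⟨f, hf⟩ := h.exists_apply_eq (w := fun i => ζ (e i).1)
      (he.map' ζ.toLinearEquiv.toLinearMap ζ.toLinearEquiv.ker) (c 0)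
    refine ⟨(0, f), ?_⟩
    funext i
    fin_cases i
    refine (h.apply_vertical f (e 0) (e 1) (e 2)).trans ?_
    rw [← vec_eta (fun i => ζ (e i).1), hf]
    rfl)
  omega

/-- The four contractions that define the polar space of a four-dimensional plane. -/
def contrFour (φ : N [⋀^Fin 4]→L[ℝ] ℂ) (e : Fin 4 → N) : N →ₗ[ℝ] (Fin 4 → ℂ) :=
  LinearMap.pi ![contr φ (e 0) (e 1) (e 2), contr φ (e 0) (e 1) (e 3), contr φ (e 0) (e 2) (e 3),
    contr φ (e 1) (e 2) (e 3)]

theorem polarN_four (e : Fin 4 → N) :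
    polarN φ (Submodule.span ℝ (range e)) = LinearMap.ker (contrFour φ e) := by
  ext v
  rw [mem_polarN_span_iff, LinearMap.mem_ker]
  constructor
  · intro h
    funext i
    fin_cases i
    · exact h 0 1 2 (by decide) (by decide)
    · exact h 0 1 3 (by decide) (by decide)
    · exact h 0 2 3 (by decide) (by decide)
    · exact h 1 2 3 (by decide) (by decide)
  · intro h i j k hij hjk
    have h0 := congrFun h 0
    have h1 := congrFun h 1
    have h2 := congrFun h 2
    have h3 := congrFun h 3
    fin_cases i <;> fin_cases j <;> fin_cases k <;> first
      | exact h0 | exact h1 | exact h2 | exact h3 | (exfalso; revert hij hjk; decide)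

theorem le_finrank_polarN_four (e : Fin 4 → N) :
    18 ≤ Module.finrank ℝ (polarN φ (Submodule.span ℝ (range e))) := by
  rw [polarN_four]
  have := le_finrank_ker (contrFour φ e)
  omega

theorem IsModel.finrank_polarN_four_of_basis (h : IsModel φ ζ K) (e : Fin 4 → N) {w₁ w₂ w₃ : C3}
    (hw : upsilon0 ![w₁, w₂, w₃] ≠ 0) (h0 : ζ (e 0).1 = w₁) (h1 : ζ (e 1).1 = Complex.I • w₁)
    (h2 : ζ (e 2).1 = w₂) (h3 : ζ (e 3).1 = w₃) :
    Module.finrank ℝ (polarN φ (Submodule.span ℝ (range e))) = 18 := by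
  rw [polarN_four]
  have := finrank_ker_of_surjective (contrFour φ e) (by
    intro c
    obtain ⟨f, hf0, hf1, hf2, hf3⟩ := h.exists_apply_eq_four hw (c 0) (c 1) (c 2) (c 3)
    refine ⟨(0, f), ?_⟩
    funext i
    fin_cases i
    · exact (h.apply_vertical f _ _ _).trans (by rw [h0, h1, h2, hf0]; rfl)
    · exact (h.apply_vertical f _ _ _).trans (by rw [h0, h1, h3, hf1]; rfl)
    · exact (h.apply_vertical f _ _ _).trans (by rw [h0, h2, h3, hf2]; rfl)
    · exact (h.apply_vertical f _ _ _).trans (by rw [h1, h2, h3, hf3]; rfl))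
  omega

theorem IsModel.type_rel_swap (h : IsModel φ ζ K) (f : Fib) (u v : C3) :
    K f ![Complex.I • u, u, v] + Complex.I * K f ![Complex.I • u, u, Complex.I • v] = 0 := by
  rw [h.map_swap, h.map_swap f u]
  linear_combination -h.type_rel' f u v

theorem IsModel.map_rotate (h : IsModel φ ζ K) (f : Fib) (a b c : C3) :
    K f ![a, b, c] = K f ![c, a, b] := by
  rw [h.map_swap f a c b, h.map_swap' f a c b]

theorem IsModel.type_rel_rotate (h : IsModel φ ζ K) (f : Fib) (v u : C3) :
    K f ![v, u, Complex.I • u] + Complex.I * K f ![Complex.I • v, u, Complex.I • u] = 0 := by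
  rw [← h.map_rotate, ← h.map_rotate f _ _ (Complex.I • v)]
  exact h.type_rel' f u v

theorem IsModel.type_rel_fst_snd (h : IsModel φ ζ K) (f : Fib) (u v x : C3) :
    K f ![u, v, x] + Complex.I * K f ![Complex.I • u, v, x] + Complex.I * K f ![u, Complex.I • v, x]
      - K f ![Complex.I • u, Complex.I • v, x] = 0 := by
  rw [h.map_rotate, h.map_rotate f (Complex.I • u), h.map_rotate f u,
    h.map_rotate f (Complex.I • u)]
  linear_combination h.type_rel f x u v

theorem IsModel.type_rel_fst_trd (h : IsModel φ ζ K) (f : Fib) (u x v : C3) :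
    K f ![u, x, v] + Complex.I * K f ![Complex.I • u, x, v] + Complex.I * K f ![u, x, Complex.I • v]
      - K f ![Complex.I • u, x, Complex.I • v] = 0 := by
  rw [h.map_swap, h.map_swap f x (Complex.I • u), h.map_swap f x u, h.map_swap f x]
  linear_combination -h.type_rel f x u v

/-- These are the type relations of Λ^{3,0} ⊕ Λ^{2,1}, transferred from the 3-forms `K f` to the
contractions of φ by an arbitrary vector. By linearity three cases suffice. For vertical vectors
they are the type relations themselves; for vectors of `P` both sides vanish; for the remaining
direction iw₁ they follow from the type relations of the fibre components of the basis and from the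
vanishing of φ on `P`. -/
theorem IsModel.rel_of_vanishOn (h : IsModel φ ζ K) {e₁ e₂ e₂' e₃ e₃' : N} {w₁ w₂ w₃ : C3}
    (h1 : ζ e₁.1 = w₁) (h2 : ζ e₂.1 = w₂) (h2' : ζ e₂'.1 = Complex.I • w₂)
    (h3 : ζ e₃.1 = w₃) (h3' : ζ e₃'.1 = Complex.I • w₃)
    {P : Submodule ℝ N} (hP : VanishOn φ P)
    (m1 : e₁ ∈ P) (m2 : e₂ ∈ P) (m2' : e₂' ∈ P) (m3 : e₃ ∈ P) (m3' : e₃' ∈ P)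
    (hspan : ∀ v : N, ∃ (u : N) (t : ℝ) (f : Fib), u ∈ P ∧
      v = u + t • (ζ.symm (Complex.I • w₁), 0) + (0, f)) (v : N) :
    φ ![v, e₁, e₂', e₃'] = φ ![v, e₁, e₂, e₃] + Complex.I * φ ![v, e₁, e₂', e₃] +
      Complex.I * φ ![v, e₁, e₂, e₃'] ∧
    φ ![v, e₂, e₂', e₃'] = Complex.I * φ ![v, e₂, e₂', e₃] ∧
    φ ![v, e₂', e₃, e₃'] = Complex.I * φ ![v, e₂, e₃, e₃'] := by
  have hv : ∀ a b c d, a ∈ P → b ∈ P → c ∈ P → d ∈ P → φ ![a, b, c, d] = 0 := by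
    intro a b c d ha hb hc hd
    refine hP _ fun i => ?_
    fin_cases i <;> assumption
  obtain ⟨u, t, f, hu, rfl⟩ := hspan v
  simp only [← contr_apply φ, map_add, map_smul]
  simp only [contr_apply]
  have hK : ∀ a b c d, a ∈ P → b ∈ P → c ∈ P → d ∈ P → _ := fun a b c d ha hb hc hd =>
    (h.apply_vec a b c d).symm.trans (hv a b c d ha hb hc hd)
  refine ⟨?_, ?_, ?_⟩
  · rw [hv u e₁ e₂' e₃' hu m1 m2' m3', hv u e₁ e₂ e₃ hu m1 m2 m3, hv u e₁ e₂' e₃ hu m1 m2' m3,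
      hv u e₁ e₂ e₃' hu m1 m2 m3', h.apply_vertical, h.apply_vertical, h.apply_vertical,
      h.apply_vertical, h.apply_vec, h.apply_vec, h.apply_vec, h.apply_vec]
    have k0 := h.type_rel f w₁ w₂ w₃
    have k1 := h.type_rel e₁.2 (Complex.I • w₁) w₂ w₃
    have k2 := h.type_rel_swap e₂.2 w₁ w₃
    have k2' := h.type_rel_swap e₂'.2 w₁ w₃
    have k3 := h.type_rel_swap e₃.2 w₁ w₂
    have k3' := h.type_rel_swap e₃'.2 w₁ w₂
    simp only [h1, h2, h2', h3, h3', ContinuousLinearEquiv.apply_symm_apply, map_zero,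
      Pi.zero_apply, zero_add, zero_sub, Complex.real_smul]
    generalize Complex.I • w₁ = x₁ at k0 k1 k2 k2' k3 k3' ⊢
    generalize Complex.I • w₂ = x₂ at k0 k1 k2 k2' k3 k3' ⊢
    generalize Complex.I • w₃ = x₃ at k0 k1 k2 k2' k3 k3' ⊢
    linear_combination (norm := (ring_nf; simp only [Complex.I_sq]; ring1))
      -k0 + t * (k1 - k2 - Complex.I * k2' + k3 + Complex.I * k3')
  · rw [hv u e₂ e₂' e₃' hu m2 m2' m3', hv u e₂ e₂' e₃ hu m2 m2' m3,
      h.apply_vertical, h.apply_vertical, h.apply_vec, h.apply_vec]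
    -- For v in the direction iw₁ the type relations trade iw₁ for w₁. What results is eliminated by
    -- `r1` and `r2`, the integrality of `P` on quadruples that contain `e₁`.
    have r1 := hK e₁ e₂ e₂' e₃' m1 m2 m2' m3'
    have r2 := hK e₁ e₂ e₂' e₃ m1 m2 m2' m3
    have k0 := h.type_rel' f w₂ w₃
    have k1 := h.type_rel' e₁.2 w₂ w₃
    have k2 := h.type_rel_fst_trd e₂.2 w₁ (Complex.I • w₂) w₃
    have k2' := h.type_rel_fst_trd e₂'.2 w₁ w₂ w₃
    have k3 := h.type_rel_rotate e₃.2 w₁ w₂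
    have k3' := h.type_rel_rotate e₃'.2 w₁ w₂
    simp only [h1, h2, h2', h3, h3', ContinuousLinearEquiv.apply_symm_apply, map_zero,
      Pi.zero_apply, zero_add, zero_sub, Complex.real_smul] at r1 r2 ⊢
    generalize Complex.I • w₁ = x₁ at k0 k1 k2 k2' k3 k3' r1 r2 ⊢
    generalize Complex.I • w₂ = x₂ at k0 k1 k2 k2' k3 k3' r1 r2 ⊢
    generalize Complex.I • w₃ = x₃ at k0 k1 k2 k2' k3 k3' r1 r2 ⊢
    linear_combination (norm := (ring_nf; simp only [Complex.I_sq, Complex.I_pow_three]; ring1))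
      -Complex.I * k0 + t * Complex.I * (r1 - Complex.I * r2) - t * Complex.I *
        (-Complex.I * k1 + Complex.I * k2 - Complex.I * k2' - k3' + Complex.I * k3)
  · rw [hv u e₂' e₃ e₃' hu m2' m3 m3', hv u e₂ e₃ e₃' hu m2 m3 m3',
      h.apply_vertical, h.apply_vertical, h.apply_vec, h.apply_vec]
    have r1 := hK e₁ e₂' e₃ e₃' m1 m2' m3 m3'
    have r2 := hK e₁ e₂ e₃ e₃' m1 m2 m3 m3'
    have k0 := h.type_rel_rotate f w₂ w₃
    have k1 := h.type_rel_rotate e₁.2 w₂ w₃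
    have k2 := h.type_rel_rotate e₂.2 w₁ w₃
    have k2' := h.type_rel_rotate e₂'.2 w₁ w₃
    have k3 := h.type_rel_fst_snd e₃.2 w₁ w₂ (Complex.I • w₃)
    have k3' := h.type_rel_fst_snd e₃'.2 w₁ w₂ w₃
    simp only [h1, h2, h2', h3, h3', ContinuousLinearEquiv.apply_symm_apply, map_zero,
      Pi.zero_apply, zero_add, zero_sub, Complex.real_smul] at r1 r2 ⊢
    generalize Complex.I • w₁ = x₁ at k0 k1 k2 k2' k3 k3' r1 r2 ⊢
    generalize Complex.I • w₂ = x₂ at k0 k1 k2 k2' k3 k3' r1 r2 ⊢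
    generalize Complex.I • w₃ = x₃ at k0 k1 k2 k2' k3 k3' r1 r2 ⊢
    linear_combination (norm := (ring_nf; simp only [Complex.I_sq, Complex.I_pow_three]; ring1))
      -Complex.I * k0 + t * Complex.I * (r1 - Complex.I * r2) - t * Complex.I *
        (-Complex.I * k1 - k2' + Complex.I * k2 - Complex.I * k3 + Complex.I * k3')

end PolarDimensions

end SLBundle

namespace SLBundle

/-! ### Real subspaces of ℂ³ in terms of complex bases. -/

section AdaptedBases

theorem complex_smul_eq (z : ℂ) (w : C3) : z • w = z.re • w + z.im • (Complex.I • w) := by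
  funext j
  simp only [Pi.smul_apply, Pi.add_apply, smul_eq_mul, Complex.real_smul]
  conv_lhs => rw [← Complex.re_add_im z]
  ring

theorem exists_decomposition {w₁ w₂ w₃ : C3} (hw : upsilon0 ![w₁, w₂, w₃] ≠ 0) (x : C3) :
    ∃ z₁ z₂ z₃ : ℂ, x = z₁ • w₁ + z₂ • w₂ + z₃ • w₃ := by
  refine ⟨upsilon0 ![x, w₂, w₃] / upsilon0 ![w₁, w₂, w₃],
    upsilon0 ![w₁, x, w₃] / upsilon0 ![w₁, w₂, w₃],
    upsilon0 ![w₁, w₂, x] / upsilon0 ![w₁, w₂, w₃], ?_⟩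
  funext j
  simp only [Pi.smul_apply, Pi.add_apply, smul_eq_mul]
  rw [div_mul_eq_mul_div, div_mul_eq_mul_div, div_mul_eq_mul_div, ← add_div, ← add_div,
    eq_div_iff hw]
  simp only [upsilon0_vec]
  fin_cases j <;> simp <;> ring

theorem exists_real_decomposition {w₁ w₂ w₃ : C3} (hw : upsilon0 ![w₁, w₂, w₃] ≠ 0) (x : C3) :
    ∃ a₁ b₁ a₂ b₂ a₃ b₃ : ℝ, x = a₁ • w₁ + b₁ • (Complex.I • w₁) + a₂ • w₂ +
      b₂ • (Complex.I • w₂) + a₃ • w₃ + b₃ • (Complex.I • w₃) := by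
  obtain ⟨z₁, z₂, z₃, h⟩ := exists_decomposition hw x
  refine ⟨z₁.re, z₁.im, z₂.re, z₂.im, z₃.re, z₃.im, ?_⟩
  rw [h, complex_smul_eq z₁, complex_smul_eq z₂, complex_smul_eq z₃]
  abel

theorem finrank_C3 : Module.finrank ℝ C3 = 6 := by
  simp [Module.finrank_pi_fintype, Complex.finrank_real_complex]

theorem linearIndependent_real_basis {w₁ w₂ w₃ : C3} (hw : upsilon0 ![w₁, w₂, w₃] ≠ 0) :
    LinearIndependent ℝ ![w₁, Complex.I • w₁, w₂, Complex.I • w₂, w₃, Complex.I • w₃] := by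
  refine linearIndependent_of_top_le_span_of_card_eq_finrank ?_ (by simp [finrank_C3])
  rintro x -
  obtain ⟨a₁, b₁, a₂, b₂, a₃, b₃, rfl⟩ := exists_real_decomposition hw x
  rw [Submodule.mem_span_range_iff_exists_fun]
  refine ⟨![a₁, b₁, a₂, b₂, a₃, b₃], ?_⟩
  simp [Fin.sum_univ_six]

theorem exists_mem_notMem_of_finrank_lt {V : Type*} [AddCommGroup V] [Module ℝ V]
    [FiniteDimensional ℝ V] {S T : Submodule ℝ V}
    (h : Module.finrank ℝ S < Module.finrank ℝ T) : ∃ x ∈ T, x ∉ S := by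
  by_contra hcon
  push Not at hcon
  exact absurd (Submodule.finrank_mono (show T ≤ S from hcon)) (not_le.2 h)

theorem finrank_span_range_le {V : Type*} [AddCommGroup V] [Module ℝ V] {k : ℕ} (b : Fin k → V) :
    Module.finrank ℝ (Submodule.span ℝ (range b)) ≤ k := by
  have h := finrank_range_le_card (R := ℝ) b
  rwa [Fintype.card_fin] at h

theorem exists_relation_of_upsilon0_eq_zero {w₁ w₂ w₃ : C3} (hw : upsilon0 ![w₁, w₂, w₃] = 0) :
    ∃ c₁ c₂ c₃ : ℂ, (c₁ ≠ 0 ∨ c₂ ≠ 0 ∨ c₃ ≠ 0) ∧ c₁ • w₁ + c₂ • w₂ + c₃ • w₃ = 0 := by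
  rw [upsilon0_apply] at hw
  obtain ⟨c, hc, h⟩ := Matrix.exists_vecMul_eq_zero_iff.2 hw
  refine ⟨c 0, c 1, c 2, ?_, ?_⟩
  · by_contra hcon
    push Not at hcon
    apply hc
    funext i
    fin_cases i
    exacts [hcon.1, hcon.2.1, hcon.2.2]
  · funext j
    have := congrFun h j
    simpa [Matrix.vecMul, dotProduct, Fin.sum_univ_three] using this

/-- The maximal complex subspace of a real subspace of `ℂ³` has at most twice its codimension. -/
theorem exists_complex_part (W : Submodule ℝ C3) : ∃ W' : Submodule ℝ C3,
    2 * Module.finrank ℝ W ≤ Module.finrank ℝ W' + 6 ∧ ∀ x ∈ W', x ∈ W ∧ Complex.I • x ∈ W := by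
  let Jm : C3 →ₗ[ℝ] C3 := (LinearMap.lsmul ℂ C3 Complex.I).restrictScalars ℝ
  have hJ : Function.Injective Jm := fun x y hxy => by
    have h2 : Complex.I • x = Complex.I • y := hxy
    exact smul_right_injective C3 Complex.I_ne_zero h2
  refine ⟨W ⊓ W.map Jm, ?_, ?_⟩
  · have h1 := Submodule.finrank_sup_add_finrank_inf_eq W (W.map Jm)
    have h2 : Module.finrank ℝ (W.map Jm) = Module.finrank ℝ W :=
      LinearEquiv.finrank_eq (Submodule.equivMapOfInjective Jm hJ W).symm
    have h3 := Submodule.finrank_le (W ⊔ W.map Jm)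
    rw [finrank_C3] at h3
    omega
  · rintro x ⟨hx, y, hy, rfl⟩
    refine ⟨hx, ?_⟩
    have e : Complex.I • Jm y = -y := by
      change Complex.I • Complex.I • y = -y
      rw [smul_smul, Complex.I_mul_I, neg_one_smul]
    rw [e]
    exact W.neg_mem hy

theorem smul_mem_span_pair (z : ℂ) {w : C3} {S : Submodule ℝ C3} (h : w ∈ S)
    (h' : Complex.I • w ∈ S) : z • w ∈ S := by
  rw [complex_smul_eq]
  exact S.add_mem (S.smul_mem _ h) (S.smul_mem _ h')

theorem eq_smul_add_smul {a b c : ℂ} (hc : c ≠ 0) {u v w : C3}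
    (h : c • w = -(a • u) + -(b • v)) : w = (-(c⁻¹ * a)) • u + (-(c⁻¹ * b)) • v := by
  have h2 : c⁻¹ • (c • w) = w := by rw [smul_smul, inv_mul_cancel₀ hc, one_smul]
  rw [← h2, h]
  module

/-- W ∩ iW has real dimension at least 4, hence contains two vectors w₂, w₃ independent over ℂ.
Their complex span has real dimension four, so some w₁ in W lies outside it. -/
theorem exists_adapted_five {W : Submodule ℝ C3} (hW : Module.finrank ℝ W = 5) :
    ∃ w₁ w₂ w₃ : C3, upsilon0 ![w₁, w₂, w₃] ≠ 0 ∧ w₁ ∈ W ∧ w₂ ∈ W ∧ Complex.I • w₂ ∈ W ∧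
      w₃ ∈ W ∧ Complex.I • w₃ ∈ W := by
  obtain ⟨W', hW', hmem⟩ := exists_complex_part W
  obtain ⟨w₂, h2, h2'⟩ := exists_mem_notMem_of_finrank_lt (S := (⊥ : Submodule ℝ C3)) (T := W')
    (by rw [finrank_bot]; omega)
  obtain ⟨w₃, h3, h3'⟩ := exists_mem_notMem_of_finrank_lt
    (S := Submodule.span ℝ (range ![w₂, Complex.I • w₂])) (T := W')
    (lt_of_le_of_lt (finrank_span_range_le _) (by omega))
  obtain ⟨w₁, h1, h1'⟩ := exists_mem_notMem_of_finrank_lt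
    (S := Submodule.span ℝ (range ![w₂, Complex.I • w₂, w₃, Complex.I • w₃])) (T := W)
    (lt_of_le_of_lt (finrank_span_range_le _) (by omega))
  refine ⟨w₁, w₂, w₃, fun h0 => ?_, h1, (hmem _ h2).1, (hmem _ h2).2, (hmem _ h3).1, (hmem _ h3).2⟩
  obtain ⟨c₁, c₂, c₃, hc, hrel⟩ := exists_relation_of_upsilon0_eq_zero h0
  have hw2 : w₂ ≠ 0 := fun h => h2' (by rw [h]; exact Submodule.zero_mem _)
  by_cases hc1 : c₁ = 0
  · by_cases hc3 : c₃ = 0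
    · have hc2 : c₂ ≠ 0 := by tauto
      rw [hc1, hc3, zero_smul, zero_smul, zero_add, add_zero] at hrel
      exact (smul_ne_zero hc2 hw2) hrel
    · apply h3'
      have e : w₃ = (-(c₃⁻¹ * c₂)) • w₂ := by
        have : c₃ • w₃ = -(c₂ • w₂) := by
          rw [hc1, zero_smul, zero_add] at hrel
          exact (eq_neg_of_add_eq_zero_right hrel)
        rw [neg_smul, mul_smul, ← smul_neg, ← this, smul_smul, inv_mul_cancel₀ hc3, one_smul]
      rw [e]
      exact smul_mem_span_pair _ (Submodule.subset_span ⟨0, rfl⟩) (Submodule.subset_span ⟨1, rfl⟩)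
  · apply h1'
    have e : w₁ = (-(c₁⁻¹ * c₂)) • w₂ + (-(c₁⁻¹ * c₃)) • w₃ := by
      have : c₁ • w₁ = -(c₂ • w₂) + -(c₃ • w₃) := by
        rw [add_assoc] at hrel
        rw [eq_neg_of_add_eq_zero_left hrel, neg_add]
      exact eq_smul_add_smul hc1 this
    rw [e]
    exact Submodule.add_mem _
      (smul_mem_span_pair _ (Submodule.subset_span ⟨0, rfl⟩) (Submodule.subset_span ⟨1, rfl⟩))
      (smul_mem_span_pair _ (Submodule.subset_span ⟨2, rfl⟩) (Submodule.subset_span ⟨3, rfl⟩))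

/-- W ∩ iW has real dimension at least 2 and provides w₁; the vector x, which is outside W ∩ iW,
serves as w₂; and w₃ is any vector of W outside the real span of w₁, iw₁, x. -/
theorem exists_adapted_four {W : Submodule ℝ C3} (hW : Module.finrank ℝ W = 4) {x : C3}
    (hx : x ∈ W) (hx' : Complex.I • x ∉ W) :
    ∃ w₁ w₂ w₃ : C3, upsilon0 ![w₁, w₂, w₃] ≠ 0 ∧ w₁ ∈ W ∧ Complex.I • w₁ ∈ W ∧ w₂ ∈ W ∧
      w₃ ∈ W := by
  obtain ⟨W', hW', hmem⟩ := exists_complex_part W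
  obtain ⟨w₁, h1, h1'⟩ := exists_mem_notMem_of_finrank_lt (S := (⊥ : Submodule ℝ C3)) (T := W')
    (by rw [finrank_bot]; omega)
  obtain ⟨w₃, h3, h3'⟩ := exists_mem_notMem_of_finrank_lt
    (S := Submodule.span ℝ (range ![w₁, Complex.I • w₁, x])) (T := W)
    (lt_of_le_of_lt (finrank_span_range_le _) (by omega))
  have hw1 : w₁ ≠ 0 := fun h => h1' (by rw [h]; exact Submodule.zero_mem _)
  have hC : ∀ z : ℂ, z • w₁ ∈ W := fun z => smul_mem_span_pair z (hmem _ h1).1 (hmem _ h1).2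
  refine ⟨w₁, x, w₃, fun h0 => ?_, (hmem _ h1).1, (hmem _ h1).2, hx, h3⟩
  obtain ⟨c₁, c₂, c₃, hc, hrel⟩ := exists_relation_of_upsilon0_eq_zero h0
  by_cases hc3 : c₃ = 0
  · by_cases hc2 : c₂ = 0
    · have hc1 : c₁ ≠ 0 := by tauto
      rw [hc2, hc3, zero_smul, zero_smul, add_zero, add_zero] at hrel
      exact (smul_ne_zero hc1 hw1) hrel
    · apply hx'
      have e : x = (-(c₂⁻¹ * c₁)) • w₁ := by
        have : c₂ • x = -(c₁ • w₁) := by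
          rw [hc3, zero_smul, add_zero] at hrel
          exact (eq_neg_of_add_eq_zero_right hrel)
        rw [neg_smul, mul_smul, ← smul_neg, ← this, smul_smul, inv_mul_cancel₀ hc2, one_smul]
      rw [e, smul_smul]
      exact hC _
  · obtain ⟨α, hα⟩ : ∃ α, α = -(c₃⁻¹ * c₁) := ⟨_, rfl⟩
    obtain ⟨β, hβ⟩ : ∃ β, β = -(c₃⁻¹ * c₂) := ⟨_, rfl⟩
    have e : w₃ = α • w₁ + β • x := by
      have : c₃ • w₃ = -(c₁ • w₁) + -(c₂ • x) := by
        rw [eq_neg_of_add_eq_zero_right hrel, neg_add]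
      rw [hα, hβ]
      exact eq_smul_add_smul hc3 this
    rw [complex_smul_eq β] at e
    -- If w₃ = αw₁ + βx with β not real, solving for ix would put it in W. With β real, w₃ would lie
    -- in the real span that it was chosen to avoid.
    have him : β.im = 0 := by
      by_contra him
      apply hx'
      have h5 : β.im • (Complex.I • x) = w₃ - α • w₁ - β.re • x := by rw [e]; abel
      have h6 : β.im • (Complex.I • x) ∈ W := by
        rw [h5]
        exact W.sub_mem (W.sub_mem h3 (hC _)) (W.smul_mem _ hx)
      have h7 := W.smul_mem β.im⁻¹ h6
      rwa [smul_smul, inv_mul_cancel₀ him, one_smul] at h7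
    apply h3'
    rw [e, him, zero_smul, add_zero]
    exact Submodule.add_mem _
      (smul_mem_span_pair _ (Submodule.subset_span ⟨0, rfl⟩) (Submodule.subset_span ⟨1, rfl⟩))
      (Submodule.smul_mem _ _ (Submodule.subset_span ⟨2, rfl⟩))

end AdaptedBases

end SLBundle

namespace SLBundle

/-! ### Dimensions of the polar spaces in the model. -/

section AbstractPlanes

variable {φ : N [⋀^Fin 4]→L[ℝ] ℂ} {ζ : E6 ≃L[ℝ] C3} {K : Fib →ₗ[ℝ] ((Fin 3 → C3) → ℂ)}

/-- A plane of the model that is transverse to the fibres. -/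
def TransverseN (P : Submodule ℝ N) : Prop := ∀ v ∈ P, v.1 = 0 → v = 0

theorem TransverseN.injective {P : Submodule ℝ N} (hP : TransverseN P) (ζ : E6 ≃L[ℝ] C3) :
    Function.Injective ((ζ.toLinearEquiv.toLinearMap ∘ₗ LinearMap.fst ℝ E6 Fib).domRestrict P) := by
  rw [← LinearMap.ker_eq_bot, LinearMap.ker_eq_bot']
  rintro ⟨v, hv⟩ h
  have h1 : ζ v.1 = 0 := h
  exact Subtype.ext (hP v hv (by simpa using h1))

theorem TransverseN.finrank_map {P : Submodule ℝ N} (hP : TransverseN P) (ζ : E6 ≃L[ℝ] C3) :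
    Module.finrank ℝ (P.map (ζ.toLinearEquiv.toLinearMap ∘ₗ LinearMap.fst ℝ E6 Fib)) =
      Module.finrank ℝ P := by
  rw [← LinearMap.range_domRestrict]
  exact LinearMap.finrank_range_of_inj (hP.injective ζ)

theorem transverseN_span_iff {p : ℕ} {e : Fin p → N} (he : LinearIndependent ℝ e) :
    TransverseN (Submodule.span ℝ (range e)) ↔ LinearIndependent ℝ fun i => (e i).1 := by
  have key : (fun i => (e i).1) = LinearMap.fst ℝ E6 Fib ∘ e := rfl
  constructor
  · intro h
    rw [key]
    refine he.map ?_
    rw [Submodule.disjoint_def]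
    intro v hv hv'
    exact h v hv hv'
  · intro h v hv h0
    obtain ⟨c, rfl⟩ := (Submodule.mem_span_range_iff_exists_fun ℝ).1 hv
    have h1 : ∑ i, c i • (e i).1 = 0 := by
      rw [← h0, Prod.fst_sum]
      rfl
    have h2 := Fintype.linearIndependent_iff.1 h c h1
    simp [h2]

theorem span_range_eq_of_finrank {P : Submodule ℝ N} {p : ℕ} (hp : Module.finrank ℝ P = p)
    {e : Fin p → N} (he : LinearIndependent ℝ e) (hm : ∀ i, e i ∈ P) :
    P = Submodule.span ℝ (range e) := by
  symm
  refine Submodule.eq_of_le_of_finrank_eq (Submodule.span_le.2 ?_) ?_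
  · rintro _ ⟨i, rfl⟩
    exact hm i
  · rw [finrank_span_eq_card he, Fintype.card_fin, hp]

theorem exists_basis_of_finrank {P : Submodule ℝ N} {p : ℕ} (hp : Module.finrank ℝ P = p) :
    ∃ e : Fin p → N, LinearIndependent ℝ e ∧ P = Submodule.span ℝ (range e) := by
  let b := Module.finBasisOfFinrankEq ℝ P hp
  have h := b.linearIndependent.map' P.subtype P.ker_subtype
  exact ⟨_, h, span_range_eq_of_finrank hp h fun i => (b i).2⟩

/-- A basis of a hyperplane section adapted to the complex structure. -/
theorem exists_adapted_basis_five (ζ : E6 ≃L[ℝ] C3) {P : Submodule ℝ N} (hP : TransverseN P)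
    (hp : Module.finrank ℝ P = 5) : ∃ (e : Fin 5 → N) (w₁ w₂ w₃ : C3),
      upsilon0 ![w₁, w₂, w₃] ≠ 0 ∧ LinearIndependent ℝ e ∧ P = Submodule.span ℝ (range e) ∧
      ζ (e 0).1 = w₁ ∧ ζ (e 1).1 = w₂ ∧ ζ (e 2).1 = Complex.I • w₂ ∧ ζ (e 3).1 = w₃ ∧
      ζ (e 4).1 = Complex.I • w₃ := by
  obtain ⟨w₁, w₂, w₃, hw, ⟨a, ha, ha'⟩, ⟨b, hb, hb'⟩, ⟨c, hc, hc'⟩, ⟨d, hd, hd'⟩, ⟨f, hf, hf'⟩⟩ :=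
    exists_adapted_five ((hP.finrank_map ζ).trans hp)
  have hli : LinearIndependent ℝ ![a, b, c, d, f] := by
    refine LinearIndependent.of_comp (ζ.toLinearEquiv.toLinearMap ∘ₗ LinearMap.fst ℝ E6 Fib) ?_
    have h1 := (linearIndependent_real_basis hw).comp ![0, 2, 3, 4, 5] (by decide)
    convert h1 using 1
    funext i
    fin_cases i
    exacts [ha', hb', hc', hd', hf']
  refine ⟨![a, b, c, d, f], w₁, w₂, w₃, hw, hli, span_range_eq_of_finrank hp hli ?_,
    ha', hb', hc', hd', hf'⟩
  intro i
  fin_cases i <;> assumption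

theorem exists_adapted_basis_four (ζ : E6 ≃L[ℝ] C3) {P : Submodule ℝ N} (hP : TransverseN P)
    (hp : Module.finrank ℝ P = 4) {x : N} (hx : x ∈ P)
    (hx' : ∀ x' ∈ P, ζ x'.1 ≠ Complex.I • ζ x.1) : ∃ (e : Fin 4 → N) (w₁ w₂ w₃ : C3),
      upsilon0 ![w₁, w₂, w₃] ≠ 0 ∧ LinearIndependent ℝ e ∧ P = Submodule.span ℝ (range e) ∧
      ζ (e 0).1 = w₁ ∧ ζ (e 1).1 = Complex.I • w₁ ∧ ζ (e 2).1 = w₂ ∧ ζ (e 3).1 = w₃ := by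
  obtain ⟨w₁, w₂, w₃, hw, ⟨a, ha, ha'⟩, ⟨b, hb, hb'⟩, ⟨c, hc, hc'⟩, ⟨d, hd, hd'⟩⟩ :=
    exists_adapted_four ((hP.finrank_map ζ).trans hp) (x := ζ x.1) ⟨x, hx, rfl⟩
      (by rintro ⟨x', h1, h2⟩; exact hx' x' h1 h2)
  have hli : LinearIndependent ℝ ![a, b, c, d] := by
    refine LinearIndependent.of_comp (ζ.toLinearEquiv.toLinearMap ∘ₗ LinearMap.fst ℝ E6 Fib) ?_
    have h1 := (linearIndependent_real_basis hw).comp ![0, 1, 2, 4] (by decide)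
    convert h1 using 1
    funext i
    fin_cases i
    exacts [ha', hb', hc', hd']
  refine ⟨![a, b, c, d], w₁, w₂, w₃, hw, hli, span_range_eq_of_finrank hp hli ?_,
    ha', hb', hc', hd'⟩
  intro i
  fin_cases i <;> assumption

/-- Of the ten polar equations three follow from the others by `IsModel.rel_of_vanishOn`, and the
remaining seven are independent already on vertical vectors. The dimension is therefore 26 - 2 · 7.
-/
theorem IsModel.finrank_polarN_five (h : IsModel φ ζ K) {P : Submodule ℝ N} (hP : TransverseN P)
    (hp : Module.finrank ℝ P = 5) (hv : VanishOn φ P) : Module.finrank ℝ (polarN φ P) = 12 := by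
  obtain ⟨e, w₁, w₂, w₃, hw, hli, rfl, h0, h1, h2, h3, h4⟩ := exists_adapted_basis_five ζ hP hp
  have hm : ∀ i, e i ∈ Submodule.span ℝ (range e) := fun i => Submodule.subset_span ⟨i, rfl⟩
  -- The base components of the plane miss only the real direction iw₁ of ℂ³; the difference in the
  -- fibre components is vertical.
  have hspan : ∀ v : N, ∃ (u : N) (t : ℝ) (f : Fib), u ∈ Submodule.span ℝ (range e) ∧
      v = u + t • (ζ.symm (Complex.I • w₁), 0) + (0, f) := by
    intro v
    obtain ⟨a₁, b₁, a₂, b₂, a₃, b₃, hd⟩ := exists_real_decomposition hw (ζ v.1)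
    refine ⟨a₁ • e 0 + a₂ • e 1 + b₂ • e 2 + a₃ • e 3 + b₃ • e 4, b₁,
      v.2 - (a₁ • e 0 + a₂ • e 1 + b₂ • e 2 + a₃ • e 3 + b₃ • e 4).2, ?_, ?_⟩
    · exact Submodule.add_mem _ (Submodule.add_mem _ (Submodule.add_mem _ (Submodule.add_mem _
        (Submodule.smul_mem _ _ (hm 0)) (Submodule.smul_mem _ _ (hm 1)))
        (Submodule.smul_mem _ _ (hm 2))) (Submodule.smul_mem _ _ (hm 3)))
        (Submodule.smul_mem _ _ (hm 4))
    · refine Prod.ext ?_ ?_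
      · apply ζ.injective
        rw [hd]
        simp only [Prod.fst_add, Prod.smul_fst, map_add, map_smul, h0, h1, h2, h3, h4,
          ContinuousLinearEquiv.apply_symm_apply, map_zero]
        module
      · simp
  have key : polarN φ (Submodule.span ℝ (range e)) = LinearMap.ker (LinearMap.pi
      ![contr φ (e 0) (e 1) (e 2), contr φ (e 0) (e 1) (e 3), contr φ (e 0) (e 2) (e 3),
        contr φ (e 0) (e 1) (e 4), contr φ (e 0) (e 3) (e 4), contr φ (e 1) (e 2) (e 3),
        contr φ (e 1) (e 3) (e 4)]) := by
    ext v
    rw [mem_polarN_span_iff, LinearMap.mem_ker]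
    constructor
    · intro h
      funext i
      fin_cases i
      · exact h 0 1 2 (by decide) (by decide)
      · exact h 0 1 3 (by decide) (by decide)
      · exact h 0 2 3 (by decide) (by decide)
      · exact h 0 1 4 (by decide) (by decide)
      · exact h 0 3 4 (by decide) (by decide)
      · exact h 1 2 3 (by decide) (by decide)
      · exact h 1 3 4 (by decide) (by decide)
    · intro hk
      have k0 : φ ![v, e 0, e 1, e 2] = 0 := congrFun hk 0
      have k1 : φ ![v, e 0, e 1, e 3] = 0 := congrFun hk 1
      have k2 : φ ![v, e 0, e 2, e 3] = 0 := congrFun hk 2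
      have k3 : φ ![v, e 0, e 1, e 4] = 0 := congrFun hk 3
      have k4 : φ ![v, e 0, e 3, e 4] = 0 := congrFun hk 4
      have k5 : φ ![v, e 1, e 2, e 3] = 0 := congrFun hk 5
      have k6 : φ ![v, e 1, e 3, e 4] = 0 := congrFun hk 6
      obtain ⟨r1, r2, r3⟩ := h.rel_of_vanishOn h0 h1 h2 h3 h4 hv (hm 0) (hm 1) (hm 2) (hm 3) (hm 4)
        hspan v
      rw [k1, k2, k3, mul_zero, add_zero, add_zero] at r1
      rw [k5, mul_zero] at r2
      rw [k6, mul_zero] at r3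
      intro i j k hij hjk
      fin_cases i <;> fin_cases j <;> fin_cases k <;> first
        | assumption | (exfalso; revert hij hjk; decide)
  rw [key]
  have := finrank_ker_of_surjective (LinearMap.pi
      ![contr φ (e 0) (e 1) (e 2), contr φ (e 0) (e 1) (e 3), contr φ (e 0) (e 2) (e 3),
        contr φ (e 0) (e 1) (e 4), contr φ (e 0) (e 3) (e 4), contr φ (e 1) (e 2) (e 3),
        contr φ (e 1) (e 3) (e 4)]) (by
    intro c
    obtain ⟨f, hf0, hf1, hf2, hf3, hf4, hf5, hf6⟩ := h.exists_apply_eq_five hw (c 0) (c 1) (c 2)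
      (c 3) (c 4) (c 5) (c 6)
    refine ⟨(0, f), ?_⟩
    funext i
    fin_cases i
    · exact (h.apply_vertical f _ _ _).trans (by rw [h0, h1, h2, hf0]; rfl)
    · exact (h.apply_vertical f _ _ _).trans (by rw [h0, h1, h3, hf1]; rfl)
    · exact (h.apply_vertical f _ _ _).trans (by rw [h0, h2, h3, hf2]; rfl)
    · exact (h.apply_vertical f _ _ _).trans (by rw [h0, h1, h4, hf3]; rfl)
    · exact (h.apply_vertical f _ _ _).trans (by rw [h0, h3, h4, hf4]; rfl)
    · exact (h.apply_vertical f _ _ _).trans (by rw [h1, h2, h3, hf5]; rfl)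
    · exact (h.apply_vertical f _ _ _).trans (by rw [h1, h3, h4, hf6]; rfl))
  omega

theorem le_polarN_of_vanishOn {P : Submodule ℝ N} (hv : VanishOn φ P) : P ≤ polarN φ P := by
  intro v hvP b hb c hc d hd
  refine hv _ fun i => ?_
  fin_cases i <;> assumption

/-- The plane projects onto the whole base, so a polar vector differs from a vector of `P` by a
vertical polar vector. For the latter `K f` vanishes on all triples, whence f = 0 and H(P) = P. -/
theorem IsModel.finrank_polarN_six (h : IsModel φ ζ K) {P : Submodule ℝ N} (hP : TransverseN P)
    (hp : Module.finrank ℝ P = 6) (hv : VanishOn φ P) : Module.finrank ℝ (polarN φ P) = 6 := by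
  have htop : P.map (ζ.toLinearEquiv.toLinearMap ∘ₗ LinearMap.fst ℝ E6 Fib) = ⊤ :=
    Submodule.eq_top_of_finrank_eq (by rw [hP.finrank_map ζ, hp, finrank_C3])
  have hsurj : ∀ c : C3, ∃ u ∈ P, ζ u.1 = c := fun c => by
    have hc : c ∈ P.map (ζ.toLinearEquiv.toLinearMap ∘ₗ LinearMap.fst ℝ E6 Fib) := by
      rw [htop]; trivial
    exact hc
  have hPe : polarN φ P = P := by
    refine le_antisymm (fun v hvH => ?_) (le_polarN_of_vanishOn hv)
    obtain ⟨u, hu, huv⟩ := hsurj (ζ v.1)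
    have h1 : v - u ∈ polarN φ P := Submodule.sub_mem _ hvH (le_polarN_of_vanishOn hv hu)
    have h2 : v - u = (0, (v - u).2) := Prod.ext (by simp [ζ.injective huv]) rfl
    have h3 : (v - u).2 = 0 := by
      apply h.inj
      funext w
      obtain ⟨b, hb, hb'⟩ := hsurj (w 0)
      obtain ⟨c, hc, hc'⟩ := hsurj (w 1)
      obtain ⟨d, hd, hd'⟩ := hsurj (w 2)
      have h4 := h1 b hb c hc d hd
      rw [h2, h.apply_vertical, hb', hc', hd', ← vec_eta w] at h4
      exact h4
    rw [h3] at h2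
    have h5 : v = u := sub_eq_zero.1 h2
    rw [h5]; exact hu
  rw [hPe, hp]

theorem IsModel.finrank_polarN_four (h : IsModel φ ζ K) {P : Submodule ℝ N} (hP : TransverseN P)
    (hp : Module.finrank ℝ P = 4) {x : N} (hx : x ∈ P)
    (hx' : ∀ x' ∈ P, ζ x'.1 ≠ Complex.I • ζ x.1) : Module.finrank ℝ (polarN φ P) = 18 := by
  obtain ⟨e, w₁, w₂, w₃, hw, hli, rfl, h0, h1, h2, h3⟩ := exists_adapted_basis_four ζ hP hp hx hx'
  exact h.finrank_polarN_four_of_basis e hw h0 h1 h2 h3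

theorem IsModel.finrank_polarN_of_finrank_three (h : IsModel φ ζ K) {P : Submodule ℝ N}
    (hP : TransverseN P) (hp : Module.finrank ℝ P = 3) : Module.finrank ℝ (polarN φ P) = 24 := by
  obtain ⟨e, he, rfl⟩ := exists_basis_of_finrank hp
  exact h.finrank_polarN_three e ((transverseN_span_iff he).1 hP)

theorem finrank_polarN_of_le_two {P : Submodule ℝ N} (hp : Module.finrank ℝ P ≤ 2) :
    Module.finrank ℝ (polarN φ P) = 26 := by
  obtain ⟨e, he, hP⟩ := exists_basis_of_finrank (P := P) rfl
  rw [hP, polarN_eq_top hp e, finrank_top, finrank_N]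

theorem le_finrank_polarN_of_finrank_four {P : Submodule ℝ N} (hp : Module.finrank ℝ P = 4) :
    18 ≤ Module.finrank ℝ (polarN φ P) := by
  obtain ⟨e, he, rfl⟩ := exists_basis_of_finrank hp
  exact le_finrank_polarN_four e

theorem vanishOn_of_finrank_le_three {P : Submodule ℝ N} (hp : Module.finrank ℝ P ≤ 3) :
    VanishOn φ P := by
  obtain ⟨e, he, hP⟩ := exists_basis_of_finrank (P := P) rfl
  rw [hP, vanishOn_span_iff]
  intro s hs
  have := Fintype.card_le_of_injective s hs.injective
  simp only [Fintype.card_fin] at this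
  omega

end AbstractPlanes

end SLBundle

namespace SLBundle

/-! ### Passage from planes in the model to planes in the tangent spaces of `J`. -/

section PlanesOfJ

/-- An increasing quadruple from v, e₁, e₂, … contains v at most once and in the first place, so it
is covered either by the polar equations of v or by integrality of `P`. -/
theorem VanishOn.sup_span {φ : N [⋀^Fin 4]→L[ℝ] ℂ} {P : Submodule ℝ N} (hP : VanishOn φ P) {v : N}
    (hv : v ∈ polarN φ P) : VanishOn φ (P ⊔ Submodule.span ℝ {v}) := by
  obtain ⟨e, he, hPe⟩ := exists_basis_of_finrank (P := P) rfl
  have h1 : P ⊔ Submodule.span ℝ {v} =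
      Submodule.span ℝ (range (Fin.cons v e : Fin (Module.finrank ℝ P + 1) → N)) := by
    rw [Fin.range_cons, Submodule.span_insert, ← hPe, sup_comm]
  have hm : ∀ i, e i ∈ P := fun i => by rw [hPe]; exact Submodule.subset_span ⟨i, rfl⟩
  have hm' : ∀ i : Fin (Module.finrank ℝ P + 1), i ≠ 0 →
      (Fin.cons v e : Fin (Module.finrank ℝ P + 1) → N) i ∈ P := by
    intro i hi
    obtain ⟨j, rfl⟩ := Fin.exists_succ_eq.2 hi
    exact hm j
  rw [h1, vanishOn_span_iff]
  intro s hs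
  have hpos : ∀ i : Fin 4, i ≠ 0 → s i ≠ 0 := fun i hi h => by
    have := hs (Fin.pos_iff_ne_zero.2 hi)
    rw [h] at this
    exact absurd this (Fin.not_lt_zero _)
  by_cases h0 : s 0 = 0
  · have h2 := hv _ (hm' _ (hpos 1 (by decide))) _ (hm' _ (hpos 2 (by decide))) _
      (hm' _ (hpos 3 (by decide)))
    convert h2 using 2
    funext i
    fin_cases i
    · simp [h0]
    all_goals rfl
  · refine hP _ fun i => ?_
    by_cases hi : i = 0
    · subst hi; exact hm' _ h0
    · exact hm' _ (hpos i hi)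

variable {M : Type*} [TopologicalSpace M] [ChartedSpace E6 M] [IsManifold 𝓘(ℝ, E6) ∞ M]

/-- The plane in a tangent space of `J` with a given expression in a chart. -/
def chartPlane (z : J M) (y : N) (P : Submodule ℝ N) :
    Submodule ℝ (TangentSpace 𝓘(ℝ, N) ((chartAt N z).symm y)) :=
  P.map (EDS.chartD z y).toLinearMap

theorem chartPlane_span (z : J M) (y : N) {p : ℕ} (e : Fin p → N) :
    chartPlane z y (Submodule.span ℝ (range e)) =
      Submodule.span ℝ (range fun i => EDS.chartD z y (e i)) := by
  rw [chartPlane, Submodule.map_span, ← range_comp]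
  rfl

theorem mem_chartPlane_iff (z : J M) {y : N} (hy : y ∈ (chartAt N z).target) (P : Submodule ℝ N)
    (v : N) : EDS.chartD z y v ∈ chartPlane z y P ↔ v ∈ P := by
  constructor
  · rintro ⟨w, hw, hwv⟩
    rwa [← (EDS.chartD_bijective z hy).1 hwv]
  · exact fun h => ⟨v, h, rfl⟩

theorem exists_chartPlane_eq (z : J M) {y : N} (hy : y ∈ (chartAt N z).target)
    (Q : Submodule ℝ (TangentSpace 𝓘(ℝ, N) ((chartAt N z).symm y))) :
    ∃ P : Submodule ℝ N, Q = chartPlane z y P :=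
  ⟨Q.comap (EDS.chartD z y).toLinearMap,
    (Submodule.map_comap_eq_of_surjective (EDS.chartD_bijective z hy).2 Q).symm⟩

theorem finrank_chartPlane (z : J M) {y : N} (hy : y ∈ (chartAt N z).target) (P : Submodule ℝ N) :
    Module.finrank ℝ (chartPlane z y P) = Module.finrank ℝ P :=
  (LinearEquiv.finrank_eq (Submodule.equivMapOfInjective (EDS.chartD z y).toLinearMap
    (EDS.chartD_bijective z hy).1 P)).symm

theorem isIntegralElement_chartPlane_iff (z : J M) (y : N) (P : Submodule ℝ N) :
    EDS.IsIntegralElement (idealJ M) (chartPlane z y P) ↔ VanishOn (omega z y) P := by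
  rw [idealJ, EDS.isIntegralElement_ideal_iff]
  constructor
  · intro h v hv
    apply Complex.ext
    · exact h 4 _ IsGenerator.re (fun i => EDS.chartD z y (v i)) fun i => ⟨_, hv i, rfl⟩
    · exact h 4 _ IsGenerator.im (fun i => EDS.chartD z y (v i)) fun i => ⟨_, hv i, rfl⟩
  · intro h q ψ hψ v hv
    choose w hw hwv using hv
    obtain rfl : (fun i => EDS.chartD z y (w i)) = v := funext hwv
    cases hψ with
    | re => exact congrArg Complex.re (h w hw)
    | im => exact congrArg Complex.im (h w hw)

theorem finrank_polarSpace_chartPlane (z : J M) {y : N} (hy : y ∈ (chartAt N z).target)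
    {P : Submodule ℝ N} (hP : VanishOn (omega z y) P) :
    Module.finrank ℝ (EDS.polarSpace (idealJ M) (chartPlane z y P)) =
      Module.finrank ℝ (polarN (omega z y) P) := by
  rw [← finrank_chartPlane z hy]
  have h : EDS.polarSpace (idealJ M) (chartPlane z y P) =
      chartPlane z y (polarN (omega z y) P) := by
    apply SetLike.coe_injective
    rw [EDS.coe_polarSpace _ _ ((isIntegralElement_chartPlane_iff z y P).2 hP)]
    ext v
    obtain ⟨v, rfl⟩ := (EDS.chartD_bijective z hy).2 v
    rw [SetLike.mem_coe, mem_chartPlane_iff z hy]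
    constructor
    · rintro ⟨Q, hQ, hPQ, hv⟩
      obtain ⟨Q, rfl⟩ := exists_chartPlane_eq z hy Q
      rw [isIntegralElement_chartPlane_iff z y] at hQ
      rw [mem_chartPlane_iff z hy] at hv
      have hPQ' : P ≤ Q := fun w hw => (mem_chartPlane_iff z hy Q w).1 (hPQ ⟨w, hw, rfl⟩)
      intro b hb c hc d hd
      refine hQ _ fun i => ?_
      fin_cases i
      exacts [hv, hPQ' hb, hPQ' hc, hPQ' hd]
    · intro hv
      refine ⟨chartPlane z y (P ⊔ Submodule.span ℝ {v}),
        (isIntegralElement_chartPlane_iff z y _).2 (hP.sup_span hv),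
        Submodule.map_mono le_sup_left, ?_⟩
      rw [mem_chartPlane_iff z hy]
      exact Submodule.mem_sup_right (Submodule.mem_span_singleton_self v)
  rw [h]

theorem injOn_chartPlane_iff (z : J M) {y : N} (hy : y ∈ (chartAt N z).target)
    (P : Submodule ℝ N) :
    InjOn (mfderiv 𝓘(ℝ, N) 𝓘(ℝ, E6) (J.base (M := M)) ((chartAt N z).symm y))
      (chartPlane z y P) ↔ TransverseN P := by
  have hinj := (EDS.chartD_bijective z.base hy.1).1
  constructor
  · intro h v hv h0
    have h1 : EDS.chartD z y v = 0 := by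
      refine h ⟨v, hv, rfl⟩ (Submodule.zero_mem _) ?_
      refine (mfderiv_base_chartD z hy v).trans ?_
      rw [h0, map_zero, map_zero]
      rfl
    exact (EDS.chartD_bijective z hy).1 (h1.trans (map_zero _).symm)
  · rintro h _ ⟨v, hv, rfl⟩ _ ⟨w, hw, rfl⟩ hvw
    have h1 : EDS.chartD z.base y.1 v.1 = EDS.chartD z.base y.1 w.1 :=
      (mfderiv_base_chartD z hy v).symm.trans (hvw.trans (mfderiv_base_chartD z hy w))
    have h2 : v - w = 0 := h _ (P.sub_mem hv hw) (by simpa [sub_eq_zero] using hinj h1)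
    rw [sub_eq_zero.1 h2]

/-- Linear coordinates adapted to a transverse plane: the plane has slope zero, and the fibre
directions belong to the second block. -/
theorem exists_adapted_coord {p : ℕ} {e : Fin p → N} (he : LinearIndependent ℝ fun i => (e i).1) :
    ∃ ℓ : EDS.Coord N p, EDS.slopeVector ℓ 0 = e ∧ ∀ f : Fib, (ℓ (0, f)).1 = 0 := by
  have he' : LinearIndependent ℝ e := LinearIndependent.of_comp (LinearMap.fst ℝ E6 Fib) he
  have hdis : Disjoint (Submodule.span ℝ (range e)) (LinearMap.ker (LinearMap.fst ℝ E6 Fib)) := by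
    rw [Submodule.disjoint_def]
    intro v hv hv'
    exact (transverseN_span_iff he').2 he v hv hv'
  -- Transversality means that the plane meets the vertical space in zero, so it has a complement
  -- `K` that contains the vertical space. The second block of coordinates is a basis of `K`.
  obtain ⟨K, hK, hc⟩ := hdis.symm.exists_isCompl
  replace hc := hc.symm
  have hcard : Module.finrank ℝ (Submodule.span ℝ (range e)) = p := by
    rw [finrank_span_eq_card he', Fintype.card_fin]
  have hfK : Module.finrank ℝ K = Module.finrank ℝ N - p := by
    have := Submodule.finrank_add_eq_of_isCompl hc
    omega
  let b := Module.Basis.span he'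
  let bK := Module.finBasisOfFinrankEq ℝ K hfK
  let L := (Submodule.prodEquivOfIsCompl _ _ hc).symm.trans
    (LinearEquiv.prodCongr b.equivFun bK.equivFun)
  refine ⟨L.toContinuousLinearEquiv, ?_, ?_⟩
  · funext i
    change L.symm (Pi.single i 1, 0) = e i
    rw [LinearEquiv.symm_apply_eq]
    have h1 : e i = ((b i : Submodule.span ℝ (range e)) : N) := by
      simp [b, Module.Basis.span_apply]
    refine Eq.symm ?_
    change (LinearEquiv.prodCongr b.equivFun bK.equivFun)
      ((Submodule.prodEquivOfIsCompl _ _ hc).symm (e i)) = _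
    rw [h1, Submodule.prodEquivOfIsCompl_symm_apply_left]
    refine Prod.ext ?_ ?_
    · change b.equivFun (b i) = Pi.single i 1
      funext j
      rw [Module.Basis.equivFun_self]
      simp [Pi.single_apply, eq_comm]
    · exact map_zero bK.equivFun
  · intro f
    have hm : ((0, f) : N) ∈ K := hK rfl
    change ((LinearEquiv.prodCongr b.equivFun bK.equivFun)
      ((Submodule.prodEquivOfIsCompl _ _ hc).symm (0, f))).1 = 0
    have h1 := Submodule.prodEquivOfIsCompl_symm_apply_right _ _ hc ⟨(0, f), hm⟩
    rw [show (((⟨(0, f), hm⟩ : K) : N)) = ((0, f) : N) from rfl] at h1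
    rw [h1]
    exact map_zero b.equivFun

/-- The element of the Grassmann bundle with a given expression in a chart. -/
def grOf (z : J M) {y : N} (hy : y ∈ (chartAt N z).target) {p : ℕ} {P : Submodule ℝ N}
    (hP : Module.finrank ℝ P = p) : EDS.Gr N (J M) p where
  pt := (chartAt N z).symm y
  plane := chartPlane z y P
  finrank_plane := by rw [finrank_chartPlane z hy, hP]

theorem grOf_mem_V_iff (z : J M) {y : N} (hy : y ∈ (chartAt N z).target) {p : ℕ}
    {P : Submodule ℝ N} (hP : Module.finrank ℝ P = p) :
    grOf z hy hP ∈ EDS.V (idealJ M) p ↔ VanishOn (omega z y) P :=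
  isIntegralElement_chartPlane_iff z y P

theorem grOf_mem_VJ_iff (z : J M) {y : N} (hy : y ∈ (chartAt N z).target) {p : ℕ}
    {P : Submodule ℝ N} (hP : Module.finrank ℝ P = p) :
    grOf z hy hP ∈ VJ M p ↔ VanishOn (omega z y) P ∧ TransverseN P :=
  and_congr (isIntegralElement_chartPlane_iff z y P) (injOn_chartPlane_iff z hy P)

theorem finrank_polarSpace_grOf (z : J M) {y : N} (hy : y ∈ (chartAt N z).target) {p : ℕ}
    {P : Submodule ℝ N} (hP : Module.finrank ℝ P = p) (hv : VanishOn (omega z y) P) :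
    Module.finrank ℝ (EDS.polarSpace (idealJ M) (grOf z hy hP).plane) =
      Module.finrank ℝ (polarN (omega z y) P) :=
  finrank_polarSpace_chartPlane z hy hv

theorem finrank_span_slopeVector {p : ℕ} (ℓ : EDS.Coord N p)
    (s : Fin p → Fin (Module.finrank ℝ N - p) → ℝ) :
    Module.finrank ℝ (Submodule.span ℝ (range (EDS.slopeVector ℓ s))) = p := by
  rw [finrank_span_eq_card (EDS.linearIndependent_slopeVector ℓ s), Fintype.card_fin]

theorem graphPlane_eq_grOf (z : J M) {p : ℕ} (ℓ : EDS.Coord N p) (w : EDS.GrCoord N p z)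
    {P : Submodule ℝ N} (h : Submodule.span ℝ (range (EDS.slopeVector ℓ w.2)) = P)
    (hP : Module.finrank ℝ P = p) : EDS.graphPlane z ℓ w = grOf z w.1.2 hP := by
  subst h
  rw [grOf, EDS.graphPlane]
  congr 1
  exact (chartPlane_span z (w.1 : N) _).symm

theorem exists_eq_grOf {p : ℕ} (E : EDS.Gr N (J M) p) :
    ∃ (z : J M) (P : Submodule ℝ N) (hP : Module.finrank ℝ P = p),
      E = grOf z (mem_chart_target N z) hP := by
  obtain ⟨z, Q, hQ⟩ := E
  have hz : z = (chartAt N z).symm (chartAt N z z) :=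
    ((chartAt N z).left_inv (mem_chart_source N z)).symm
  -- The type of the plane depends on its base point, so the identification of `z` with the value of
  -- the inverse chart is made for a variable point, for which substitution is possible.
  have key : ∀ z' (_ : z = z'), ∃ (Q' : Submodule ℝ (TangentSpace 𝓘(ℝ, N) z'))
      (hQ' : Module.finrank ℝ Q' = p), (⟨z, Q, hQ⟩ : EDS.Gr N (J M) p) = ⟨z', Q', hQ'⟩ := by
    rintro _ rfl
    exact ⟨Q, hQ, rfl⟩
  obtain ⟨Q', hQ', h⟩ := key _ hz
  obtain ⟨P, rfl⟩ := exists_chartPlane_eq z (mem_chart_target N z) Q'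
  exact ⟨z, P, by rw [← hQ', finrank_chartPlane z (mem_chart_target N z)], h⟩

end PlanesOfJ

end SLBundle

namespace SLBundle

/-! ### Transversality and independence of the polar equations are open conditions. -/

section Openness

theorem contDiff_upsilon0 : ContDiff ℝ ∞ (upsilon0 : (Fin 3 → C3) → ℂ) := by
  have h : (upsilon0 : (Fin 3 → C3) → ℂ) = fun u => upsilon0 ![u 0, u 1, u 2] := by
    funext u
    rw [← vec_eta u]
  rw [h]
  simp only [upsilon0_vec]
  fun_prop

/-- Preimages of a basis, chosen at one parameter, keep independent images for nearby parameters,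
and independent vectors in that number span the target. -/
theorem isOpen_setOf_surjective {W F : Type*} [TopologicalSpace W] [NormedAddCommGroup F]
    [NormedSpace ℝ F] [FiniteDimensional ℝ F] {V : Type*} [AddCommGroup V] [Module ℝ V]
    (L : W → V →ₗ[ℝ] F) (hL : ∀ v, Continuous fun w => L w v) :
    IsOpen {w | Function.Surjective (L w)} := by
  rw [isOpen_iff_mem_nhds]
  intro w₀ hw₀
  let b := Module.finBasis ℝ F
  choose v hv using fun i => hw₀ (b i)
  have hc : Continuous fun w => fun i => L w (v i) := continuous_pi fun i => hL (v i)
  have ho := (isOpen_setOfPred_linearIndependent (𝕜 := ℝ)).preimage hc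
  have hm : w₀ ∈ (fun w => fun i => L w (v i)) ⁻¹'
      {f : Fin (Module.finrank ℝ F) → F | LinearIndependent ℝ f} := by
    change LinearIndependent ℝ fun i => L w₀ (v i)
    simp only [hv]
    exact b.linearIndependent
  filter_upwards [ho.mem_nhds hm] with w hw
  have hw' : LinearIndependent ℝ fun i => L w (v i) := hw
  have hs := hw'.span_eq_top_of_card_eq_finrank' (by simp)
  refine LinearMap.range_eq_top.1 (eq_top_iff.2 ?_)
  rw [← hs, Submodule.span_le]
  rintro _ ⟨i, rfl⟩
  exact ⟨v i, rfl⟩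

theorem finrank_polarN_four_eq_iff {φ : N [⋀^Fin 4]→L[ℝ] ℂ} (e : Fin 4 → N) :
    Module.finrank ℝ (polarN φ (Submodule.span ℝ (range e))) = 18 ↔
      Function.Surjective (contrFour φ e) := by
  rw [polarN_four]
  constructor
  · intro h
    have h1 := (contrFour φ e).finrank_range_add_finrank_ker
    rw [h, finrank_N] at h1
    exact LinearMap.range_eq_top.1 (Submodule.eq_top_of_finrank_eq (by
      rw [finrank_fin_complex]; omega))
  · intro h
    have := finrank_ker_of_surjective (contrFour φ e) h
    omega

theorem continuous_slopeVector {p : ℕ} (ℓ : EDS.Coord N p) (i : Fin p) :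
    Continuous fun s => EDS.slopeVector ℓ s i := by
  unfold EDS.slopeVector
  exact ℓ.symm.continuous.comp (continuous_const.prodMk (continuous_apply i))

variable {M : Type*} [TopologicalSpace M] [ChartedSpace E6 M] [IsManifold 𝓘(ℝ, E6) ∞ M]

theorem contDiffOn_omega (z : J M) :
    ContDiffOn ℝ ∞ (fun g : N × (Fin 4 → N) => omega z g.1 g.2)
      ((chartAt N z).target ×ˢ univ) := by
  have h : ContDiff ℝ ∞ fun g : N × (Fin 4 → N) => ∑ i : Fin 4, (-1 : ℂ) ^ (i : ℕ) * ∑ k : Fin 3,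
      upsilon0 (Function.update (fun j => fibSlice g.1.2 (refIso z (g.2 (i.succAbove j)).1)) k
        (fderiv ℝ fibSlice g.1.2 (g.2 i).2 (refIso z (g.2 (i.succAbove k)).1))) := by
    have hp : ∀ i, ContDiff ℝ ∞ fun g : N × (Fin 4 → N) => g.2 i := fun i =>
      (contDiff_apply ℝ N i).comp contDiff_snd
    have hr : ∀ i, ContDiff ℝ ∞ fun g : N × (Fin 4 → N) => refIso z (g.2 i).1 := fun i =>
      (refIso z).contDiff.comp (contDiff_fst.comp (hp i))
    have hd : ContDiff ℝ ∞ (fderiv ℝ fibSlice) := contDiff_fibSlice.fderiv_right (by simp)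
    have hs : ContDiff ℝ ∞ fun g : N × (Fin 4 → N) => fibSlice g.1.2 :=
      contDiff_fibSlice.comp (contDiff_snd.comp contDiff_fst)
    have hd' : ContDiff ℝ ∞ fun g : N × (Fin 4 → N) => fderiv ℝ fibSlice g.1.2 :=
      hd.comp (contDiff_snd.comp contDiff_fst)
    refine ContDiff.sum fun i _ => contDiff_const.mul (ContDiff.sum fun k _ => ?_)
    refine contDiff_upsilon0.comp (contDiff_pi.2 fun j => ?_)
    by_cases hjk : j = k
    · subst hjk
      simp only [Function.update_self]
      exact (hd'.clm_apply (contDiff_snd.comp (hp i))).clm_apply (hr _)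
    · simp only [Function.update_of_ne hjk]
      exact hs.clm_apply (hr _)
  refine h.contDiffOn.congr fun g hg => ?_
  exact omega_apply z hg.1 g.2

theorem isOpen_gr_iff {p : ℕ} (U : Set (EDS.Gr N (J M) p)) : IsOpen U ↔
    ∀ (z : J M) (ℓ : EDS.Coord N p), IsOpen (EDS.graphPlane z ℓ ⁻¹' U) := by
  change IsOpen[⨆ (x₀ : J M) (ℓ : EDS.Coord N p),
    TopologicalSpace.coinduced (EDS.graphPlane x₀ ℓ) inferInstance] U ↔ _
  simp only [isOpen_iSup_iff, isOpen_coinduced]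

theorem continuous_graphPlane (z : J M) {p : ℕ} (ℓ : EDS.Coord N p) :
    Continuous (EDS.graphPlane (p := p) z ℓ) :=
  continuous_def.2 fun U hU => (isOpen_gr_iff U).1 hU z ℓ

variable (M) in
/-- The planes that are transverse to the fibres of `J`. -/
def transverseGr (p : ℕ) : Set (EDS.Gr N (J M) p) :=
  {E | InjOn (mfderiv 𝓘(ℝ, N) 𝓘(ℝ, E6) (J.base (M := M)) E.pt) E.plane}

variable (M) in
/-- The four-dimensional planes on which the polar equations are independent. -/
def generalGr : Set (EDS.Gr N (J M) 4) :=
  {E | Module.finrank ℝ (polarN (EDS.extD gamma E.pt) E.plane) = 18}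

theorem grOf_mem_transverseGr_iff (z : J M) {y : N} (hy : y ∈ (chartAt N z).target) {p : ℕ}
    {P : Submodule ℝ N} (hP : Module.finrank ℝ P = p) :
    grOf z hy hP ∈ transverseGr M p ↔ TransverseN P :=
  injOn_chartPlane_iff z hy P

theorem polarN_chartPlane (z : J M) {y : N} (hy : y ∈ (chartAt N z).target) (P : Submodule ℝ N) :
    polarN (EDS.extD gamma ((chartAt N z).symm y)) (chartPlane z y P) =
      chartPlane z y (polarN (omega z y) P) := by
  ext v
  obtain ⟨v, rfl⟩ := (EDS.chartD_bijective z hy).2 v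
  rw [mem_chartPlane_iff z hy]
  have key : ∀ b c d : N, EDS.extD gamma ((chartAt N z).symm y) ![EDS.chartD z y v,
      EDS.chartD z y b, EDS.chartD z y c, EDS.chartD z y d] = omega z y ![v, b, c, d] := by
    intro b c d
    rw [omega, EDS.inChart_apply]
    congr 1
    funext i
    fin_cases i <;> rfl
  constructor
  · intro h b hb c hc d hd
    rw [← key]
    exact h _ ⟨b, hb, rfl⟩ _ ⟨c, hc, rfl⟩ _ ⟨d, hd, rfl⟩
  · rintro h _ ⟨b, hb, rfl⟩ _ ⟨c, hc, rfl⟩ _ ⟨d, hd, rfl⟩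
    exact (key b c d).trans (h b hb c hc d hd)

theorem grOf_mem_generalGr_iff (z : J M) {y : N} (hy : y ∈ (chartAt N z).target)
    {P : Submodule ℝ N} (hP : Module.finrank ℝ P = 4) :
    grOf z hy hP ∈ generalGr M ↔ Module.finrank ℝ (polarN (omega z y) P) = 18 := by
  rw [← finrank_chartPlane z hy, ← polarN_chartPlane z hy]
  rfl

theorem isOpen_transverseGr (p : ℕ) : IsOpen (transverseGr M p) := by
  rw [isOpen_gr_iff]
  intro z ℓ
  have h : EDS.graphPlane z ℓ ⁻¹' transverseGr M p =
      (fun w : EDS.GrCoord N p z => fun i => (EDS.slopeVector ℓ w.2 i).1) ⁻¹'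
        {f : Fin p → E6 | LinearIndependent ℝ f} := by
    ext w
    rw [mem_preimage, graphPlane_eq_grOf z ℓ w rfl (finrank_span_slopeVector ℓ w.2),
      grOf_mem_transverseGr_iff, transverseN_span_iff (EDS.linearIndependent_slopeVector ℓ w.2)]
    rfl
  rw [h]
  refine isOpen_setOfPred_linearIndependent.preimage (continuous_pi fun i => ?_)
  exact continuous_fst.comp ((continuous_slopeVector ℓ i).comp continuous_snd)

/-- In the coordinates of the Grassmann bundle the condition becomes surjectivity of `contrFour`,
whose coefficients are continuous. -/
theorem isOpen_generalGr : IsOpen (generalGr M) := by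
  rw [isOpen_gr_iff]
  intro z ℓ
  have h : EDS.graphPlane z ℓ ⁻¹' generalGr M = {w : EDS.GrCoord N 4 z |
      Function.Surjective (contrFour (omega z w.1) (EDS.slopeVector ℓ w.2))} := by
    ext w
    rw [mem_preimage, graphPlane_eq_grOf z ℓ w rfl (finrank_span_slopeVector ℓ w.2),
      grOf_mem_generalGr_iff, finrank_polarN_four_eq_iff]
    rfl
  rw [h]
  refine isOpen_setOf_surjective _ fun v => continuous_pi fun i => ?_
  have key : ∀ a b c : Fin 4, Continuous fun w : EDS.GrCoord N 4 z =>
      omega z w.1 ![v, EDS.slopeVector ℓ w.2 a, EDS.slopeVector ℓ w.2 b,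
        EDS.slopeVector ℓ w.2 c] := by
    intro a b c
    refine (contDiffOn_omega z).continuousOn.comp_continuous
      (f := fun w : EDS.GrCoord N 4 z => ((w.1 : N), ![v, EDS.slopeVector ℓ w.2 a,
        EDS.slopeVector ℓ w.2 b, EDS.slopeVector ℓ w.2 c])) ?_ fun w => ⟨w.1.2, trivial⟩
    have hs := fun i => (continuous_slopeVector ℓ i).comp
      (continuous_snd (X := (chartAt N z).target))
    refine (continuous_subtype_val.comp continuous_fst).prodMk (continuous_pi fun i => ?_)
    fin_cases i
    exacts [continuous_const, hs a, hs b, hs c]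
  fin_cases i
  exacts [key 0 1 2, key 0 1 3, key 0 2 3, key 1 2 3]

theorem IsModel.finrank_polarN_eq {φ : N [⋀^Fin 4]→L[ℝ] ℂ} {ζ : E6 ≃L[ℝ] C3}
    {K : Fib →ₗ[ℝ] ((Fin 3 → C3) → ℂ)} (h : IsModel φ ζ K) {p : Fin 7} (hp4 : p ≠ 4)
    {P : Submodule ℝ N} (hP : TransverseN P) (hp : Module.finrank ℝ P = (p : ℕ))
    (hv : VanishOn φ P) : Module.finrank ℝ (polarN φ P) = m p := by
  fin_cases p
  · exact finrank_polarN_of_le_two (hp.le.trans (by decide))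
  · exact finrank_polarN_of_le_two (hp.le.trans (by decide))
  · exact finrank_polarN_of_le_two (hp.le.trans (by decide))
  · exact h.finrank_polarN_of_finrank_three hP hp
  · exact absurd rfl hp4
  · exact h.finrank_polarN_five hP hp hv
  · exact h.finrank_polarN_six hP hp hv

theorem finrank_polarSpace_eq {p : Fin 7} (hp4 : p ≠ 4) {E : EDS.Gr N (J M) p} (hE : E ∈ VJ M p) :
    Module.finrank ℝ (EDS.polarSpace (idealJ M) E.plane) = m p := by
  obtain ⟨z, P, hP, rfl⟩ := exists_eq_grOf E
  obtain ⟨hv, hT⟩ := (grOf_mem_VJ_iff z _ hP).1 hE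
  obtain ⟨ζ, K, h⟩ := exists_isModel_omega z (mem_chart_target N z)
  rw [finrank_polarSpace_grOf z _ hP hv, h.finrank_polarN_eq hp4 hT hP hv]

theorem le_finrank_polarSpace_four {E : EDS.Gr N (J M) 4} (hE : E ∈ VJ M 4) :
    18 ≤ Module.finrank ℝ (EDS.polarSpace (idealJ M) E.plane) := by
  obtain ⟨z, P, hP, rfl⟩ := exists_eq_grOf E
  obtain ⟨hv, hT⟩ := (grOf_mem_VJ_iff z _ hP).1 hE
  rw [finrank_polarSpace_grOf z _ hP hv]
  exact le_finrank_polarN_of_finrank_four hP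

/-- `generalGr` is defined by the polar equations alone, also for planes that are not integral. It
is thus open in the whole bundle, and on integral elements it expresses the condition on H. -/
theorem mem_generalGr_iff {E : EDS.Gr N (J M) 4} (hE : E ∈ EDS.V (idealJ M) 4) :
    E ∈ generalGr M ↔ Module.finrank ℝ (EDS.polarSpace (idealJ M) E.plane) = 18 := by
  obtain ⟨z, P, hP, rfl⟩ := exists_eq_grOf E
  rw [finrank_polarSpace_grOf z _ hP ((grOf_mem_V_iff z _ hP).1 hE), grOf_mem_generalGr_iff]

end Openness

end SLBundle

namespace SLBundle

/-! ### Deformation of complex four-dimensional integral planes. -/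

section Density

theorem exists_basis_four_extending {P : Submodule ℝ N} (hp : Module.finrank ℝ P = 4) {c d : N}
    (hc : c ∈ P) (hd : d ∈ P) (hcd : LinearIndependent ℝ ![c, d]) :
    ∃ a b, LinearIndependent ℝ ![a, b, c, d] ∧ P = Submodule.span ℝ (range ![a, b, c, d]) := by
  obtain ⟨b, hb, hb'⟩ := exists_mem_notMem_of_finrank_lt
    (S := Submodule.span ℝ (range ![c, d])) (T := P)
    (lt_of_le_of_lt (finrank_span_range_le _) (by omega))
  have h3 : LinearIndependent ℝ ![b, c, d] := linearIndependent_finCons.2 ⟨hcd, hb'⟩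
  obtain ⟨a, ha, ha'⟩ := exists_mem_notMem_of_finrank_lt
    (S := Submodule.span ℝ (range ![b, c, d])) (T := P)
    (lt_of_le_of_lt (finrank_span_range_le _) (by omega))
  have h4 : LinearIndependent ℝ ![a, b, c, d] := linearIndependent_finCons.2 ⟨h3, ha'⟩
  refine ⟨a, b, h4, span_range_eq_of_finrank hp h4 ?_⟩
  intro i
  fin_cases i <;> assumption

theorem linearIndependent_pair_I {w : C3} (hw : w ≠ 0) :
    LinearIndependent ℝ ![w, Complex.I • w] := by
  rw [LinearIndependent.pair_iff]
  intro s t h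
  have h1 : ((s : ℂ) + t * Complex.I) • w = 0 := by
    rw [← h, complex_smul_eq]
    simp
  have h2 := (smul_eq_zero.1 h1).resolve_right hw
  have hre := congrArg Complex.re h2
  have him := congrArg Complex.im h2
  simp at hre him
  exact ⟨hre, him⟩

theorem slopeVector_update {p : ℕ} (ℓ : EDS.Coord N p) {w : N} (hw : (ℓ w).1 = 0) (i : Fin p)
    (t : ℝ) : EDS.slopeVector ℓ (Function.update 0 i (t • (ℓ w).2)) =
      Function.update (EDS.slopeVector ℓ 0) i (EDS.slopeVector ℓ 0 i + t • w) := by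
  funext j
  have hw' : ℓ w = (0, (ℓ w).2) := Prod.ext hw rfl
  by_cases hij : j = i
  · subst hij
    rw [Function.update_self]
    unfold EDS.slopeVector
    rw [ℓ.symm_apply_eq, map_add, map_smul, ℓ.apply_symm_apply, Function.update_self, hw']
    simp
  · rw [Function.update_of_ne hij]
    unfold EDS.slopeVector
    rw [Function.update_of_ne hij]

theorem coord_apply_of_slopeVector {p : ℕ} {ℓ : EDS.Coord N p} {e : Fin p → N}
    (h : EDS.slopeVector ℓ 0 = e) (i : Fin p) : ℓ (e i) = (Pi.single i 1, 0) := by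
  rw [← h]
  exact ℓ.apply_symm_apply _

theorem strictMono_fin_eq_id {n : ℕ} {s : Fin n → Fin n} (hs : StrictMono s) : s = id := by
  have h := Subsingleton.elim
    (hs.orderIsoOfSurjective s (Finite.surjective_of_injective hs.injective)) (OrderIso.refl _)
  exact congrArg DFunLike.coe h

/-- A complex four-dimensional integral plane may be moved, through integral planes, out of the
set of the complex planes. -/
theorem exists_deformation {φ : N [⋀^Fin 4]→L[ℝ] ℂ} {ζ : E6 ≃L[ℝ] C3}
    {K : Fib →ₗ[ℝ] ((Fin 3 → C3) → ℂ)} (h : IsModel φ ζ K) {P : Submodule ℝ N}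
    (hT : TransverseN P) (hp : Module.finrank ℝ P = 4) (hv : VanishOn φ P)
    (hC : ∀ x ∈ P, ∃ x' ∈ P, ζ x'.1 = Complex.I • ζ x.1) :
    ∃ (ℓ : EDS.Coord N 4) (r : Fin (Module.finrank ℝ N - 4) → ℝ),
      Submodule.span ℝ (range (EDS.slopeVector ℓ 0)) = P ∧ ∀ t : ℝ, t ≠ 0 →
      VanishOn φ (Submodule.span ℝ (range (EDS.slopeVector ℓ (Function.update 0 3 (t • r))))) ∧
      TransverseN (Submodule.span ℝ (range (EDS.slopeVector ℓ (Function.update 0 3 (t • r))))) ∧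
      Module.finrank ℝ (polarN φ (Submodule.span ℝ
        (range (EDS.slopeVector ℓ (Function.update 0 3 (t • r)))))) = 18 := by
  obtain ⟨c, hc, hc0⟩ := exists_mem_notMem_of_finrank_lt (S := (⊥ : Submodule ℝ N)) (T := P)
    (by rw [finrank_bot]; omega)
  obtain ⟨d, hd, hcd⟩ := hC c hc
  have hζc : ζ c.1 ≠ 0 := fun h0 => hc0 (hT c hc (by simpa using h0))
  have hli2 : LinearIndependent ℝ ![c, d] := by
    refine LinearIndependent.of_comp (ζ.toLinearEquiv.toLinearMap ∘ₗ LinearMap.fst ℝ E6 Fib) ?_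
    convert linearIndependent_pair_I hζc using 1
    funext i
    fin_cases i
    exacts [rfl, hcd]
  obtain ⟨a, b, hli, rfl⟩ := exists_basis_four_extending hp hc hd hli2
  set e : Fin 4 → N := ![a, b, c, d] with he
  have hb : LinearIndependent ℝ fun i => (e i).1 := (transverseN_span_iff hli).1 hT
  have hm : ∀ i, e i ∈ Submodule.span ℝ (range e) := fun i => Submodule.subset_span ⟨i, rfl⟩
  obtain ⟨ℓ, hℓ, -⟩ := exists_adapted_coord hb
  -- With `a`, `b`, `c` fixed, integrality of a 4-plane is the single linear equation L = 0 on its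
  -- fourth basis vector.
  let L : N →ₗ[ℝ] ℂ := φ.toAlternatingMap.toMultilinearMap.toLinearMap e 3
  have hL : ∀ v, L v = φ (Function.update e 3 v) := fun v => rfl
  have hup : ∀ v, Function.update e 3 v = ![a, b, c, v] := fun v => by
    funext i; fin_cases i <;> rfl
  have hLP : ∀ v ∈ Submodule.span ℝ (range e), L v = 0 := by
    intro v hvP
    refine hv _ fun i => ?_
    by_cases hi : i = 3
    · subst hi; simpa using hvP
    · rw [Function.update_of_ne hi]; exact hm i
  obtain ⟨u, -, hu⟩ := exists_mem_notMem_of_finrank_lt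
    (S := Submodule.span ℝ (range fun i => (e i).1)) (T := (⊤ : Submodule ℝ E6))
    (lt_of_le_of_lt (finrank_span_range_le _) (by rw [finrank_top]; simp))
  have hli3 : LinearIndependent ℝ fun i : Fin 3 => ζ (![a, b, c] i).1 := by
    have h1 := (hb.map' ζ.toLinearEquiv.toLinearMap ζ.toLinearEquiv.ker).comp ![0, 1, 2]
      (by decide)
    have h2 : (fun i : Fin 3 => ζ (![a, b, c] i).1) =
        (ζ.toLinearEquiv.toLinearMap ∘ fun i => (e i).1) ∘ ![0, 1, 2] := by
      funext i
      fin_cases i <;> rfl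
    rw [h2]
    exact h1
  -- The base direction `u` leaves the base image of the plane. The vertical vector `f` compensates
  -- its contribution, so that L(u, f) = 0.
  obtain ⟨f, hf⟩ := h.exists_apply_eq hli3 (L (u, 0))
  have hLf : L (0, f) = - L (u, 0) := by
    rw [hL, hup, h.apply_vec, ← hf, vec_eta (fun i : Fin 3 => ζ (![a, b, c] i).1)]
    simp [(h.map_vec_zero _ _ _).2.2]
  -- Subtracting the component along the plane does not change L and makes the first block of
  -- coordinates of `w` zero; adding t w to the last basis vector then changes only the last slope.
  let w : N := (u, f) - ∑ i, (ℓ (u, f)).1 i • e i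
  have hsum : (∑ i, (ℓ (u, f)).1 i • e i) ∈ Submodule.span ℝ (range e) :=
    Submodule.sum_mem _ fun i _ => Submodule.smul_mem _ _ (hm i)
  have hℓw : (ℓ w).1 = 0 := by
    simp only [w, map_sub, map_sum, map_smul, coord_apply_of_slopeVector hℓ]
    funext j
    simp [Prod.fst_sum, Finset.sum_apply, Pi.single_apply]
  have hLw : L w = 0 := by
    have h1 : ((u, f) : N) = (u, 0) + (0, f) := by simp
    have h2 : L w = L (u, f) - L (∑ i, (ℓ (u, f)).1 i • e i) := map_sub L _ _
    rw [h2, hLP _ hsum, h1, map_add, hLf]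
    ring
  have hw : w.1 ∉ Submodule.span ℝ (range fun i => (e i).1) := by
    intro hw
    apply hu
    have h1 : u = w.1 + ∑ i, (ℓ (u, f)).1 i • (e i).1 := by
      simp [w, Prod.fst_sum]
    rw [h1]
    exact Submodule.add_mem _ hw (Submodule.sum_mem _ fun i _ =>
      Submodule.smul_mem _ _ (Submodule.subset_span ⟨i, rfl⟩))
  have h5 : LinearIndependent ℝ (Fin.cons w.1 (fun i => (e i).1) : Fin 5 → E6) :=
    linearIndependent_finCons.2 ⟨hb, hw⟩
  have key : ∀ c₀ c₁ c₂ c₃ c₄ : ℝ,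
      c₀ • w.1 + c₁ • a.1 + c₂ • b.1 + c₃ • c.1 + c₄ • d.1 = 0 →
      c₀ = 0 ∧ c₁ = 0 ∧ c₂ = 0 ∧ c₃ = 0 ∧ c₄ = 0 := by
    intro c₀ c₁ c₂ c₃ c₄ h0
    have h1 := Fintype.linearIndependent_iff.1 h5 ![c₀, c₁, c₂, c₃, c₄] (by
      rw [Fin.sum_univ_five]
      exact h0)
    exact ⟨h1 0, h1 1, h1 2, h1 3, h1 4⟩
  refine ⟨ℓ, (ℓ w).2, by rw [hℓ], fun t ht => ?_⟩
  rw [slopeVector_update ℓ hℓw, hℓ]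
  have hLt : φ (Function.update e 3 (e 3 + t • w)) = 0 := by
    rw [← hL, map_add, map_smul, hLw, hLP _ (hm 3), smul_zero, add_zero]
  rw [hup] at hLt ⊢
  have hbt : LinearIndependent ℝ fun i => (![a, b, c, e 3 + t • w] i).1 := by
    rw [Fintype.linearIndependent_iff]
    intro g hg
    rw [Fin.sum_univ_four] at hg
    have h1 := key (g 3 * t) (g 0) (g 1) (g 2) (g 3) (by
      rw [← hg]
      simp [he]
      module)
    intro i
    fin_cases i
    exacts [h1.2.1, h1.2.2.1, h1.2.2.2.1, h1.2.2.2.2]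
  have hlit : LinearIndependent ℝ ![a, b, c, e 3 + t • w] :=
    LinearIndependent.of_comp (LinearMap.fst ℝ E6 Fib) hbt
  have hTt := (transverseN_span_iff hlit).2 hbt
  refine ⟨?_, hTt, h.finrank_polarN_four hTt ?_ (x := c) (Submodule.subset_span ⟨2, rfl⟩) ?_⟩
  · rw [vanishOn_span_iff]
    intro s hs
    rw [strictMono_fin_eq_id hs]
    exact hLt
  · rw [finrank_span_eq_card hlit, Fintype.card_fin]
  -- The new plane still contains `c`, but no vector over i ζ(c) = ζ(d): independence of the base
  -- components of w, a, b, c, d forces such a vector to involve d + t w with coefficient 1, hence t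
  -- = 0.
  · intro x' hx' hx
    rw [← hcd] at hx
    obtain ⟨g, rfl⟩ := (Submodule.mem_span_range_iff_exists_fun ℝ).1 hx'
    have h1 : (∑ i, g i • ![a, b, c, e 3 + t • w] i).1 = d.1 := ζ.injective hx
    rw [Fin.sum_univ_four] at h1
    have h2 := key (g 3 * t) (g 0) (g 1) (g 2) (g 3 - 1) (by
      rw [← sub_eq_zero.2 h1]
      simp [he]
      module)
    have h3 : g 3 = 1 := by linarith [h2.2.2.2.2]
    rw [h3, one_mul] at h2
    exact ht h2.1

variable {M : Type*} [TopologicalSpace M] [ChartedSpace E6 M] [IsManifold 𝓘(ℝ, E6) ∞ M]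

/-- A plane with non-complex base image already belongs to the set; a complex one is the limit of
its deformations as t tends to 0. -/
theorem dense_generalGr : Dense ((↑) ⁻¹' generalGr M : Set (VJ M 4)) := by
  rintro ⟨E, hE⟩
  rw [closure_subtype]
  obtain ⟨z, P, hP, rfl⟩ := exists_eq_grOf E
  obtain ⟨hv, hT⟩ := (grOf_mem_VJ_iff z _ hP).1 hE
  obtain ⟨ζ, K, h⟩ := exists_isModel_omega z (mem_chart_target N z)
  by_cases hC : ∀ x ∈ P, ∃ x' ∈ P, ζ x'.1 = Complex.I • ζ x.1
  · obtain ⟨ℓ, r, h0, ht⟩ := exists_deformation h hT hP hv hC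
    let f : ℝ → EDS.Gr N (J M) 4 := fun t => EDS.graphPlane z ℓ
      (⟨chartAt N z z, mem_chart_target N z⟩, Function.update 0 3 (t • r))
    have hf : Continuous f := by
      refine (continuous_graphPlane z ℓ).comp (continuous_const.prodMk ?_)
      exact continuous_const.update 3 (continuous_id.smul continuous_const)
    have hf0 : f 0 = grOf z (mem_chart_target N z) hP := by
      refine graphPlane_eq_grOf z ℓ _ ?_ hP
      rw [zero_smul, ← h0]
      congr 2
      simp
    have hlim : Tendsto f (𝓝[≠] 0) (𝓝 (grOf z (mem_chart_target N z) hP)) := by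
      rw [← hf0]
      exact hf.continuousAt.tendsto.mono_left nhdsWithin_le_nhds
    refine mem_closure_of_tendsto hlim ?_
    filter_upwards [self_mem_nhdsWithin] with t htne
    obtain ⟨h1, h2, h3⟩ := ht t htne
    have e1 : f t = grOf z (mem_chart_target N z) (finrank_span_slopeVector ℓ _) :=
      graphPlane_eq_grOf z ℓ _ rfl _
    have hV : f t ∈ VJ M 4 := by
      rw [e1]
      exact (grOf_mem_VJ_iff z _ _).2 ⟨h1, h2⟩
    refine ⟨⟨f t, hV⟩, ?_, rfl⟩
    change f t ∈ generalGr M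
    rw [e1]
    exact (grOf_mem_generalGr_iff z _ _).2 h3
  · push Not at hC
    obtain ⟨x, hx, hx'⟩ := hC
    refine subset_closure ⟨⟨_, hE⟩, ?_, rfl⟩
    exact (grOf_mem_generalGr_iff z (mem_chart_target N z) hP).2 (h.finrank_polarN_four hT hP hx hx')

end Density

end SLBundle

namespace EDS

/-! ### Recovering a form from its products with 1-forms. -/

section Chains

variable {V : Type*} [AddCommGroup V] [Module ℝ V] [TopologicalSpace V]

/-- The product `α ∧ β₁ ∧ … ∧ βₖ` with 1-forms `βᵢ`. -/
def chain {a : ℕ} (α : V [⋀^Fin a]→L[ℝ] ℝ) :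
    (k : ℕ) → (Fin k → V [⋀^Fin 1]→L[ℝ] ℝ) → V [⋀^Fin (a + k)]→L[ℝ] ℝ
  | 0, _ => α
  | k + 1, β => wedge (a := a + k) (b := 1) (chain α k fun i => β i.castSucc) (β (Fin.last k))

theorem chain_eq_zero {a : ℕ} (α : V [⋀^Fin a]→L[ℝ] ℝ) (k : ℕ)
    (β : Fin k → V [⋀^Fin 1]→L[ℝ] ℝ) {n : ℕ} (u : Fin n → V) (h : ∀ t : Fin a → Fin n, α (u ∘ t) = 0)
    (t : Fin (a + k) → Fin n) : chain α k β (u ∘ t) = 0 := by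
  induction k with
  | zero => exact h t
  | succ k ih =>
    change wedge (a := a + k) (b := 1) _ _ _ = 0
    rw [wedge_apply, Finset.sum_eq_zero, mul_zero]
    intro σ _
    have h1 := ih (fun i => β i.castSucc) fun i => t (σ (Fin.castAdd 1 i))
    rw [show (fun i => (u ∘ t) (σ (Fin.castAdd 1 i))) = u ∘ fun i => t (σ (Fin.castAdd 1 i)) from rfl,
      h1]
    ring

/-- Each β_j detects only the vector with index a + j, so the factors can be stripped off one at a
time, from the last, by `eq_zero_of_wedge_eq_zero`. -/
theorem eq_zero_of_chain_eq_zero {a : ℕ} (α : V [⋀^Fin a]→L[ℝ] ℝ) (k : ℕ)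
    (β : Fin k → V [⋀^Fin 1]→L[ℝ] ℝ) (u : Fin (a + k) → V)
    (h0 : ∀ j i, i ≠ Fin.natAdd a j → β j (fun _ => u i) = 0)
    (h1 : ∀ j, β j (fun _ => u (Fin.natAdd a j)) ≠ 0) (h : chain α k β u = 0) :
    α (fun i => u (Fin.castAdd k i)) = 0 := by
  induction k with
  | zero => exact h
  | succ k ih =>
    have h2 := eq_zero_of_wedge_eq_zero (chain α k fun i => β i.castSucc) (β (Fin.last k)) u
      (fun i => h0 (Fin.last k) i.castSucc (fun h => by
        have := congrArg Fin.val h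
        simp at this
        omega)) (h1 (Fin.last k)) h
    refine ih (fun i => β i.castSucc) (fun i => u i.castSucc) (fun j i hij => ?_) (fun j => ?_) h2
    · refine h0 j.castSucc i.castSucc fun h => hij ?_
      apply Fin.ext
      have := congrArg Fin.val h
      simpa using this
    · exact h1 j.castSucc

/-- The forms `α ∧ β_{w 1} ∧ … ∧ β_{w k}` determine `α` on a space of dimension `a + k`, if
the 1-forms `βᵢ` are a dual basis. -/
theorem eq_zero_of_forall_chain_eq_zero {a k : ℕ} (α : V [⋀^Fin a]→L[ℝ] ℝ)
    (β : Fin (a + k) → V [⋀^Fin 1]→L[ℝ] ℝ) (u : Fin (a + k) → V)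
    (hβ : ∀ i j, β i (fun _ => u j) = if j = i then 1 else 0)
    (h : ∀ w : Fin k → Fin (a + k), chain α k (fun j => β (w j)) u = 0)
    (t : Fin a → Fin (a + k)) : α (u ∘ t) = 0 := by
  by_cases ht : Function.Injective t
  -- The injection `t` is extended to a permutation of all the indices. The indices that `t` misses
  -- select the 1-forms by which α has to be multiplied.
  · let e : {x // x ∈ range (Fin.castAdd k : Fin a → Fin (a + k))} ≃ {x // x ∈ range t} :=
      (Equiv.ofInjective _ (Fin.castAdd_injective a k)).symm.trans (Equiv.ofInjective t ht)
    let σ : Equiv.Perm (Fin (a + k)) := e.extendSubtype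
    have hσ : ∀ i, σ (Fin.castAdd k i) = t i := by
      intro i
      have h1 := Equiv.extendSubtype_apply_of_mem e (Fin.castAdd k i) ⟨i, rfl⟩
      refine h1.trans ?_
      have h2 : (Equiv.ofInjective _ (Fin.castAdd_injective a k)).symm
          ⟨Fin.castAdd k i, ⟨i, rfl⟩⟩ = i := by
        rw [Equiv.symm_apply_eq]
        rfl
      change ((Equiv.ofInjective t ht) ((Equiv.ofInjective _ (Fin.castAdd_injective a k)).symm
          ⟨Fin.castAdd k i, ⟨i, rfl⟩⟩) : Fin (a + k)) = t i
      rw [h2]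
      rfl
    have h3 : chain α k (fun j => β (σ (Fin.natAdd a j))) (u ∘ σ) = 0 := by
      have h4 := (chain α k fun j => β (σ (Fin.natAdd a j))).toAlternatingMap.map_perm u σ
      refine h4.trans ?_
      have h5 : (chain α k fun j => β (σ (Fin.natAdd a j))).toAlternatingMap u = 0 := h _
      rw [h5, smul_zero]
    have h6 := eq_zero_of_chain_eq_zero α k (fun j => β (σ (Fin.natAdd a j))) (u ∘ σ)
      (fun j i hij => by
        refine (hβ _ _).trans (if_neg fun h => hij (σ.injective h)))
      (fun j => by
        refine ne_of_eq_of_ne ((hβ _ _).trans (if_pos rfl)) one_ne_zero) h3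
    rw [← h6]
    congr 1
    funext i
    exact congrArg u (hσ i).symm
  · exact α.toAlternatingMap.map_eq_zero_of_not_injective _
      fun h' => ht (Function.Injective.of_comp h')

end Chains

/-! ### Smoothness of coefficients, and products in the ideal. -/

section SmoothCoefficients

variable {E : Type*} [NormedAddCommGroup E] [NormedSpace ℝ E]
  {X : Type*} [TopologicalSpace X] [ChartedSpace E X]

/-- The coefficients of the form in the chart at `x₀` are smooth, jointly in the point and the
arguments. -/
def SmoothCoeff {q : ℕ} (θ : DForm E X q ℝ) (x₀ : X) : Prop :=
  ContDiffOn ℝ ∞ (fun g : E × (Fin q → E) => inChart θ x₀ g.1 g.2)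
    ((chartAt E x₀).target ×ˢ univ)

theorem SmoothCoeff.wedge {a b : ℕ} {α : DForm E X a ℝ} {β : DForm E X b ℝ} {x₀ : X}
    (hα : SmoothCoeff α x₀) (hβ : SmoothCoeff β x₀) :
    SmoothCoeff (fun x => wedge (α x) (β x)) x₀ := by
  unfold SmoothCoeff
  simp only [inChart_wedge, wedge_apply]
  have hcomp : ∀ {n c : ℕ} (r : Fin c → Fin n),
      ContDiff ℝ ∞ fun g : E × (Fin n → E) => (g.1, fun i => g.2 (r i)) := fun r =>
    contDiff_fst.prodMk (contDiff_pi.2 fun i => (contDiff_apply ℝ E (r i)).comp contDiff_snd)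
  refine contDiffOn_const.mul (ContDiffOn.sum fun σ _ => contDiffOn_const.mul (ContDiffOn.mul ?_ ?_))
  · exact ContDiffOn.comp hα (hcomp fun i => σ (Fin.castAdd b i)).contDiffOn
      fun g hg => ⟨hg.1, trivial⟩
  · exact ContDiffOn.comp hβ (hcomp fun i => σ (Fin.natAdd a i)).contDiffOn
      fun g hg => ⟨hg.1, trivial⟩

theorem SmoothCoeff.contDiffOn_hat {p : ℕ} {θ : DForm E X p ℝ} {x₀ : X} (h : SmoothCoeff θ x₀)
    (ℓ : Coord E p) : ContDiffOn ℝ ∞ (hat x₀ ℓ θ) ((chartAt E x₀).target ×ˢ univ) := by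
  have hs : ContDiff ℝ ∞ fun w : E × (Fin p → Fin (Module.finrank ℝ E - p) → ℝ) =>
      (w.1, slopeVector ℓ w.2) := by
    refine contDiff_fst.prodMk (contDiff_pi.2 fun i => ?_)
    exact ℓ.symm.contDiff.comp (contDiff_const.prodMk
      ((contDiff_apply ℝ (Fin (Module.finrank ℝ E - p) → ℝ) i).comp contDiff_snd))
  exact ContDiffOn.comp h hs.contDiffOn fun w hw => ⟨hw.1, trivial⟩

/-- The product `ψ ∧ β₁ ∧ … ∧ βₖ` of differential forms. -/
def chainForm {a : ℕ} (ψ : DForm E X a ℝ) (k : ℕ) (β : Fin k → DForm E X 1 ℝ) :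
    DForm E X (a + k) ℝ := fun x => chain (ψ x) k fun i => β i x

theorem inChart_chainForm {a : ℕ} (ψ : DForm E X a ℝ) (k : ℕ) (β : Fin k → DForm E X 1 ℝ) (x₀ : X)
    (y : E) : inChart (chainForm ψ k β) x₀ y =
      chain (inChart ψ x₀ y) k fun i => inChart (β i) x₀ y := by
  induction k with
  | zero => rfl
  | succ k ih =>
    change inChart (fun x => wedge (chainForm ψ k (fun i => β i.castSucc) x) (β (Fin.last k) x)) x₀ y
      = wedge _ _
    rw [inChart_wedge, ih]

theorem SmoothCoeff.chainForm {a : ℕ} {ψ : DForm E X a ℝ} {x₀ : X} (hψ : SmoothCoeff ψ x₀) {k : ℕ}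
    {β : Fin k → DForm E X 1 ℝ} (hβ : ∀ i, SmoothCoeff (β i) x₀) :
    SmoothCoeff (chainForm ψ k β) x₀ := by
  induction k with
  | zero => exact hψ
  | succ k ih => exact (ih fun i => hβ i.castSucc).wedge (hβ (Fin.last k))

theorem chainForm_mem_ideal {G : ∀ q : ℕ, Set (DForm E X q ℝ)} {a : ℕ} {ψ : DForm E X a ℝ}
    (hψ : ψ ∈ ideal G a) {k : ℕ} {β : Fin k → DForm E X 1 ℝ} (hβ : ∀ i, IsSmoothForm (β i)) :
    chainForm ψ k β ∈ ideal G (a + k) := by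
  induction k with
  | zero => exact hψ
  | succ k ih => exact InIdeal.wedge_right _ _ (ih fun i => hβ i.castSucc) (hβ (Fin.last k))

end SmoothCoefficients

end EDS

namespace SLBundle

/-! ### Globally smooth 1-forms pulled back from M. -/

section BasicForms

variable {M : Type*} [TopologicalSpace M] [ChartedSpace E6 M] [IsManifold 𝓘(ℝ, E6) ∞ M]

/-- The 1-form `d(g ∘ π̄)` on `J`, for a function `g` on `M`. -/
def dBase (g : M → ℝ) : EDS.DForm N (J M) 1 ℝ := fun z =>
  ContinuousAlternatingMap.ofSubsingleton ℝ (TangentSpace 𝓘(ℝ, N) z) ℝ (0 : Fin 1)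
    (mfderiv 𝓘(ℝ, N) 𝓘(ℝ, ℝ) (g ∘ J.base) z : TangentSpace 𝓘(ℝ, N) z →L[ℝ] ℝ)

theorem inChart_dBase {g : M → ℝ} (hg : ContMDiff 𝓘(ℝ, E6) 𝓘(ℝ, ℝ) ∞ g) (z : J M) {y : N}
    (hy : y ∈ (chartAt N z).target) (v : Fin 1 → N) : EDS.inChart (dBase g) z y v =
      fderiv ℝ (g ∘ (chartAt E6 z.base).symm) y.1 (v 0).1 := by
  have := EDS.isManifold_one (E := E6) (X := M)
  have hg1 : MDifferentiable 𝓘(ℝ, E6) 𝓘(ℝ, ℝ) g := hg.mdifferentiable (by simp)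
  have h3 : MDifferentiableAt 𝓘(ℝ, E6) 𝓘(ℝ, E6) (chartAt E6 z.base).symm y.1 :=
    mdifferentiableAt_atlas_symm (I := 𝓘(ℝ, E6)) (chart_mem_atlas E6 z.base) hy.1
  have e1 := mfderiv_comp ((chartAt N z).symm y) (hg1 _)
    (mdifferentiableAt_base ((chartAt N z).symm y))
  have e2 := mfderiv_comp y.1 (hg1 _) h3
  rw [mfderiv_eq_fderiv] at e2
  have e3 : mfderiv 𝓘(ℝ, N) 𝓘(ℝ, ℝ) (g ∘ J.base) ((chartAt N z).symm y) (EDS.chartD z y (v 0)) =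
      mfderiv 𝓘(ℝ, E6) 𝓘(ℝ, ℝ) g ((chartAt N z).symm y).base
        (mfderiv 𝓘(ℝ, N) 𝓘(ℝ, E6) (J.base (M := M)) ((chartAt N z).symm y)
          (EDS.chartD z y (v 0))) :=
    congrArg (fun L : TangentSpace 𝓘(ℝ, N) ((chartAt N z).symm y) →L[ℝ] ℝ =>
      L (EDS.chartD z y (v 0))) e1
  refine e3.trans ?_
  have e4 : fderiv ℝ (g ∘ (chartAt E6 z.base).symm) y.1 (v 0).1 =
      mfderiv 𝓘(ℝ, E6) 𝓘(ℝ, ℝ) g ((chartAt E6 z.base).symm y.1)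
        (EDS.chartD z.base y.1 (v 0).1) :=
    congrArg (fun L : E6 →L[ℝ] ℝ => L (v 0).1) e2
  rw [e4]
  exact congrArg (mfderiv 𝓘(ℝ, E6) 𝓘(ℝ, ℝ) g ((chartAt E6 z.base).symm y.1))
    (mfderiv_base_chartD z hy (v 0))

theorem contDiffOn_comp_chart {g : M → ℝ} (hg : ContMDiff 𝓘(ℝ, E6) 𝓘(ℝ, ℝ) ∞ g) (x₀ : M) :
    ContDiffOn ℝ ∞ (g ∘ (chartAt E6 x₀).symm) (chartAt E6 x₀).target := by
  rw [← contMDiffOn_iff_contDiffOn]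
  exact hg.comp_contMDiffOn (contMDiffOn_chart_symm (I := 𝓘(ℝ, E6)) (x := x₀))

theorem contDiffOn_fderiv_comp_chart {g : M → ℝ} (hg : ContMDiff 𝓘(ℝ, E6) 𝓘(ℝ, ℝ) ∞ g) (z : J M) :
    ContDiffOn ℝ ∞ (fun y : N => fderiv ℝ (g ∘ (chartAt E6 z.base).symm) y.1)
      (chartAt N z).target := by
  have h := (contDiffOn_comp_chart hg z.base).fderiv_of_isOpen (m := ∞)
    (chartAt E6 z.base).open_target (by simp)
  exact h.comp contDiff_fst.contDiffOn fun y hy => hy.1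

/-- The ideal admits only multipliers that are smooth on all of `J`. Differentials of global
functions on M qualify, whereas coordinate differentials exist only locally. -/
theorem isSmoothForm_dBase {g : M → ℝ} (hg : ContMDiff 𝓘(ℝ, E6) 𝓘(ℝ, ℝ) ∞ g) :
    EDS.IsSmoothForm (dBase g) := by
  intro z
  have h : ContDiffOn ℝ ∞ (fun y : N => ContinuousAlternatingMap.ofSubsingletonLIE (𝕜 := ℝ) (E := N) (F := ℝ) (0 : Fin 1)
      ((fderiv ℝ (g ∘ (chartAt E6 z.base).symm) y.1).comp (ContinuousLinearMap.fst ℝ E6 Fib)))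
      (chartAt N z).target :=
    (ContinuousAlternatingMap.ofSubsingletonLIE (𝕜 := ℝ) (E := N) (F := ℝ) (0 : Fin 1)).contDiff.comp_contDiffOn
      ((contDiffOn_fderiv_comp_chart hg z).clm_comp contDiffOn_const)
  refine h.congr fun y hy => ?_
  ext v
  exact inChart_dBase hg z hy v

theorem smoothCoeff_dBase {g : M → ℝ} (hg : ContMDiff 𝓘(ℝ, E6) 𝓘(ℝ, ℝ) ∞ g) (z : J M) :
    EDS.SmoothCoeff (dBase g) z := by
  have h : ContDiffOn ℝ ∞ (fun q : N × (Fin 1 → N) =>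
      fderiv ℝ (g ∘ (chartAt E6 z.base).symm) q.1.1 (q.2 0).1) ((chartAt N z).target ×ˢ univ) :=
    ((contDiffOn_fderiv_comp_chart hg z).comp contDiff_fst.contDiffOn fun q hq => hq.1).clm_apply
      (contDiff_fst.comp ((contDiff_apply ℝ N 0).comp contDiff_snd)).contDiffOn
  exact h.congr fun q hq => inChart_dBase hg z hq.1 q.2

/-- A smooth function on `M` with a given differential at a point. -/
theorem exists_contMDiff_fderiv_eq [T2Space M] (x₀ : M) (l : E6 →L[ℝ] ℝ) :
    ∃ g : M → ℝ, ContMDiff 𝓘(ℝ, E6) 𝓘(ℝ, ℝ) ∞ g ∧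
      fderiv ℝ (g ∘ (chartAt E6 x₀).symm) (chartAt E6 x₀ x₀) = l := by
  obtain ⟨f⟩ : Nonempty (SmoothBumpFunction 𝓘(ℝ, E6) x₀) := inferInstance
  -- A linear function of the chart is cut off by a bump function that equals 1 near the point, so
  -- the differential there is still `l`.
  refine ⟨fun x => f x • l (chartAt E6 x₀ x), f.contMDiff_smul ?_, ?_⟩
  · exact l.contDiff.contMDiff.comp_contMDiffOn (contMDiffOn_chart (I := 𝓘(ℝ, E6)) (x := x₀))
  · have h1 : Tendsto (chartAt E6 x₀).symm (𝓝 (chartAt E6 x₀ x₀)) (𝓝 x₀) := by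
      have := (chartAt E6 x₀).continuousAt_symm (mem_chart_target E6 x₀)
      rwa [ContinuousAt, (chartAt E6 x₀).left_inv (mem_chart_source E6 x₀)] at this
    have h2 : ((fun x => f x • l (chartAt E6 x₀ x)) ∘ (chartAt E6 x₀).symm)
        =ᶠ[𝓝 (chartAt E6 x₀ x₀)] l := by
      filter_upwards [h1.eventually f.eventuallyEq_one,
        (chartAt E6 x₀).open_target.mem_nhds (mem_chart_target E6 x₀)] with y hy hy'
      simp only [Function.comp_apply, hy, (chartAt E6 x₀).right_inv hy']
      simp
    rw [h2.fderiv_eq, l.fderiv]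

theorem smoothCoeff_re (z : J M) : EDS.SmoothCoeff
    (fun z : J M => Complex.reCLM.compContinuousAlternatingMap (EDS.extD gamma z)) z :=
  Complex.reCLM.contDiff.comp_contDiffOn (contDiffOn_omega z)

theorem smoothCoeff_im (z : J M) : EDS.SmoothCoeff
    (fun z : J M => Complex.imCLM.compContinuousAlternatingMap (EDS.extD gamma z)) z :=
  Complex.imCLM.contDiff.comp_contDiffOn (contDiffOn_omega z)

end BasicForms

/-! ### Linearity of the equations in the fibre components. -/

section FibreLinear

/-- A form on `N` that is linear in the fibre components of its arguments. -/
def FibreLinear {q : ℕ} (α : N [⋀^Fin q]→L[ℝ] ℝ) : Prop :=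
  ∀ b : Fin q → E6, ∃ L : (Fin q → Fib) →ₗ[ℝ] ℝ, ∀ δ, α (fun i => (b i, δ i)) = L δ

/-- Multiplication by a 1-form that sees only base components contributes factors that are constant
once the base components are fixed. -/
theorem FibreLinear.wedge {a : ℕ} {α : N [⋀^Fin a]→L[ℝ] ℝ} (hα : FibreLinear α)
    {β : N [⋀^Fin 1]→L[ℝ] ℝ} {l : E6 →L[ℝ] ℝ} (hβ : ∀ v, β v = l (v 0).1) :
    FibreLinear (EDS.wedge α β) := by
  intro b
  choose L hL using hα
  refine ⟨((a.factorial * (1 : ℕ).factorial : ℕ) : ℝ)⁻¹ • ∑ σ : Equiv.Perm (Fin (a + 1)),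
    (((Equiv.Perm.sign σ : ℤ) : ℝ) * l (b (σ (Fin.natAdd a 0)))) •
      (L (fun i => b (σ (Fin.castAdd 1 i)))) ∘ₗ
        (LinearMap.funLeft ℝ Fib fun i => σ (Fin.castAdd 1 i)), fun δ => ?_⟩
  rw [EDS.wedge_apply, LinearMap.smul_apply, LinearMap.sum_apply, smul_eq_mul]
  congr 1
  refine Finset.sum_congr rfl fun σ _ => ?_
  rw [hL (fun i => b (σ (Fin.castAdd 1 i))) (fun i => δ (σ (Fin.castAdd 1 i))), hβ,
    LinearMap.smul_apply, LinearMap.comp_apply, smul_eq_mul, mul_assoc, mul_comm (L _ _)]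
  rfl

theorem FibreLinear.chain {a : ℕ} {α : N [⋀^Fin a]→L[ℝ] ℝ} (hα : FibreLinear α) {k : ℕ}
    {β : Fin k → N [⋀^Fin 1]→L[ℝ] ℝ} {l : Fin k → E6 →L[ℝ] ℝ} (hβ : ∀ i v, β i v = l i (v 0).1) :
    FibreLinear (EDS.chain α k β) := by
  induction k with
  | zero => exact hα
  | succ k ih => exact (ih fun i => hβ i.castSucc).wedge (hβ (Fin.last k))

/-- The values of `φ` on the vectors with base components `bᵢ`, as a function of their fibre
components. -/
def modelMap (ζ : E6 ≃L[ℝ] C3) (K : Fib →ₗ[ℝ] ((Fin 3 → C3) → ℂ)) {p : ℕ} (b : Fin p → E6) :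
    (Fin p → Fib) →ₗ[ℝ] ((Fin 4 → Fin p) → ℂ) where
  toFun δ t := ∑ i : Fin 4, (-1 : ℂ) ^ (i : ℕ) *
    K (δ (t i)) (fun j => ζ (b (t (i.succAbove j))))
  map_add' δ δ' := by
    funext t
    simp only [Pi.add_apply, map_add, mul_add, Finset.sum_add_distrib]
  map_smul' c δ := by
    funext t
    simp only [Pi.smul_apply, map_smul, Finset.smul_sum, RingHom.id_apply, mul_smul_comm]

variable {φ : N [⋀^Fin 4]→L[ℝ] ℂ} {ζ : E6 ≃L[ℝ] C3} {K : Fib →ₗ[ℝ] ((Fin 3 → C3) → ℂ)}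

theorem IsModel.apply_eq_modelMap (h : IsModel φ ζ K) {p : ℕ} (v : Fin p → N)
    (t : Fin 4 → Fin p) :
    φ (v ∘ t) = modelMap ζ K (fun i => (v i).1) (fun i => (v i).2) t :=
  h.formula _

theorem IsModel.fibreLinear (h : IsModel φ ζ K) (L : ℂ →L[ℝ] ℝ) :
    FibreLinear (L.compContinuousAlternatingMap φ) := by
  intro b
  refine ⟨L.toLinearMap ∘ₗ LinearMap.proj (R := ℝ) (φ := fun _ : Fin 4 → Fin 4 => ℂ) id ∘ₗ
    modelMap ζ K b, fun δ => ?_⟩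
  exact congrArg L (h.apply_eq_modelMap (fun i => (b i, δ i)) id)

theorem IsModel.vanishOn_iff_modelMap (h : IsModel φ ζ K) {p : ℕ} (e : Fin p → N) :
    VanishOn φ (Submodule.span ℝ (range e)) ↔
      modelMap ζ K (fun i => (e i).1) (fun i => (e i).2) = 0 := by
  constructor
  · intro hv
    funext t
    rw [← h.apply_eq_modelMap]
    exact hv _ fun i => Submodule.subset_span ⟨t i, rfl⟩
  · intro h0
    rw [vanishOn_span_iff]
    intro s _
    rw [h.apply_eq_modelMap, h0]
    rfl

end FibreLinear

/-! ### Selecting independent equations that keep cutting out the same kernel. -/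

section IndependentEquations

/-- If finitely many functionals cut out the kernel of `D` at a point `w₀`, then independent ones
among them cut out the kernel of `D` wherever they remain independent and the rank of `D` is not
larger than at `w₀`. -/
theorem exists_linearIndependent_functionals {Δ F W ι : Type*} [AddCommGroup Δ] [Module ℝ Δ]
    [FiniteDimensional ℝ Δ] [AddCommGroup F] [Module ℝ F] [Finite ι] (m : ι → W → Module.Dual ℝ Δ)
    (D : W → Δ →ₗ[ℝ] F) (w₀ : W)
    (hm : ∀ a w δ, D w δ = 0 → m a w δ = 0) (hm₀ : ∀ δ, (∀ a, m a w₀ δ = 0) → D w₀ δ = 0) :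
    ∃ (q : ℕ) (a : Fin q → ι), LinearIndependent ℝ (fun j => m (a j) w₀) ∧
      ∀ w, Module.finrank ℝ (LinearMap.range (D w)) ≤ Module.finrank ℝ (LinearMap.range (D w₀)) →
        LinearIndependent ℝ (fun j => m (a j) w) → ∀ δ, (∀ j, m (a j) w δ = 0) → D w δ = 0 := by
  obtain ⟨κ, a, ha, hspan, hli⟩ := exists_linearIndependent' ℝ fun i => m i w₀
  have : Finite κ := Finite.of_injective a ha
  have : Fintype κ := Fintype.ofFinite κ
  let e := (Fintype.equivFin κ).symm
  have hcount : ∀ w, LinearIndependent ℝ (fun j => m (a (e j)) w) →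
      Fintype.card κ + Module.finrank ℝ
        (Submodule.dualCoannihilator (Submodule.span ℝ (range fun j => m (a (e j)) w))) =
        Module.finrank ℝ Δ := by
    intro w hw
    rw [← Subspace.finrank_add_finrank_dualCoannihilator_eq
      (Submodule.span ℝ (range fun j => m (a (e j)) w)), finrank_span_eq_card hw, Fintype.card_fin]
  have hle : ∀ w, LinearMap.ker (D w) ≤
      Submodule.dualCoannihilator (Submodule.span ℝ (range fun j => m (a (e j)) w)) := by
    intro w δ hδ
    rw [Submodule.mem_dualCoannihilator]
    intro l hl
    refine Submodule.span_induction (p := fun l _ => l δ = 0) ?_ rfl ?_ ?_ hl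
    · rintro _ ⟨j, rfl⟩
      exact hm _ w δ hδ
    · intro l l' _ _ h h'
      rw [LinearMap.add_apply, h, h', add_zero]
    · intro c l _ h
      rw [LinearMap.smul_apply, h, smul_zero]
  have hli₀ : LinearIndependent ℝ (fun j => m (a (e j)) w₀) := hli.comp e e.injective
  have hspan₀ : Submodule.span ℝ (range fun j => m (a (e j)) w₀) =
      Submodule.span ℝ (range fun i => m i w₀) := by
    rw [← hspan]
    congr 1
    exact e.surjective.range_comp ((fun i => m i w₀) ∘ a)
  -- At `w₀` the selected functionals span the same space as all of them, so their common kernel is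
  -- inside that of `D w₀`; there are therefore at least as many of them as the rank of `D w₀`.
  have hrank₀ : Module.finrank ℝ (LinearMap.range (D w₀)) ≤ Fintype.card κ := by
    have h1 : Submodule.dualCoannihilator (Submodule.span ℝ (range fun j => m (a (e j)) w₀)) ≤
        LinearMap.ker (D w₀) := by
      rw [hspan₀]
      intro δ hδ
      rw [Submodule.mem_dualCoannihilator] at hδ
      exact hm₀ δ fun i => hδ _ (Submodule.subset_span ⟨i, rfl⟩)
    have h2 := Submodule.finrank_mono h1
    have h3 := (D w₀).finrank_range_add_finrank_ker
    have h4 := hcount w₀ hli₀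
    omega
  refine ⟨Fintype.card κ, a ∘ e, hli₀, fun w hrank hw δ hδ => ?_⟩
  -- The kernel of `D w` lies in the common kernel of the selected functionals. As the rank of `D w`
  -- is at most their number, its dimension is not smaller, and the two agree.
  have h1 := Submodule.eq_of_le_of_finrank_le (hle w) (by
    have h3 := (D w).finrank_range_add_finrank_ker
    have h4 := hcount w hw
    omega)
  have h2 : δ ∈ LinearMap.ker (D w) := by
    rw [h1, Submodule.mem_dualCoannihilator]
    intro l hl
    refine Submodule.span_induction (p := fun l _ => l δ = 0) ?_ rfl ?_ ?_ hl
    · rintro _ ⟨j, rfl⟩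
      exact hδ j
    · intro l l' _ _ h h'
      rw [LinearMap.add_apply, h, h', add_zero]
    · intro c l _ h
      rw [LinearMap.smul_apply, h, smul_zero]
  exact h2

end IndependentEquations

end SLBundle

namespace SLBundle

/-! ### Maximality of the rank of the equations in dimensions four, five and six. -/

section Rank

theorem eq_of_eq_on_strictMono {V V' W : Type*} [AddCommGroup V] [Module ℝ V] [AddCommGroup V']
    [Module ℝ V'] [AddCommGroup W] [Module ℝ W] {n p : ℕ} (g : V [⋀^Fin n]→ₗ[ℝ] W)
    (g' : V' [⋀^Fin n]→ₗ[ℝ] W) (v : Fin p → V) (v' : Fin p → V')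
    (h : ∀ s : Fin n → Fin p, StrictMono s → g (v ∘ s) = g' (v' ∘ s)) (r : Fin n → Fin p) :
    g (v ∘ r) = g' (v' ∘ r) := by
  by_cases hr : Function.Injective r
  · have hs : StrictMono (r ∘ Tuple.sort r) :=
      (Tuple.monotone_sort r).strictMono_of_injective (hr.comp (Tuple.sort r).injective)
    have h1 := g.map_perm (v ∘ r) (Tuple.sort r)
    have h2 := g'.map_perm (v' ∘ r) (Tuple.sort r)
    have h3 : g ((v ∘ r) ∘ Tuple.sort r) = g' ((v' ∘ r) ∘ Tuple.sort r) := h _ hs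
    rw [h1, h2] at h3
    exact smul_left_cancel _ h3
  · rw [g.map_eq_zero_of_not_injective _ fun h' => hr (Function.Injective.of_comp h'),
      g'.map_eq_zero_of_not_injective _ fun h' => hr (Function.Injective.of_comp h')]

variable {φ φ₀ : N [⋀^Fin 4]→L[ℝ] ℂ} {ζ ζ₀ : E6 ≃L[ℝ] C3}
  {K K₀ : Fib →ₗ[ℝ] ((Fin 3 → C3) → ℂ)}

/-- ζ and K are not determined by φ, but the values of φ are. This permits the change to a model for
which the basis is adapted. -/
theorem IsModel.modelMap_eq (h : IsModel φ ζ K) (h₀ : IsModel φ ζ₀ K₀) {p : ℕ} (b : Fin p → E6) :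
    modelMap ζ K b = modelMap ζ₀ K₀ b := by
  refine LinearMap.ext fun δ => funext fun t => ?_
  exact (h.apply_eq_modelMap (fun i => (b i, δ i)) t).symm.trans
    (h₀.apply_eq_modelMap (fun i => (b i, δ i)) t)

theorem IsModel.modelMap_vec (h : IsModel φ ζ K) {p : ℕ} (b : Fin p → E6) (δ : Fin p → Fib)
    (i j k l : Fin p) : modelMap ζ K b δ ![i, j, k, l] =
      K (δ i) ![ζ (b j), ζ (b k), ζ (b l)] - K (δ j) ![ζ (b i), ζ (b k), ζ (b l)] +
      K (δ k) ![ζ (b i), ζ (b j), ζ (b l)] - K (δ l) ![ζ (b i), ζ (b j), ζ (b k)] := by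
  rw [← h.apply_vec (b i, δ i) (b j, δ j) (b k, δ k) (b l, δ l),
    ← h.apply_eq_modelMap (fun i => (b i, δ i))]
  congr 1
  funext a
  fin_cases a <;> rfl

/-- All values of a model map are alternating families, hence determined by their increasing
components. If these components are arbitrary at `b₀`, then the range there contains every other
range. -/
theorem IsModel.range_modelMap_le (h : IsModel φ ζ K) (h₀ : IsModel φ₀ ζ₀ K₀) {p : ℕ}
    (b b₀ : Fin p → E6) (hs : ∀ G : (Fin 4 → Fin p) → ℂ, ∃ δ, ∀ s : Fin 4 → Fin p, StrictMono s →
      modelMap ζ₀ K₀ b₀ δ s = G s) :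
    Module.finrank ℝ (LinearMap.range (modelMap ζ K b)) ≤
      Module.finrank ℝ (LinearMap.range (modelMap ζ₀ K₀ b₀)) := by
  refine Submodule.finrank_mono ?_
  rintro _ ⟨δ, rfl⟩
  obtain ⟨δ₀, hδ₀⟩ := hs (modelMap ζ K b δ)
  refine ⟨δ₀, funext fun t => ?_⟩
  refine (h₀.apply_eq_modelMap (fun i => (b₀ i, δ₀ i)) t).symm.trans (Eq.trans ?_
    (h.apply_eq_modelMap (fun i => (b i, δ i)) t))
  refine eq_of_eq_on_strictMono φ₀.toAlternatingMap φ.toAlternatingMap (fun i => (b₀ i, δ₀ i))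
    (fun i => (b i, δ i)) (fun s hs => ?_) t
  exact (h₀.apply_eq_modelMap (fun i => (b₀ i, δ₀ i)) s).trans ((hδ₀ s hs).trans
    (h.apply_eq_modelMap (fun i => (b i, δ i)) s).symm)

theorem IsModel.rank_four (h : IsModel φ ζ K) (h₀ : IsModel φ₀ ζ₀ K₀) (b : Fin 4 → E6)
    {b₀ : Fin 4 → E6} (hb₀ : LinearIndependent ℝ b₀) :
    Module.finrank ℝ (LinearMap.range (modelMap ζ K b)) ≤
      Module.finrank ℝ (LinearMap.range (modelMap ζ₀ K₀ b₀)) := by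
  refine h.range_modelMap_le h₀ b b₀ fun G => ?_
  have hli := (hb₀.map' ζ₀.toLinearEquiv.toLinearMap ζ₀.toLinearEquiv.ker).comp
    (Fin.castSucc : Fin 3 → Fin 4) (Fin.castSucc_injective 3)
  -- There is only one increasing component; the fibre vector is put in the last slot, which enters
  -- with a minus sign.
  obtain ⟨f, hf⟩ := h₀.exists_apply_eq hli (-G ![0, 1, 2, 3])
  refine ⟨![0, 0, 0, f], fun s hs => ?_⟩
  have e : s = ![0, 1, 2, 3] := by
    rw [strictMono_fin_eq_id hs]
    funext i
    fin_cases i <;> rfl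
  have hf' : K₀ f ![ζ₀ (b₀ 0), ζ₀ (b₀ 1), ζ₀ (b₀ 2)] = -G ![0, 1, 2, 3] := by
    rw [← hf]
    refine congrArg (K₀ f) (funext fun i => ?_)
    fin_cases i <;> rfl
  rw [e, h₀.modelMap_vec]
  simp [hf']

theorem strictMono_four_five {s : Fin 4 → Fin 5} (hs : StrictMono s) :
    s = ![0, 1, 2, 3] ∨ s = ![0, 1, 2, 4] ∨ s = ![0, 1, 3, 4] ∨ s = ![0, 2, 3, 4] ∨
      s = ![1, 2, 3, 4] := by
  have key : ∀ a b c d : Fin 5, a < b → b < c → c < d →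
      (a = 0 ∧ b = 1 ∧ c = 2 ∧ d = 3) ∨ (a = 0 ∧ b = 1 ∧ c = 2 ∧ d = 4) ∨
      (a = 0 ∧ b = 1 ∧ c = 3 ∧ d = 4) ∨ (a = 0 ∧ b = 2 ∧ c = 3 ∧ d = 4) ∨
      (a = 1 ∧ b = 2 ∧ c = 3 ∧ d = 4) := by
    intro a b c d
    omega
  have e : s = ![s 0, s 1, s 2, s 3] := by
    funext i
    fin_cases i <;> rfl
  rcases key (s 0) (s 1) (s 2) (s 3) (hs (by decide)) (hs (by decide)) (hs (by decide)) with
    h | h | h | h | h <;> rw [h.1, h.2.1, h.2.2.1, h.2.2.2] at e <;> simp [e]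

theorem IsModel.rank_five (h : IsModel φ ζ K) (h₀ : IsModel φ₀ ζ₀ K₀) (b : Fin 5 → E6)
    {b₀ : Fin 5 → E6} {w₁ w₂ w₃ : C3} (hw : upsilon0 ![w₁, w₂, w₃] ≠ 0)
    (e0 : ζ₀ (b₀ 0) = w₁) (e1 : ζ₀ (b₀ 1) = w₂) (e2 : ζ₀ (b₀ 2) = Complex.I • w₂)
    (e3 : ζ₀ (b₀ 3) = w₃) (e4 : ζ₀ (b₀ 4) = Complex.I • w₃) :
    Module.finrank ℝ (LinearMap.range (modelMap ζ K b)) ≤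
      Module.finrank ℝ (LinearMap.range (modelMap ζ₀ K₀ b₀)) := by
  refine h.range_modelMap_le h₀ b b₀ fun G => ?_
  -- Two fibre vectors, in the slots 3 and 4, produce the five increasing components. On (w₁, iw₂,
  -- iw₃), which is not a free component, the type relation gives the value c₂ + i c₃ + i c₄ of the
  -- prescribed constants; c₃ is chosen to make this equal to `G ![0, 2, 3, 4]`.
  obtain ⟨f, f1, f2, f3, f4, -, f6, -⟩ := h₀.exists_apply_eq_five hw (-G ![0, 1, 2, 3]) 0
    (-Complex.I * G ![0, 2, 3, 4] - G ![0, 1, 3, 4]) (G ![0, 1, 3, 4]) 0 0 0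
  obtain ⟨f', g1, g2, g3, -, -, g6, -⟩ := h₀.exists_apply_eq_five hw (-G ![0, 1, 2, 4]) 0 0 0 0
    (-G ![1, 2, 3, 4]) 0
  have r1 := h₀.type_rel f w₁ w₂ w₃
  have r2 := h₀.type_rel' f w₂ w₃
  rw [f2, f3, f4] at r1
  rw [f6, zero_add] at r2
  have r2' := (mul_eq_zero.1 r2).resolve_left Complex.I_ne_zero
  refine ⟨![0, 0, 0, f, f'], fun s hs => ?_⟩
  rcases strictMono_four_five hs with rfl | rfl | rfl | rfl | rfl <;> rw [h₀.modelMap_vec] <;>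
    simp only [e0, e1, e2, e3, e4] <;> simp [f1, f4, g1, g2, g3, g6, r2']
  linear_combination (norm := (ring_nf; simp only [Complex.I_sq]; ring1)) -r1

/-- The model map for a basis is conjugate to the one for any other basis, by the invariance of
the type decomposition. -/
theorem IsModel.rank_of_span (h : IsModel φ ζ K) (h₀ : IsModel φ₀ ζ₀ K₀) {p : ℕ}
    {b b₀ : Fin p → E6} (hb : LinearIndependent ℝ b)
    (hspan : Submodule.span ℝ (range b₀) = ⊤) :
    Module.finrank ℝ (LinearMap.range (modelMap ζ K b)) ≤
      Module.finrank ℝ (LinearMap.range (modelMap ζ₀ K₀ b₀)) := by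
  have hA : ∀ i, ∃ c : Fin p → ℝ, ∑ j, c j • b₀ j = ζ₀.symm (ζ (b i)) := fun i =>
    (Submodule.mem_span_range_iff_exists_fun ℝ).1 (by rw [hspan]; trivial)
  choose A hA using hA
  -- `R` is the action on the components of 4-forms of the change of basis `A`, which expresses the
  -- vectors ζ₀⁻¹ζ b_i in terms of `b₀`.
  let R : ((Fin 4 → Fin p) → ℂ) →ₗ[ℝ] ((Fin 4 → Fin p) → ℂ) :=
    LinearMap.pi fun t => ∑ r : Fin 4 → Fin p, (∏ i, A (t i) (r i)) •
      (LinearMap.proj (R := ℝ) (φ := fun _ : Fin 4 → Fin p => ℂ) r)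
  have hle : LinearMap.range (modelMap ζ K b) ≤ (LinearMap.range (modelMap ζ₀ K₀ b₀)).map R := by
    rintro _ ⟨δ, rfl⟩
    -- `K` and `K₀` have the same image, the variations of Υ₀, so the fibre components can be
    -- carried from one model to the other.
    have hδ : ∀ i, ∃ f, K₀ f = K (δ i) := fun i => by
      obtain ⟨τ, hτ⟩ := h.mem (δ i)
      rw [hτ]
      exact h₀.surj τ
    choose δ' hδ' using hδ
    have hli : LinearIndependent ℝ fun i => ζ₀.symm (ζ (b i)) :=
      hb.map' (ζ.trans ζ₀.symm).toLinearEquiv.toLinearMap (ζ.trans ζ₀.symm).toLinearEquiv.ker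
    -- The transported fibre components are extended to a linear map of the base. The vectors of one
    -- plane are then combinations, with matrix `A`, of the vectors u_j of its graph over `b₀`.
    obtain ⟨V, hV⟩ := LinearMap.exists_extend ((Module.Basis.span hli).constr ℝ δ')
    have hVi : ∀ i, V (ζ₀.symm (ζ (b i))) = δ' i := fun i => by
      have h1 : ζ₀.symm (ζ (b i)) = ((Module.Basis.span hli i :
          Submodule.span ℝ (range fun i => ζ₀.symm (ζ (b i)))) : E6) := by
        simp [Module.Basis.span_apply]
      have h2 := congrArg (fun L => L (Module.Basis.span hli i)) hV
      simp only [LinearMap.comp_apply, Module.Basis.constr_basis] at h2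
      rw [← h2, h1]
      rfl
    refine ⟨modelMap ζ₀ K₀ b₀ fun j => V (b₀ j), ⟨_, rfl⟩, ?_⟩
    funext t
    let u : Fin p → N := fun j => (b₀ j, V (b₀ j))
    have h3 : modelMap ζ K b δ t =
        φ₀ fun i => ∑ j, A (t i) j • u j := by
      have h4 : (fun i => ∑ j, A (t i) j • u j) =
          (fun i => ((ζ₀.symm (ζ (b i)), δ' i) : N)) ∘ t := by
        funext i
        refine Prod.ext ?_ ?_
        · rw [Prod.fst_sum]
          exact hA (t i)
        · rw [Prod.snd_sum]
          change ∑ j, A (t i) j • V (b₀ j) = δ' (t i)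
          simp only [← map_smul]
          rw [← map_sum, hA, hVi]
      rw [h4, h₀.apply_eq_modelMap]
      change ∑ i : Fin 4, (-1 : ℂ) ^ (i : ℕ) * K (δ (t i)) (fun j => ζ (b (t (i.succAbove j)))) =
        ∑ i : Fin 4, (-1 : ℂ) ^ (i : ℕ) *
          K₀ (δ' (t i)) (fun j => ζ₀ (ζ₀.symm (ζ (b (t (i.succAbove j))))))
      simp only [hδ', ContinuousLinearEquiv.apply_symm_apply]
    rw [h3]
    have h5 := φ₀.toAlternatingMap.toMultilinearMap.map_sum (fun i j => A (t i) j • u j)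
    refine Eq.trans ?_ h5.symm
    change (∑ r : Fin 4 → Fin p, (∏ i, A (t i) (r i)) •
      (LinearMap.proj (R := ℝ) (φ := fun _ : Fin 4 → Fin p => ℂ) r))
        (modelMap ζ₀ K₀ b₀ fun j => V (b₀ j)) = _
    rw [LinearMap.sum_apply]
    refine Finset.sum_congr rfl fun r _ => ?_
    have h6 := φ₀.toAlternatingMap.toMultilinearMap.map_smul_univ (fun i => A (t i) (r i))
      (fun i => u (r i))
    refine Eq.trans ?_ h6.symm
    rw [LinearMap.smul_apply]
    congr 1
    exact (h₀.apply_eq_modelMap u r).symm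
  exact (Submodule.finrank_mono hle).trans (Submodule.finrank_map_le _ _)

end Rank

end SLBundle

namespace SLBundle

/-! ### Transverse integral elements are ordinary. -/

section Ordinary

variable {M : Type*} [TopologicalSpace M] [ChartedSpace E6 M] [IsManifold 𝓘(ℝ, E6) ∞ M]

theorem exists_dual_functionals {p : ℕ} {b : Fin p → E6} (hb : LinearIndependent ℝ b) :
    ∃ l : Fin p → E6 →L[ℝ] ℝ, ∀ i j, l i (b j) = if j = i then 1 else 0 := by
  choose g hg using fun i => LinearMap.exists_extend ((Module.Basis.span hb).coord i)
  refine ⟨fun i => LinearMap.toContinuousLinearMap (g i), fun i j => ?_⟩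
  have h1 : b j = (Submodule.span ℝ (range b)).subtype (Module.Basis.span hb j) := by
    simp [Module.Basis.span_apply]
  have h2 := congrArg (fun L => L (Module.Basis.span hb j)) (hg i)
  simp only [LinearMap.comp_apply, Module.Basis.coord_apply, Module.Basis.repr_self,
    Finsupp.single_apply] at h2
  rw [← h2, LinearMap.coe_toContinuousLinearMap', ← h1]

/-- The slopes that move the basis vectors of a plane in the fibre directions. -/
def fibreSlope {p : ℕ} (ℓ : EDS.Coord N p) :
    (Fin p → Fib) →L[ℝ] N × (Fin p → Fin (Module.finrank ℝ N - p) → ℝ) :=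
  (ContinuousLinearMap.inr ℝ N (Fin p → Fin (Module.finrank ℝ N - p) → ℝ)).comp
    (ContinuousLinearMap.pi fun i => (ContinuousLinearMap.snd ℝ (Fin p → ℝ)
      (Fin (Module.finrank ℝ N - p) → ℝ)).comp ((ℓ : N →L[ℝ] _).comp
        ((ContinuousLinearMap.inr ℝ E6 Fib).comp (ContinuousLinearMap.proj i))))

theorem slopeVector_add_fibreSlope {p : ℕ} {ℓ : EDS.Coord N p} (hℓ : ∀ f : Fib, (ℓ (0, f)).1 = 0)
    (s : Fin p → Fin (Module.finrank ℝ N - p) → ℝ) (δ : Fin p → Fib) (i : Fin p) :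
    EDS.slopeVector ℓ (s + (fibreSlope ℓ δ).2) i = EDS.slopeVector ℓ s i + (0, δ i) := by
  unfold EDS.slopeVector
  rw [ℓ.symm_apply_eq, map_add, ℓ.apply_symm_apply]
  refine Prod.ext ?_ rfl
  change Pi.single i 1 = Pi.single i 1 + (ℓ (0, δ i)).1
  rw [hℓ, add_zero]

/-- The derivative of the function `θ̂` in the fibre directions. -/
theorem fderiv_hat_fibreSlope {p : ℕ} {z : J M} {ℓ : EDS.Coord N p}
    (hℓ : ∀ f : Fib, (ℓ (0, f)).1 = 0) {θ : EDS.DForm N (J M) p ℝ} (hθ : EDS.SmoothCoeff θ z)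
    {y : N} (hy : y ∈ (chartAt N z).target) (hlin : FibreLinear (EDS.inChart θ z y))
    (s : Fin p → Fin (Module.finrank ℝ N - p) → ℝ) (δ : Fin p → Fib) :
    fderiv ℝ (EDS.hat z ℓ θ) (y, s) (fibreSlope ℓ δ) =
      EDS.inChart θ z y fun i => ((EDS.slopeVector ℓ s i).1, δ i) := by
  have hd : DifferentiableAt ℝ (EDS.hat z ℓ θ) (y, s) :=
    ((hθ.contDiffOn_hat ℓ).contDiffAt (((chartAt N z).open_target.prod isOpen_univ).mem_nhds
      ⟨hy, trivial⟩)).differentiableAt (by simp)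
  obtain ⟨L, hL⟩ := hlin fun i => (EDS.slopeVector ℓ s i).1
  rw [← hd.lineDeriv_eq_fderiv, hL]
  -- Along a fibre direction the base components of the slope vectors stay fixed, so by fibre
  -- linearity the function is affine in t.
  have h1 : ∀ t : ℝ, EDS.hat z ℓ θ ((y, s) + t • fibreSlope ℓ δ) =
      L (fun i => (EDS.slopeVector ℓ s i).2) + t * L δ := by
    intro t
    rw [← smul_eq_mul, ← L.map_smul, ← L.map_add, ← hL, ← (fibreSlope ℓ).map_smul]
    have h2 : ((y, s) + fibreSlope ℓ (t • δ)) = (y, s + (fibreSlope ℓ (t • δ)).2) :=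
      Prod.ext (add_zero y) rfl
    rw [h2]
    change EDS.inChart θ z y (EDS.slopeVector ℓ (s + (fibreSlope ℓ (t • δ)).2)) = _
    congr 1
    funext i
    rw [slopeVector_add_fibreSlope hℓ]
    exact Prod.ext (add_zero _) rfl
  have h3 : HasDerivAt (fun t : ℝ => L (fun i => (EDS.slopeVector ℓ s i).2) + t * L δ) (L δ) 0 := by
    simpa using ((hasDerivAt_id (0 : ℝ)).mul_const (L δ)).const_add
      (L fun i => (EDS.slopeVector ℓ s i).2)
  rw [lineDeriv]
  simp only [h1]
  exact h3.deriv

/-- A transverse integral element of dimension at most three is ordinary. -/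
theorem isOrdinary_of_le_three (z : J M) {p : ℕ} (hp : p ≤ 3) {P : Submodule ℝ N}
    (hP : Module.finrank ℝ P = p) (hT : TransverseN P) :
    EDS.IsOrdinary (idealJ M) (grOf z (mem_chart_target N z) hP) := by
  obtain ⟨e, he, rfl⟩ := exists_basis_of_finrank hP
  obtain ⟨ℓ, hℓ, -⟩ := exists_adapted_coord ((transverseN_span_iff he).1 hT)
  -- The ideal begins in degree 4, so every plane of dimension at most three is integral and the
  -- empty system of equations serves.
  refine ⟨(grOf_mem_V_iff z _ hP).2 (vanishOn_of_finrank_le_three (hP.le.trans hp)), z, ℓ, univ, 0,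
    Fin.elim0, isOpen_univ, ⟨(⟨_, mem_chart_target N z⟩, 0), trivial,
      graphPlane_eq_grOf z ℓ _ (by rw [hℓ]) hP⟩, fun j => j.elim0,
    fun w _ => linearIndependent_empty_type, fun w _ => ⟨fun _ j => j.elim0, fun _ => ?_⟩⟩
  rw [graphPlane_eq_grOf z ℓ w rfl (finrank_span_slopeVector ℓ w.2), grOf_mem_V_iff]
  exact vanishOn_of_finrank_le_three ((finrank_span_slopeVector ℓ w.2).le.trans hp)

variable (M) in
/-- The generators of `𝒥`, as a family. -/
def generator : Bool → EDS.DForm N (J M) 4 ℝ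
  | true => fun z => Complex.reCLM.compContinuousAlternatingMap (EDS.extD gamma z)
  | false => fun z => Complex.imCLM.compContinuousAlternatingMap (EDS.extD gamma z)

theorem generator_mem_idealJ (c : Bool) : generator M c ∈ idealJ M 4 := by
  cases c
  · exact .gen _ IsGenerator.im
  · exact .gen _ IsGenerator.re

theorem smoothCoeff_generator (c : Bool) (z : J M) : EDS.SmoothCoeff (generator M c) z := by
  cases c
  · exact smoothCoeff_im z
  · exact smoothCoeff_re z

theorem IsModel.fibreLinear_generator {z : J M} {y : N} {ζ : E6 ≃L[ℝ] C3}
    {K : Fib →ₗ[ℝ] ((Fin 3 → C3) → ℂ)} (h : IsModel (omega z y) ζ K) (c : Bool) :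
    FibreLinear (EDS.inChart (generator M c) z y) := by
  cases c
  · exact h.fibreLinear Complex.imCLM
  · exact h.fibreLinear Complex.reCLM

theorem inChart_generator_eq_zero {z : J M} {y : N} {v : Fin 4 → N} (h : omega z y v = 0)
    (c : Bool) : EDS.inChart (generator M c) z y v = 0 := by
  cases c
  · exact congrArg Complex.im h
  · exact congrArg Complex.re h

theorem omega_eq_zero {z : J M} {y : N} {v : Fin 4 → N}
    (h : ∀ c, EDS.inChart (generator M c) z y v = 0) : omega z y v = 0 :=
  Complex.ext (h true) (h false)

/-- A transverse integral element is ordinary if the rank of the linearized equations, in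
the fibre directions, has a maximum there. -/
theorem isOrdinary_of_rank [T2Space M] (z : J M) {k : ℕ} {P : Submodule ℝ N}
    (hP : Module.finrank ℝ P = 4 + k) {e : Fin (4 + k) → N} (he : P = Submodule.span ℝ (range e))
    (hb : LinearIndependent ℝ fun i => (e i).1) (hv : VanishOn (omega z (chartAt N z z)) P)
    (hrank : ∀ (φ : N [⋀^Fin 4]→L[ℝ] ℂ) (ζ : E6 ≃L[ℝ] C3) (K : Fib →ₗ[ℝ] ((Fin 3 → C3) → ℂ)),
      IsModel φ ζ K → ∀ b : Fin (4 + k) → E6, LinearIndependent ℝ b →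
      ∀ (ζ₀ : E6 ≃L[ℝ] C3) (K₀ : Fib →ₗ[ℝ] ((Fin 3 → C3) → ℂ)),
      IsModel (omega z (chartAt N z z)) ζ₀ K₀ →
      Module.finrank ℝ (LinearMap.range (modelMap ζ K b)) ≤
        Module.finrank ℝ (LinearMap.range (modelMap ζ₀ K₀ fun i => (e i).1))) :
    EDS.IsOrdinary (idealJ M) (grOf z (mem_chart_target N z) hP) := by
  obtain ⟨ℓ, hℓ, hfib⟩ := exists_adapted_coord hb
  obtain ⟨l, hl⟩ := exists_dual_functionals hb
  -- The differentials of the functions `G i` are a dual basis of the base components of `e` at the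
  -- central point; nothing is required of them elsewhere.
  choose G hG hGl using fun i => exists_contMDiff_fderiv_eq z.base (l i)
  choose ζ K hK using fun w : EDS.GrCoord N (4 + k) z => exists_isModel_omega z w.1.2
  let w₀ : EDS.GrCoord N (4 + k) z := (⟨chartAt N z z, mem_chart_target N z⟩, 0)
  let base : EDS.GrCoord N (4 + k) z → Fin (4 + k) → E6 := fun w i => (EDS.slopeVector ℓ w.2 i).1
  have hbase₀ : base w₀ = fun i => (e i).1 := by
    funext i
    change (EDS.slopeVector ℓ 0 i).1 = _
    rw [hℓ]
  -- The candidate equations: Re dγ or Im dγ times k of the differentials d(G i ∘ π̄), forms of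
  -- degree 4 + k in the ideal.
  let θ : Bool × (Fin k → Fin (4 + k)) → EDS.DForm N (J M) (4 + k) ℝ := fun a =>
    EDS.chainForm (generator M a.1) k fun j => dBase (G (a.2 j))
  have hθI : ∀ a, θ a ∈ idealJ M (4 + k) := fun a =>
    EDS.chainForm_mem_ideal (generator_mem_idealJ a.1) fun j => isSmoothForm_dBase (hG _)
  have hθS : ∀ a, EDS.SmoothCoeff (θ a) z := fun a =>
    (smoothCoeff_generator a.1 z).chainForm fun j => smoothCoeff_dBase (hG _) z
  have hθL : ∀ a (w : EDS.GrCoord N (4 + k) z), FibreLinear (EDS.inChart (θ a) z w.1) := by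
    intro a w
    simp only [θ, EDS.inChart_chainForm]
    exact ((hK w).fibreLinear_generator a.1).chain fun j v => inChart_dBase (hG _) z w.1.2 v
  let mc : Bool × (Fin k → Fin (4 + k)) → EDS.GrCoord N (4 + k) z →
      ((Fin (4 + k) → Fib) →L[ℝ] ℝ) := fun a w =>
    (fderiv ℝ (EDS.hat z ℓ (θ a)) ((w.1 : N), w.2)).comp (fibreSlope ℓ)
  have hmc : ∀ a w δ, mc a w δ = EDS.inChart (θ a) z w.1 fun i => (base w i, δ i) :=
    fun a w δ => fderiv_hat_fibreSlope hfib (hθS a) w.1.2 (hθL a w) w.2 δ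
  -- The function φ̂ is its own fibre derivative, evaluated at the fibre components of the plane.
  -- Its zeros are thus described by kernels of the functionals `mc`.
  have hhat : ∀ a (w : EDS.GrCoord N (4 + k) z), EDS.hat z ℓ (θ a) ((w.1 : N), w.2) =
      mc a w fun i => (EDS.slopeVector ℓ w.2 i).2 := fun a w => by
    rw [hmc]
    rfl
  have hmcC : ∀ a, Continuous (mc a) := by
    intro a
    have h1 := ((hθS a).contDiffOn_hat ℓ).continuousOn_fderiv_of_isOpen
      ((chartAt N z).open_target.prod isOpen_univ) (by simp)
    have h2 : Continuous fun w : EDS.GrCoord N (4 + k) z =>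
        fderiv ℝ (EDS.hat z ℓ (θ a)) ((w.1 : N), w.2) :=
      h1.comp_continuous ((continuous_subtype_val.comp continuous_fst).prodMk continuous_snd)
        fun w => ⟨w.1.2, trivial⟩
    exact h2.clm_comp continuous_const
  let D : EDS.GrCoord N (4 + k) z → (Fin (4 + k) → Fib) →ₗ[ℝ] ((Fin 4 → Fin (4 + k)) → ℂ) :=
    fun w => modelMap (ζ w) (K w) (base w)
  have hD : ∀ w δ t, D w δ t = omega z w.1 ((fun i => ((base w i, δ i) : N)) ∘ t) :=
    fun w δ t => ((hK w).apply_eq_modelMap (fun i => (base w i, δ i)) t).symm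
  have hm : ∀ a w δ, D w δ = 0 → mc a w δ = 0 := by
    intro a w δ h0
    rw [hmc]
    simp only [θ, EDS.inChart_chainForm]
    refine EDS.chain_eq_zero _ k _ (fun i => ((base w i, δ i) : N)) (fun t => ?_) id
    refine inChart_generator_eq_zero ?_ a.1
    rw [← hD, h0]
    rfl
  -- At the central point the 1-forms are dual to the basis, so the products with them recover every
  -- component of dγ on the plane.
  have hm₀ : ∀ δ, (∀ a, mc a w₀ δ = 0) → D w₀ δ = 0 := by
    intro δ h0
    funext t
    rw [hD]
    refine omega_eq_zero fun c => ?_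
    refine EDS.eq_zero_of_forall_chain_eq_zero _
      (fun i => EDS.inChart (dBase (G i)) z (chartAt N z z)) (fun i => ((base w₀ i, δ i) : N))
      (fun i j => ?_) (fun w => ?_) t
    · rw [inChart_dBase (hG i) z (mem_chart_target N z), chartAt_apply_fst, hGl i]
      change l i (base w₀ j) = _
      rw [hbase₀]
      exact hl i j
    · have h1 := h0 (c, w)
      rw [hmc] at h1
      simp only [θ, EDS.inChart_chainForm] at h1
      exact h1
  obtain ⟨q, a, hli₀, hker⟩ := exists_linearIndependent_functionals
    (fun a w => (mc a w).toLinearMap) D w₀ hm hm₀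
  have hli : ∀ w, LinearIndependent ℝ (fun j => mc (a j) w) →
      LinearIndependent ℝ (fun j => (mc (a j) w).toLinearMap) := fun w hw =>
    hw.map' (LinearMap.toContinuousLinearMap (𝕜 := ℝ) (E := Fin (4 + k) → Fib)
      (F' := ℝ)).symm.toLinearMap (LinearEquiv.ker _)
  -- The neighbourhood consists of the planes that are still transverse, so that `hrank` applies,
  -- and on which the selected functionals are still independent.
  refine ⟨(grOf_mem_V_iff z _ hP).2 hv, z, ℓ, {w | LinearIndependent ℝ (base w) ∧
    LinearIndependent ℝ (fun j => mc (a j) w)}, q, fun j => θ (a j), ?_, ?_, fun j => hθI _, ?_, ?_⟩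
  · refine IsOpen.inter ?_ ?_
    · exact isOpen_setOfPred_linearIndependent.preimage (continuous_pi fun i =>
        continuous_fst.comp ((continuous_slopeVector ℓ i).comp continuous_snd))
    · exact isOpen_setOfPred_linearIndependent.preimage (continuous_pi fun j => hmcC (a j))
  · refine ⟨w₀, ⟨by rw [hbase₀]; exact hb, ?_⟩, graphPlane_eq_grOf z ℓ _ ?_ hP⟩
    · exact LinearIndependent.of_comp (ContinuousLinearMap.coeLM ℝ) hli₀
    · change Submodule.span ℝ (range (EDS.slopeVector ℓ 0)) = P
      rw [hℓ, he]
  -- The full differentials are independent since their restrictions to the fibre directions are.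
  · intro w hw
    refine LinearIndependent.of_comp (((ContinuousLinearMap.compL ℝ (Fin (4 + k) → Fib)
      (N × (Fin (4 + k) → Fin (Module.finrank ℝ N - (4 + k)) → ℝ)) ℝ).flip
        (fibreSlope ℓ)).toLinearMap) ?_
    exact hw.2
  · intro w hw
    rw [graphPlane_eq_grOf z ℓ w rfl (finrank_span_slopeVector ℓ w.2), grOf_mem_V_iff,
      (hK w).vanishOn_iff_modelMap]
    simp only [hhat]
    constructor
    · intro h0 j
      exact hm (a j) w _ h0
    · intro h0
      have hr := hrank _ _ _ (hK w) _ hw.1 _ _ (hK w₀)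
      rw [← hbase₀] at hr
      exact hker w hr (hli w hw.2) _ h0

end Ordinary

end SLBundle

namespace SLBundle

/-! ### Regularity, and the case of dimension four. -/

section Regular

variable {M : Type*} [TopologicalSpace M] [ChartedSpace E6 M] [IsManifold 𝓘(ℝ, E6) ∞ M]

theorem extensionRank_eq {p : ℕ} {E E' : EDS.Gr N (J M) p}
    (h : Module.finrank ℝ (EDS.polarSpace (idealJ M) E'.plane) =
      Module.finrank ℝ (EDS.polarSpace (idealJ M) E.plane)) :
    EDS.extensionRank (idealJ M) E' = EDS.extensionRank (idealJ M) E := by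
  rw [EDS.extensionRank, EDS.extensionRank, h]

variable [T2Space M]

theorem isOrdinary_four {E : EDS.Gr N (J M) 4} (hE : E ∈ VJ M 4) :
    EDS.IsOrdinary (idealJ M) E := by
  obtain ⟨z, P, hP, rfl⟩ := exists_eq_grOf E
  obtain ⟨hv, hT⟩ := (grOf_mem_VJ_iff z _ hP).1 hE
  obtain ⟨e, he, hPe⟩ := exists_basis_of_finrank hP
  have hb := (transverseN_span_iff he).1 (hPe ▸ hT)
  exact isOrdinary_of_rank z (k := 0) hP hPe hb hv
    fun φ ζ K h b _ ζ₀ K₀ h₀ => h.rank_four h₀ b hb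

/-- The basis is adapted to one chosen model; as the rank depends on φ alone, `modelMap_eq` replaces
any other model at the point by that one. -/
theorem isOrdinary_five {E : EDS.Gr N (J M) 5} (hE : E ∈ VJ M 5) :
    EDS.IsOrdinary (idealJ M) E := by
  obtain ⟨z, P, hP, rfl⟩ := exists_eq_grOf E
  obtain ⟨hv, hT⟩ := (grOf_mem_VJ_iff z _ hP).1 hE
  obtain ⟨ζ₁, K₁, h₁⟩ := exists_isModel_omega z (mem_chart_target N z)
  obtain ⟨e, w₁, w₂, w₃, hw, he, hPe, e0, e1, e2, e3, e4⟩ := exists_adapted_basis_five ζ₁ hT hP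
  have hb := (transverseN_span_iff he).1 (hPe ▸ hT)
  refine isOrdinary_of_rank z (k := 1) hP hPe hb hv fun φ ζ K h b _ ζ₀ K₀ h₀ => ?_
  rw [h₀.modelMap_eq h₁]
  exact h.rank_five h₁ b hw e0 e1 e2 e3 e4

theorem isOrdinary_six {E : EDS.Gr N (J M) 6} (hE : E ∈ VJ M 6) :
    EDS.IsOrdinary (idealJ M) E := by
  obtain ⟨z, P, hP, rfl⟩ := exists_eq_grOf E
  obtain ⟨hv, hT⟩ := (grOf_mem_VJ_iff z _ hP).1 hE
  obtain ⟨e, he, hPe⟩ := exists_basis_of_finrank hP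
  have hb := (transverseN_span_iff he).1 (hPe ▸ hT)
  exact isOrdinary_of_rank z (k := 2) hP hPe hb hv fun φ ζ K h b hbl ζ₀ K₀ h₀ =>
    h.rank_of_span h₀ hbl (hb.span_eq_top_of_card_eq_finrank' (by simp))

theorem isOrdinary_of_mem_VJ {p : Fin 7} {E : EDS.Gr N (J M) p} (hE : E ∈ VJ M p) :
    EDS.IsOrdinary (idealJ M) E := by
  have hle : ∀ {p : ℕ} (_ : p ≤ 3) {E : EDS.Gr N (J M) p}, E ∈ VJ M p →
      EDS.IsOrdinary (idealJ M) E := by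
    intro p hp E hE
    obtain ⟨z, P, hP, rfl⟩ := exists_eq_grOf E
    exact isOrdinary_of_le_three z hp hP ((grOf_mem_VJ_iff z _ hP).1 hE).2
  fin_cases p
  · exact hle (by decide) hE
  · exact hle (by decide) hE
  · exact hle (by decide) hE
  · exact hle (by decide) hE
  · exact isOrdinary_four hE
  · exact isOrdinary_five hE
  · exact isOrdinary_six hE

/-- Here dim H is the same for all transverse integral elements, so the open set of transverse
planes serves as the neighbourhood. -/
theorem isRegular_of_ne_four {p : Fin 7} (hp : p ≠ 4) {E : EDS.Gr N (J M) p} (hE : E ∈ VJ M p) :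
    EDS.IsRegular (idealJ M) E := by
  refine ⟨isOrdinary_of_mem_VJ hE, transverseGr M p, isOpen_transverseGr p, hE.2,
    fun E' hE' => extensionRank_eq ?_⟩
  rw [finrank_polarSpace_eq hp ⟨hE'.2, hE'.1⟩, finrank_polarSpace_eq hp hE]

theorem isRegular_four {E : EDS.Gr N (J M) 4} (hE : E ∈ VJ M 4)
    (h : Module.finrank ℝ (EDS.polarSpace (idealJ M) E.plane) = 18) :
    EDS.IsRegular (idealJ M) E := by
  refine ⟨isOrdinary_four hE, generalGr M, isOpen_generalGr, (mem_generalGr_iff hE.1).2 h,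
    fun E' hE' => extensionRank_eq ?_⟩
  rw [h, (mem_generalGr_iff hE'.2).1 hE'.1]

variable (M) in
-- The natural number p, equal to 4 by hypothesis, is left variable so that the result applies to
-- the value of an element of `Fin 7`, on which the types of the planes depend.
theorem polarSpace_four {p : ℕ} (hp : p = 4) :
    (∀ E ∈ VJ M p, 18 ≤ Module.finrank ℝ (EDS.polarSpace (idealJ M) E.plane)) ∧
    (∃ U : Set (VJ M p), IsOpen U ∧ Dense U ∧ ∀ E ∈ U,
      Module.finrank ℝ (EDS.polarSpace (idealJ M) E.1.plane) = 18) ∧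
    ∀ E ∈ VJ M p, Module.finrank ℝ (EDS.polarSpace (idealJ M) E.plane) = 18 →
      EDS.IsRegular (idealJ M) E := by
  subst hp
  have ho : IsOpen ((↑) ⁻¹' generalGr M : Set (VJ M 4)) :=
    isOpen_induced isOpen_generalGr
  have hf : ∀ E ∈ ((↑) ⁻¹' generalGr M : Set (VJ M 4)),
      Module.finrank ℝ (EDS.polarSpace (idealJ M) E.1.plane) = 18 := by
    rintro ⟨E, hE⟩ h
    exact (mem_generalGr_iff hE.1).1 h
  exact ⟨fun E hE => le_finrank_polarSpace_four hE, ⟨_, ho, dense_generalGr, hf⟩,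
    fun E hE h => isRegular_four hE h⟩

end Regular

end SLBundle

end

theorem proposition1 {M : Type*} [TopologicalSpace M] [T2Space M]
    [ChartedSpace SLBundle.E6 M] [IsManifold 𝓘(ℝ, SLBundle.E6) ∞ M] (p : Fin 7) :
    (∀ E ∈ SLBundle.VJ M p,
      SLBundle.m p ≤ Module.finrank ℝ (EDS.polarSpace (SLBundle.idealJ M) E.plane)) ∧
    (p ≠ 3 → p ≠ 4 → ∀ E ∈ SLBundle.VJ M p,
      Module.finrank ℝ (EDS.polarSpace (SLBundle.idealJ M) E.plane) = SLBundle.m p) ∧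
    (∃ U : Set (SLBundle.VJ M p), IsOpen U ∧ Dense U ∧ ∀ E ∈ U,
      Module.finrank ℝ (EDS.polarSpace (SLBundle.idealJ M) E.1.plane) = SLBundle.m p) ∧
    (∀ E ∈ SLBundle.VJ M p,
      Module.finrank ℝ (EDS.polarSpace (SLBundle.idealJ M) E.plane) = SLBundle.m p →
        EDS.IsRegular (SLBundle.idealJ M) E) := by
  by_cases hp : p = 4
  · have hn : (p : ℕ) = 4 := congrArg Fin.val hp
    have hm : SLBundle.m p = 18 := congrArg SLBundle.m hp
    obtain ⟨h₁, h₂, h₃⟩ := SLBundle.polarSpace_four M hn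
    rw [hm]
    exact ⟨h₁, fun _ h => absurd hp h, h₂, h₃⟩
  -- For p ≠ 4, including p = 3, the equality dim H = m_p holds on all of V_p, so the dense open
  -- subset is everything.
  · exact ⟨fun E hE => (SLBundle.finrank_polarSpace_eq hp hE).ge,
      fun _ _ E hE => SLBundle.finrank_polarSpace_eq hp hE,
      ⟨univ, isOpen_univ, dense_univ, fun E _ => SLBundle.finrank_polarSpace_eq hp E.2⟩,
      fun E hE _ => SLBundle.isRegular_of_ne_four hp hE⟩
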